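/- Let $\Omega$ be a finite set, $n\ge 1$ real, $H:\Omega\to\{0\}\cup[1,n]$, and let $\beta_{\min}<\beta_{\max}$ be real. Write $Z(\beta)=\sum_{x\in\Omega}e^{-\beta H(x)}$, $\mu_\beta(x)=e^{-\beta H(x)}/Z(\beta)$, $Q=Z(\beta_{\min})/Z(\beta_{\max})$ and $q=\ln Q$. Suppose that an oracle is available which on input $\beta\in[\beta_{\min},\beta_{\max}]$ returns an independent exact sample from $\mu_\beta$. Consider the following algorithm with integer parameters $d,k,r\ge 1$, where $k=md$. 1. (TPA) One run: start at $\beta=\beta_{\min}$; repeatedly sample $X\sim\mu_\beta$ with the oracle, draw $U$ uniform on $[0,1]$ and replace $\beta$ by $\beta-\ln U/H(X)$ (by $+\infty$ if $H(X)=0$); if the new $\beta$ lies in $[\beta_{\min},\beta_{\max}]$, output it and continue, otherwise terminate the run. Let $\mathcal B$ be the union (as multisets) of the outputs of $k$ independent runs. 2. (Schedule) Sort $\mathcal B$, choose $c\in\{1,\dots,d\}$ uniformly at random, keep the points with indices $c,c+d,c+2d,\dots$, and add $\beta_{\min}$ at the beginning and $\beta_{\max}$ at the end. This gives $\beta_{\min}=\beta_0\le\beta_1\le\dots\le\beta_\ell=\beta_{\max}$.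 3. (Paired product estimator) Independently $r$ times: sample $X_i\sim\mu_{\beta_i}$ independently for $0\le i\le\ell$ with the oracle, and compute $W=\prod_{i<\ell}e^{-\frac{\beta_{i+1}-\beta_i}{2}H(X_i)}$ and $V=\prod_{i<\ell}e^{\frac{\beta_{i+1}-\beta_i}{2}H(X_{i+1})}$. Output $\hat Q=\bar V/\bar W$, where $\bar V,\bar W$ are the averages of the $r$ values. Let $\Gamma(a,b)=\int_b^\infty t^{a-1}e^{-t}\,dt$ and $$\tau_\rho(d)=\min_{\tau\ge 0,\ \tau^+>0}\left\{\tau+\tau^+ \;:\; \frac{\Gamma(d+2,\tau d)}{\tau^+\cdot d\cdot d!}\le 1-\rho\right\}.$$ Let $\varepsilon>0$ and $\tilde\varepsilon=1-(1+\varepsilon)^{-1/2}$ (so that $\tilde\varepsilon=\frac12\varepsilon+O(\varepsilon^2)$ as $\varepsilon\to0$). **Theorem.** Suppose that for some $\gamma\in(0,0.25)$, $\rho=\frac{0.75}{1-\gamma}$ and $\lambda\in(0,1)$ we have $(1+\frac12\gamma r\tilde\varepsilon^2)(1-\lambda)>1$ and $$m\ \ge\ \frac{\tau_\rho(d)\,\bigl(2+\ln\frac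 n\lambda\bigr)}{2\ln\left[\left(1+\frac12\gamma r\tilde\varepsilon^{2}\right)(1-\lambda)\right]}.\qquad(*)$$ Then $\hat Q\in\left(\frac{Q}{1+\varepsilon},\,Q(1+\varepsilon)\right)$ with probability at least $0.75$. The expected number of oracle calls made by the algorithm is $mq(r+d)+2r+md$; if the $k=md$ calls on which the $k$ runs of TPA terminate are charged as a single call, the expected number is $mq(r+d)+2r+1$. For example, $(*)$ and the condition preceding it are satisfied with $\gamma=0.24$ and $\lambda=e^{-7}$ for $d=64$, every real $m\ge 3.6\,(9+\ln n)$ and $r=\lceil 2\tilde\varepsilon^{-2}\rceil$; here $\lceil 2\tilde\varepsilon^{-2}\rceil=8(1+o(1))\varepsilon^{-2}$ as $\varepsilon\to0^+$. -/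

import Mathlib

open MeasureTheory ProbabilityTheory Filter Topology Asymptotics
open scoped ENNReal unitInterval

noncomputable section

namespace GibbsTPA

/-! ### Gibbs distributions and sampling oracles -/

/-- The partition function `Z(β) = ∑ₓ exp(-β H(x))`. -/
def partitionFn {Ω : Type*} [Fintype Ω] (H : Ω → ℝ) (β : ℝ) : ℝ :=
  ∑ x, Real.exp (-β * H x)

/-- The Gibbs weight `μ_β(x) = exp(-β H(x)) / Z(β)`. -/
def gibbs {Ω : Type*} [Fintype Ω] (H : Ω → ℝ) (β : ℝ) (x : Ω) : ℝ :=
  Real.exp (-β * H x) / partitionFn H β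

/-- An exact sampling oracle for the family `μ_β`, `β ∈ [βmin, βmax]`. One call with parameter `β`
draws a fresh seed `s ∼ ν` and returns `φ β s`, which has law `μ_β`. The seeds carry the internal
randomness of the oracle; different calls use independent seeds. -/
structure IsSamplingOracle {Ω : Type*} [Fintype Ω] (H : Ω → ℝ) (βmin βmax : ℝ)
    {S : Type*} [MeasurableSpace S] (ν : Measure S) (φ : ℝ → S → Ω) : Prop where
  measurable : ∀ x, MeasurableSet {p : ℝ × S | φ p.1 p.2 = x}
  law : ∀ β ∈ Set.Icc βmin βmax, ∀ x, ν {s | φ β s = x} = ENNReal.ofReal (gibbs H β x)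

/-! ### The randomness used by the algorithm -/

/-- All the random draws. First component: for each of the `k` runs of TPA and each step of the run,
a seed for the oracle call and the uniform variable `U ∈ [0,1]`. Second component: for each of the
`r` repetitions of the paired product estimator and each index `i`, a seed for the oracle call at
`βᵢ`. Third component: the offset (counted from `0`) of the first point to be kept. -/
abbrev Draws (S : Type*) (d k r : ℕ) : Type _ :=
  (Fin k → ℕ → S × I) × (Fin r → ℕ → S) × Fin d

/-- All draws are independent, seeds have law `ν`, and the remaining draws are uniform. -/
def drawsLaw {S : Type*} [MeasurableSpace S] (ν : Measure S) [IsProbabilityMeasure ν]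
    (d k r : ℕ) : Measure (Draws S d k r) :=
  (Measure.pi fun _ : Fin k => Measure.infinitePi fun _ : ℕ => ν.prod (volume : Measure I)).prod
    ((Measure.pi fun _ : Fin r => Measure.infinitePi fun _ : ℕ => ν).prod
      (uniformOn (Set.univ : Set (Fin d))))

/-! ### TPA -/

/-- One iteration of TPA from the current value `β`, given the sample `x ∼ μ_β` and the
uniform variable `u`: the new value is `β - ln u / H(x)` (or `+∞` if `H(x) = 0`). The result is
`none` if the new value is not in `[βmin, βmax]`, in which case the run terminates. -/
def tpaStep {Ω : Type*} (H : Ω → ℝ) (βmin βmax β : ℝ) (x : Ω) (u : ℝ) : Option ℝ :=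
  open Classical in
  if H x ≠ 0 ∧ β - Real.log u / H x ∈ Set.Icc βmin βmax
  then some (β - Real.log u / H x) else none

/-- The state of one run of TPA after `i` iterations; `none` means that it has terminated.
Iteration `i + 1` is executed, and then makes exactly one oracle call, iff the state after `i`
iterations is not `none`. -/
def tpaState {Ω S : Type*} (H : Ω → ℝ) (βmin βmax : ℝ) (φ : ℝ → S → Ω) (w : ℕ → S × I) :
    ℕ → Option ℝ
  | 0 => some βmin
  | i + 1 => (tpaState H βmin βmax φ w i).bind fun β =>
      tpaStep H βmin βmax β (φ β (w i).1) (w i).2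

/-- The number of oracle calls of one run of TPA. -/
def tpaCalls {Ω S : Type*} (H : Ω → ℝ) (βmin βmax : ℝ) (φ : ℝ → S → Ω) (w : ℕ → S × I) : ℕ∞ :=
  {i : ℕ | tpaState H βmin βmax φ w i ≠ none}.encard

/-- The number of points output by one run of TPA. -/
def tpaSize {Ω S : Type*} (H : Ω → ℝ) (βmin βmax : ℝ) (φ : ℝ → S → Ω) (w : ℕ → S × I) : ℕ∞ :=
  {i : ℕ | tpaState H βmin βmax φ w (i + 1) ≠ none}.encard

/-- The multiset of points output by one run of TPA. (On the null event that the run does not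
terminate, this is the empty multiset.) -/
def tpaRun {Ω S : Type*} (H : Ω → ℝ) (βmin βmax : ℝ) (φ : ℝ → S → Ω) (w : ℕ → S × I) :
    Multiset ℝ :=
  ((List.range (tpaSize H βmin βmax φ w).toNat).filterMap fun i =>
    tpaState H βmin βmax φ w (i + 1) : List ℝ)

/-- `TPA(k)`: the union of `k` runs. -/
def tpaUnion {Ω S : Type*} (H : Ω → ℝ) (βmin βmax : ℝ) (φ : ℝ → S → Ω) {k : ℕ}
    (w : Fin k → ℕ → S × I) : Multiset ℝ :=
  ∑ j, tpaRun H βmin βmax φ (w j)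

/-! ### The schedule -/

/-- Keep the entries of a list at the positions `c, c + d, c + 2d, …`
(positions are counted from `0`, and `c < d`). -/
def keepEvery {d : ℕ} (c : Fin d) (L : List ℝ) : List ℝ :=
  L.zipIdx.filterMap fun p => if p.2 % d = c then some p.1 else none

/-- The schedule `(β₀, …, β_ℓ)`: sort `TPA(k)`, keep every `d`-th value starting from a uniformly
random one of the first `d`, and add `βmin` and `βmax`. -/
def schedule {Ω S : Type*} (H : Ω → ℝ) (βmin βmax : ℝ) (φ : ℝ → S → Ω) {d k r : ℕ}
    (ω : Draws S d k r) : List ℝ :=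
  βmin :: (keepEvery ω.2.2 ((tpaUnion H βmin βmax φ ω.1).sort (· ≤ ·)) ++ [βmax])

/-! ### The paired product estimator -/

/-- `W = ∏_{i < ℓ} exp(-(βᵢ₊₁ - βᵢ)/2 · H(Xᵢ))` with `Xᵢ = φ βᵢ (t i)`, for the schedule `B`. -/
def estW {Ω S : Type*} (H : Ω → ℝ) (φ : ℝ → S → Ω) (B : List ℝ) (t : ℕ → S) : ℝ :=
  ∏ i ∈ Finset.range (B.length - 1),
    Real.exp (-((B.getD (i + 1) 0 - B.getD i 0) / 2) * H (φ (B.getD i 0) (t i)))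

/-- `V = ∏_{i < ℓ} exp((βᵢ₊₁ - βᵢ)/2 · H(Xᵢ₊₁))` with `Xᵢ = φ βᵢ (t i)`, for the schedule `B`. -/
def estV {Ω S : Type*} (H : Ω → ℝ) (φ : ℝ → S → Ω) (B : List ℝ) (t : ℕ → S) : ℝ :=
  ∏ i ∈ Finset.range (B.length - 1),
    Real.exp ((B.getD (i + 1) 0 - B.getD i 0) / 2 * H (φ (B.getD (i + 1) 0) (t (i + 1))))

/-- The output `Q̂`: the ratio of the averages of `V` and of `W` over `r` independent samples. -/
def estimate {Ω S : Type*} (H : Ω → ℝ) (βmin βmax : ℝ) (φ : ℝ → S → Ω) {d k r : ℕ}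
    (ω : Draws S d k r) : ℝ :=
  ((∑ a, estV H φ (schedule H βmin βmax φ ω) (ω.2.1 a)) / r) /
    ((∑ a, estW H φ (schedule H βmin βmax φ ω) (ω.2.1 a)) / r)

/-- The number of oracle calls of the whole algorithm: those of the `k` runs of TPA, and `ℓ + 1`
for each of the `r` samples of `(W, V)`. -/
def oracleCalls {Ω S : Type*} (H : Ω → ℝ) (βmin βmax : ℝ) (φ : ℝ → S → Ω) {d k r : ℕ}
    (ω : Draws S d k r) : ℕ∞ :=
  (∑ j, tpaCalls H βmin βmax φ (ω.1 j)) + r * (schedule H βmin βmax φ ω).length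

/-- The number of oracle calls, when the `k` calls on which the `k` runs of TPA terminate (these
calls yield no point) are charged as a single call. -/
def mergedCalls {Ω S : Type*} (H : Ω → ℝ) (βmin βmax : ℝ) (φ : ℝ → S → Ω) {d k r : ℕ}
    (ω : Draws S d k r) : ℕ∞ :=
  ((∑ j, tpaSize H βmin βmax φ (ω.1 j)) + 1) + r * (schedule H βmin βmax φ ω).length

/-! ### The parameters -/

/-- The upper incomplete gamma function `Γ(a, b) = ∫_b^∞ t^{a-1} e^{-t} dt`. -/
def upperGamma (a b : ℝ) : ℝ :=
  ∫ t in Set.Ioi b, t ^ (a - 1) * Real.exp (-t)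

/-- `τ_ρ(d) = min {τ + τ⁺ : τ ≥ 0, τ⁺ > 0, Γ(d+2, τ d) / (τ⁺ · d · d!) ≤ 1 - ρ}`. -/
def tauRho (ρ : ℝ) (d : ℕ) : ℝ :=
  sInf {y | ∃ τ τp : ℝ, 0 ≤ τ ∧ 0 < τp ∧
    upperGamma (d + 2) (τ * d) / (τp * d * d.factorial) ≤ 1 - ρ ∧ y = τ + τp}

/-- `ε̃ = 1 - (1 + ε)^{-1/2}`. -/
def epsTilde (ε : ℝ) : ℝ := 1 - (1 + ε) ^ (-(1 / 2) : ℝ)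

/-- The condition `m ≥ τ_ρ(d) (2 + ln (n/λ)) / (2 ln [(1 + ½ γ r ε̃²)(1 - λ)])` with
`ρ = 0.75 / (1 - γ)`, where the logarithm in the denominator is required to be positive. -/
def SizeCondition (n ε m : ℝ) (d r : ℕ) (γ lam : ℝ) : Prop :=
  1 < (1 + 1 / 2 * γ * r * epsTilde ε ^ 2) * (1 - lam) ∧
  m ≥ tauRho (0.75 / (1 - γ)) d * (2 + Real.log (n / lam)) /
    (2 * Real.log ((1 + 1 / 2 * γ * r * epsTilde ε ^ 2) * (1 - lam)))

end GibbsTPA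

end

/-! Write z = ln Z. It is nonincreasing and convex, and -z' (`meanH`) is the mean of H under the
Gibbs law.

Poisson structure. One TPA step from β lands at b with density -Z'(b)/Z(β) and terminates with
probability Z(βmax)/Z(β). Iterating, the partition functions telescope (`lintegral_runWeight`), and
the expected product of f over the points of a run is exp ∫ (f - 1)(-z'). Hence the union of k runs
is a Poisson process, of rate k in the coordinate z (`lintegral_prod_tpaUnion`). Step functions f
give independent Poisson counts in adjacent intervals (`measure_tpaUnion_counts`).

Estimator. For a fixed schedule, E V / E W = Q, and E W² / (E W)² and E V² / (E V)² both equal the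
exponential of the total curvature, the sum of z(s) + z(t) - 2 z((s+t)/2) over the intervals [s, t].
Chebyshev's inequality makes the output accurate when the total curvature is small
(`measure_estimate_compl_le`).

Curvature. On one interval it is at most half the decrease of z times the decrease of ln(-z')
(`curvature_le_mul_log`). Writing the second factor as an integral, the total is at most ½ ∫ D(p)
d(-ln(-z'(p))), where D(p) is the decrease of z over the schedule interval containing p. This is
used up to a cutoff b, chosen so that ln(-z') decreases by at most ln(n/λ) before b and z decreases
by at most -ln(1-λ) after it (`exists_cutoff`). The interval straddling b contributes at most D(b),
which amounts to a mass 2 at b; this produces 2 + ln(n/λ).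

Random schedule. Around a fixed p the schedule interval spans at most d + 1 exponential gaps (not d:
the inspection paradox), so k D(p) is dominated by an Erlang variable of shape d + 1, whose mean
beyond τd is Γ(d+2, τd)/d! (`lintegral_gapAt_le`). Markov's inequality, applied only to the part of
k D(p) exceeding τd and integrated over p, bounds the total curvature by (τ+τ⁺)(2 + ln(n/λ))/(2m) -
ln(1-λ) with probability at least ρ (`exists_good_schedules`). When τ + τ⁺ is close to τ_ρ(d),
condition (*) makes this essentially ln(1 + ½γrε̃²). Then each of the two averages fails with
probability about γ/2, and ρ(1-γ) = 0.75.

Calls. The number of points is Poisson of mean kq, and averaging over the random first index keeps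
exactly a fraction 1/d of them. -/

noncomputable section

namespace GibbsTPA

/-! ### The partition function -/

section Partition

variable {Ω : Type*} [Fintype Ω] (H : Ω → ℝ)

/-- The first moment `∑ₓ H(x) exp(-β H(x)) = -Z'(β)`. -/
def partitionFn₁ (β : ℝ) : ℝ := ∑ x, H x * Real.exp (-β * H x)

/-- The second moment `∑ₓ H(x)² exp(-β H(x)) = Z''(β)`. -/
def partitionFn₂ (β : ℝ) : ℝ := ∑ x, H x ^ 2 * Real.exp (-β * H x)

/-- `z(β) = ln Z(β)`. -/
def logZ (β : ℝ) : ℝ := Real.log (partitionFn H β)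

/-- The mean `-z'(β)` of `H` under `μ_β`. -/
def meanH (β : ℝ) : ℝ := partitionFn₁ H β / partitionFn H β

/-- The rate `-(ln (-z'))'`. -/
def slopeRate (β : ℝ) : ℝ :=
  partitionFn₂ H β / partitionFn₁ H β - partitionFn₁ H β / partitionFn H β

lemma partitionFn_pos [Nonempty Ω] (β : ℝ) : 0 < partitionFn H β :=
  Finset.sum_pos (fun _ _ => Real.exp_pos _) Finset.univ_nonempty

lemma exp_logZ [Nonempty Ω] (β : ℝ) : Real.exp (logZ H β) = partitionFn H β :=
  Real.exp_log (partitionFn_pos H β)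

lemma hasDerivAt_partitionFn (β : ℝ) : HasDerivAt (partitionFn H) (-partitionFn₁ H β) β := by
  have : HasDerivAt (partitionFn H) (∑ x, Real.exp (-β * H x) * (-1 * H x)) β := by
    unfold partitionFn
    exact HasDerivAt.fun_sum fun x _ => (((hasDerivAt_id β).neg.mul_const (H x)).exp)
  convert this using 1
  rw [partitionFn₁, ← Finset.sum_neg_distrib]
  exact Finset.sum_congr rfl fun x _ => by ring

lemma hasDerivAt_partitionFn₁ (β : ℝ) : HasDerivAt (partitionFn₁ H) (-partitionFn₂ H β) β := by
  have : HasDerivAt (partitionFn₁ H) (∑ x, H x * (Real.exp (-β * H x) * (-1 * H x))) β := by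
    unfold partitionFn₁
    exact HasDerivAt.fun_sum fun x _ =>
      (((hasDerivAt_id β).neg.mul_const (H x)).exp).const_mul (H x)
  convert this using 1
  rw [partitionFn₂, ← Finset.sum_neg_distrib]
  exact Finset.sum_congr rfl fun x _ => by ring

lemma continuous_partitionFn : Continuous (partitionFn H) := by unfold partitionFn; fun_prop
lemma continuous_partitionFn₁ : Continuous (partitionFn₁ H) := by unfold partitionFn₁; fun_prop
lemma continuous_partitionFn₂ : Continuous (partitionFn₂ H) := by unfold partitionFn₂; fun_prop

lemma hasDerivAt_logZ [Nonempty Ω] (β : ℝ) : HasDerivAt (logZ H) (-meanH H β) β := by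
  have := (hasDerivAt_partitionFn H β).log (partitionFn_pos H β).ne'
  rwa [neg_div] at this

lemma continuous_logZ [Nonempty Ω] : Continuous (logZ H) :=
  continuous_iff_continuousAt.2 fun β => (hasDerivAt_logZ H β).continuousAt

lemma continuous_meanH [Nonempty Ω] : Continuous (meanH H) :=
  (continuous_partitionFn₁ H).div (continuous_partitionFn H) fun β => (partitionFn_pos H β).ne'

lemma measurable_slopeRate : Measurable (slopeRate H) := by
  have h1 := (continuous_partitionFn H).measurable
  have h2 := (continuous_partitionFn₁ H).measurable
  have h3 := (continuous_partitionFn₂ H).measurable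
  unfold slopeRate; fun_prop

/-- Cauchy–Schwarz: `Z'² ≤ Z'' Z`. -/
lemma partitionFn₁_sq_le (β : ℝ) :
    partitionFn₁ H β ^ 2 ≤ partitionFn₂ H β * partitionFn H β := by
  have := Finset.sum_mul_sq_le_sq_mul_sq Finset.univ
    (fun x => H x * Real.exp (-β * H x / 2)) (fun x => Real.exp (-β * H x / 2))
  have e : ∀ x, Real.exp (-β * H x / 2) ^ 2 = Real.exp (-β * H x) := fun x => by
    rw [← Real.exp_nat_mul]; congr 1; push_cast; ring
  simp only [mul_pow, e] at this
  calc partitionFn₁ H β ^ 2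
      = (∑ x, H x * Real.exp (-β * H x / 2) * Real.exp (-β * H x / 2)) ^ 2 := by
        unfold partitionFn₁
        simp only [← e, mul_assoc, pow_two]
    _ ≤ _ := this

variable {H}

lemma partitionFn₁_nonneg (hH : ∀ x, 0 ≤ H x) (β : ℝ) : 0 ≤ partitionFn₁ H β :=
  Finset.sum_nonneg fun x _ => mul_nonneg (hH x) (Real.exp_pos _).le

lemma meanH_nonneg [Nonempty Ω] (hH : ∀ x, 0 ≤ H x) (β : ℝ) : 0 ≤ meanH H β :=
  div_nonneg (partitionFn₁_nonneg hH β) (partitionFn_pos H β).le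

lemma meanH_le [Nonempty Ω] {n : ℝ} (hH : ∀ x, H x ≤ n) (β : ℝ) : meanH H β ≤ n := by
  rw [meanH, div_le_iff₀ (partitionFn_pos H β), partitionFn, Finset.mul_sum]
  exact Finset.sum_le_sum fun x _ => by gcongr; exact hH x

/-- Positivity of the first moment only says that some `H x` is positive, which does not involve β.
-/
lemma partitionFn₁_pos_of_pos (hH : ∀ x, 0 ≤ H x) {β : ℝ} (h : 0 < partitionFn₁ H β) (b : ℝ) :
    0 < partitionFn₁ H b := by
  obtain ⟨x, -, hx⟩ := Finset.exists_lt_of_sum_lt (s := Finset.univ) (f := fun _ : Ω => (0 : ℝ))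
    (g := fun x => H x * Real.exp (-β * H x)) (by rw [Finset.sum_const_zero]; exact h)
  have hx' : 0 < H x := pos_of_mul_pos_left hx (Real.exp_pos _).le
  exact Finset.sum_pos' (fun y _ => mul_nonneg (hH y) (Real.exp_pos _).le)
    ⟨x, Finset.mem_univ _, mul_pos hx' (Real.exp_pos _)⟩

lemma meanH_pos_of_pos [Nonempty Ω] (hH : ∀ x, 0 ≤ H x) {β : ℝ} (h : 0 < meanH H β) (b : ℝ) :
    0 < meanH H b :=
  div_pos (partitionFn₁_pos_of_pos hH ((div_pos_iff_of_pos_right (partitionFn_pos H β)).1 h) b)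
    (partitionFn_pos H b)

lemma antitone_logZ [Nonempty Ω] (hH : ∀ x, 0 ≤ H x) : Antitone (logZ H) :=
  antitone_of_hasDerivAt_nonpos (fun β => hasDerivAt_logZ H β)
    fun β => neg_nonpos.2 (meanH_nonneg hH β)

lemma hasDerivAt_meanH [Nonempty Ω] (β : ℝ) : HasDerivAt (meanH H)
    ((-partitionFn₂ H β * partitionFn H β - partitionFn₁ H β * -partitionFn₁ H β) /
      partitionFn H β ^ 2) β :=
  (hasDerivAt_partitionFn₁ H β).div (hasDerivAt_partitionFn H β) (partitionFn_pos H β).ne'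

/-- Convexity of ln Z: the derivative of the mean is minus the variance, which Cauchy–Schwarz
controls. -/
lemma antitone_meanH [Nonempty Ω] : Antitone (meanH H) :=
  antitone_of_hasDerivAt_nonpos (fun β => hasDerivAt_meanH β) fun β =>
    div_nonpos_of_nonpos_of_nonneg (by nlinarith [partitionFn₁_sq_le H β]) (sq_nonneg _)

lemma slopeRate_nonneg [Nonempty Ω] (hH : ∀ x, 0 ≤ H x) (β : ℝ) : 0 ≤ slopeRate H β := by
  rcases (partitionFn₁_nonneg hH β).eq_or_lt with h | h
  -- If H vanishes identically, both quotients are 0 because division by zero gives zero.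
  · simp [slopeRate, ← h]
  · have hZ := partitionFn_pos H β
    rw [slopeRate, div_sub_div _ _ h.ne' hZ.ne']
    exact div_nonneg (by nlinarith [partitionFn₁_sq_le H β]) (by positivity)

lemma hasDerivAt_log_meanH [Nonempty Ω] {β : ℝ} (h : 0 < meanH H β) :
    HasDerivAt (fun b => Real.log (meanH H b)) (-slopeRate H β) β := by
  have hZ := partitionFn_pos H β
  have h1 := (div_pos_iff_of_pos_right hZ).1 h
  convert (hasDerivAt_meanH β).log h.ne' using 1
  rw [slopeRate, meanH]
  field_simp
  ring

/-- The fundamental theorem of calculus for ln(-z'). Half-open intervals are used so that the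
intervals of a schedule tile without overlap. -/
lemma lintegral_slopeRate [Nonempty Ω] (hH : ∀ x, 0 ≤ H x) {s t : ℝ} (hst : s ≤ t)
    (hpos : 0 < meanH H t) :
    ∫⁻ b in Set.Ico s t, ENNReal.ofReal (slopeRate H b)
      = ENNReal.ofReal (Real.log (meanH H s) - Real.log (meanH H t)) := by
  have hp := meanH_pos_of_pos hH hpos
  have hp1 : ∀ b, partitionFn₁ H b ≠ 0 := fun b => by
    have := (div_pos_iff_of_pos_right (partitionFn_pos H b)).1 (hp b); exact this.ne'
  have hc : Continuous (slopeRate H) :=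
    ((continuous_partitionFn₂ H).div (continuous_partitionFn₁ H) hp1).sub
      ((continuous_partitionFn₁ H).div (continuous_partitionFn H)
        fun β => (partitionFn_pos H β).ne')
  have hint := intervalIntegral.integral_eq_sub_of_hasDerivAt (a := s) (b := t)
    (fun b _ => (hasDerivAt_log_meanH (hp b)).neg)
    ((hc.neg.neg).intervalIntegrable _ _)
  simp only [neg_neg] at hint
  rw [Measure.restrict_congr_set (μ := volume) Ico_ae_eq_Ioc,
    ← ofReal_integral_eq_lintegral_ofReal, ← intervalIntegral.integral_of_le hst, hint]
  · congr 1; simp only [Pi.neg_apply]; ring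
  · exact (hc.intervalIntegrable s t).1
  · exact ae_of_all _ fun b => slopeRate_nonneg hH b

/-- Once the mean of `H` is at most `lam < 1`, the remaining decrease of `ln Z` is at most
`-ln (1 - lam)`. -/
lemma logZ_sub_le_of_meanH_le [Nonempty Ω] (hH : ∀ x, H x = 0 ∨ 1 ≤ H x) {β lam : ℝ}
    (hlam : lam < 1) (h : meanH H β ≤ lam) (b : ℝ) :
    logZ H β - logZ H b ≤ -Real.log (1 - lam) := by
  classical
  have hZ := partitionFn_pos H β
  have key : (1 - lam) * partitionFn H β ≤ partitionFn H b := by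
    rw [meanH, div_le_iff₀ hZ] at h
    have h0 : partitionFn H β - partitionFn₁ H β ≤ partitionFn H b := by
      unfold partitionFn partitionFn₁
      rw [← Finset.sum_sub_distrib]
      -- Termwise, (1 - H) e^{-βH} equals 1 when H = 0 and is nonpositive when H ≥ 1. This is where
      -- the absence of values of H in (0, 1) matters.
      refine Finset.sum_le_sum fun x _ => ?_
      rcases hH x with hx | hx
      · simp [hx]
      · nlinarith [Real.exp_pos (-β * H x), Real.exp_pos (-b * H x)]
    linarith
  have := Real.log_le_log (by have := sub_pos.2 hlam; positivity) key
  rw [Real.log_mul (sub_pos.2 hlam).ne' hZ.ne'] at this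
  unfold logZ; linarith

/-- The curvature `z(s) + z(t) - 2 z((s+t)/2)` of an interval. -/
def curvature (H : Ω → ℝ) (s t : ℝ) : ℝ := logZ H s + logZ H t - 2 * logZ H ((s + t) / 2)

/-- A crude bound, used for the interval straddling the cutoff and for those beyond it, where
ln(-z') is not controlled. -/
lemma curvature_le_sub [Nonempty Ω] (hH : ∀ x, 0 ≤ H x) {s t : ℝ} (hst : s ≤ t) :
    curvature H s t ≤ logZ H s - logZ H t := by
  have := antitone_logZ hH (show (s + t) / 2 ≤ t by linarith)
  unfold curvature; linarith

/-- This is ln((1+v)/(1-v)) ≥ 2v, the first term of the series, at v = (x-y)/(x+y). -/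
lemma sub_le_half_mul_log_div {x y : ℝ} (hy : 0 < y) (hxy : y ≤ x) :
    x - y ≤ 1 / 2 * (x + y) * Real.log (x / y) := by
  have hs : 0 < x + y := by linarith
  have := Real.sum_range_le_log_div (x := (x - y) / (x + y))
    (div_nonneg (by linarith) hs.le) (by rw [div_lt_one hs]; linarith) 1
  have e : (1 + (x - y) / (x + y)) / (1 - (x - y) / (x + y)) = x / y := by
    have h2 : 1 + (x - y) / (x + y) = 2 * x / (x + y) := by field_simp; ring
    have h3 : 1 - (x - y) / (x + y) = 2 * y / (x + y) := by field_simp; ring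
    rw [h2, h3]; field_simp
  rw [e] at this
  simp only [Finset.range_one, Finset.sum_singleton, mul_zero, zero_add, pow_one, Nat.cast_zero,
    div_one] at this
  rw [div_le_iff₀ hs] at this
  linarith

/-- The curvature is x - y, where x and y are the decreases of z over the two halves. By the mean
value theorem x/y is a ratio of values of -z' inside the interval, hence at most the ratio at its
endpoints; `sub_le_half_mul_log_div` concludes. -/
lemma curvature_le_mul_log [Nonempty Ω] (hH : ∀ x, 0 ≤ H x) {s t : ℝ} (hst : s ≤ t)
    (hpos : 0 < meanH H t) :
    curvature H s t ≤ 1 / 2 * (logZ H s - logZ H t) *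
      (Real.log (meanH H s) - Real.log (meanH H t)) := by
  rcases hst.eq_or_lt with rfl | hst
  · have : (s + s) / 2 = s := by ring
    simp only [curvature, this]; linarith
  have hp := meanH_pos_of_pos hH hpos
  set c := (s + t) / 2 with hc
  have hsc : s < c := by rw [hc]; linarith
  have hct : c < t := by rw [hc]; linarith
  have hh : t - c = c - s := by rw [hc]; ring
  obtain ⟨p, hp1, hp2⟩ := exists_hasDerivAt_eq_slope (logZ H) (fun b => -meanH H b) hsc
    (continuous_logZ H).continuousOn fun b _ => hasDerivAt_logZ H b
  obtain ⟨q, hq1, hq2⟩ := exists_hasDerivAt_eq_slope (logZ H) (fun b => -meanH H b) hct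
    (continuous_logZ H).continuousOn fun b _ => hasDerivAt_logZ H b
  rw [eq_div_iff (sub_pos.2 hsc).ne'] at hp2
  rw [eq_div_iff (sub_pos.2 hct).ne', hh] at hq2
  have hcs := sub_pos.2 hsc
  have hx : logZ H s - logZ H c = meanH H p * (c - s) := by linarith
  have hy : logZ H c - logZ H t = meanH H q * (c - s) := by linarith
  have hqp : meanH H q ≤ meanH H p := antitone_meanH (hp1.2.trans hq1.1).le
  have hsp : meanH H p ≤ meanH H s := antitone_meanH hp1.1.le
  have htq : meanH H t ≤ meanH H q := antitone_meanH hq1.2.le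
  have hmain := sub_le_half_mul_log_div (x := logZ H s - logZ H c) (y := logZ H c - logZ H t)
    (by rw [hy]; exact mul_pos (hp q) hcs) (by rw [hx, hy]; gcongr)
  have hlog : Real.log ((logZ H s - logZ H c) / (logZ H c - logZ H t))
      ≤ Real.log (meanH H s) - Real.log (meanH H t) := by
    rw [hx, hy, mul_div_mul_right _ _ hcs.ne', Real.log_div (hp p).ne' (hp q).ne']
    have := Real.log_le_log (hp p) hsp
    have := Real.log_le_log hpos htq
    linarith
  have hnn : 0 ≤ 1 / 2 * (logZ H s - logZ H t) := by
    have := antitone_logZ hH (hsc.trans hct).le; linarith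
  calc curvature H s t = (logZ H s - logZ H c) - (logZ H c - logZ H t) := by
        rw [curvature]; ring
    _ ≤ _ := hmain
    _ = 1 / 2 * (logZ H s - logZ H t) *
        Real.log ((logZ H s - logZ H c) / (logZ H c - logZ H t)) := by ring
    _ ≤ _ := by gcongr

/-- A point `b` beyond which `ln Z` decreases by at most `-ln (1 - lam)`, and before which the
logarithm of the mean of `H` decreases by at most `ln (n / lam)`. -/
lemma exists_cutoff [Nonempty Ω] {n lam : ℝ} (hn : 1 ≤ n) (hH : ∀ x, H x = 0 ∨ H x ∈ Set.Icc 1 n)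
    (hlam : lam ∈ Set.Ioo (0 : ℝ) 1) {βmin βmax : ℝ} (hβ : βmin ≤ βmax) :
    ∃ b ∈ Set.Icc βmin βmax, logZ H b - logZ H βmax ≤ -Real.log (1 - lam) ∧
      (βmin < b → 0 < meanH H b) ∧
      ∫⁻ p in Set.Ico βmin b, ENNReal.ofReal (slopeRate H p)
        ≤ ENNReal.ofReal (Real.log (n / lam)) := by
  have hH0 : ∀ x, 0 ≤ H x := fun x => by
    rcases hH x with h | h
    · exact h.ge
    · linarith [h.1]
  have hH1 : ∀ x, H x = 0 ∨ 1 ≤ H x := fun x => (hH x).imp_right fun h => h.1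
  have hHn : ∀ x, H x ≤ n := fun x => by
    rcases hH x with h | h
    · linarith
    · exact h.2
  have hl : 0 ≤ -Real.log (1 - lam) := by
    rw [neg_nonneg]; exact Real.log_nonpos (by linarith [hlam.2]) (by linarith [hlam.1])
  have bound : ∀ b, βmin ≤ b → lam ≤ meanH H b →
      ∫⁻ p in Set.Ico βmin b, ENNReal.ofReal (slopeRate H p)
        ≤ ENNReal.ofReal (Real.log (n / lam)) := fun b hb hm => by
    have hb0 : 0 < meanH H b := hlam.1.trans_le hm
    rw [lintegral_slopeRate hH0 hb hb0, Real.log_div (by linarith) hlam.1.ne']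
    refine ENNReal.ofReal_le_ofReal ?_
    have := Real.log_le_log (meanH_pos_of_pos hH0 hb0 βmin) (meanH_le hHn βmin)
    have := Real.log_le_log hlam.1 hm
    linarith
  -- The cutoff is where the mean crosses `lam`, or an end of the range if it never does. If the
  -- mean is small from the start, b = βmin and the positivity clause is vacuous; H may then be
  -- identically 0.
  rcases le_total (meanH H βmin) lam with h | h
  · exact ⟨βmin, ⟨le_rfl, hβ⟩, logZ_sub_le_of_meanH_le hH1 hlam.2 h _,
      fun h => (lt_irrefl _ h).elim, by simp⟩
  rcases le_total lam (meanH H βmax) with h' | h'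
  · exact ⟨βmax, ⟨hβ, le_rfl⟩, by simpa using hl, fun _ => hlam.1.trans_le h', bound _ hβ h'⟩
  · obtain ⟨b, hb, hbl⟩ := intermediate_value_Icc' hβ (continuous_meanH H).continuousOn ⟨h', h⟩
    exact ⟨b, hb, logZ_sub_le_of_meanH_le hH1 hlam.2 hbl.le _, fun _ => hbl ▸ hlam.1,
      bound _ hb.1 hbl.ge⟩

end Partition

/-! ### Sequences of independent draws -/

section InfinitePi

variable {X : Type*} [MeasurableSpace X]

/-- Prepend an element to a sequence. -/
def consSeq (p : X × (ℕ → X)) : ℕ → X := fun i => Nat.casesOn i p.1 p.2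

lemma measurable_consSeq : Measurable (consSeq (X := X)) := by
  refine measurable_pi_iff.2 fun i => ?_
  cases i with
  | zero => exact measurable_fst
  | succ i => exact (measurable_pi_apply i).comp measurable_snd

/-- An i.i.d. sequence is a fresh draw followed by an independent copy of itself. This allows
conditioning on the first step of a run, and it is enough to check it on finite cylinders. -/
lemma infinitePi_eq_map_consSeq (μ : Measure X) [IsProbabilityMeasure μ] :
    Measure.infinitePi (fun _ : ℕ => μ)
      = (μ.prod (Measure.infinitePi fun _ : ℕ => μ)).map consSeq := by
  classical
  symm
  refine Measure.eq_infinitePi _ fun s t ht => ?_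
  rw [Measure.map_apply measurable_consSeq (.pi s.countable_toSet fun i _ => ht i)]
  obtain ⟨N, hN⟩ : ∃ N, ∀ i ∈ s, i < N + 1 :=
    ⟨s.sup id, fun i hi => Nat.lt_succ_of_le (Finset.le_sup (f := id) hi)⟩
  -- Padding with the whole space turns the cylinder into a box over an initial segment, from which
  -- coordinate 0 can be split off.
  set t' : ℕ → Set X := fun i => if i ∈ s then t i else Set.univ with ht'
  have ht'm : ∀ i, MeasurableSet (t' i) := fun i => by
    simp only [ht']; split_ifs; exacts [ht i, .univ]
  have e : consSeq ⁻¹' (Set.pi s t)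
      = t' 0 ×ˢ Set.pi (Finset.range N) (fun i => t' (i + 1)) := by
    ext ⟨v, w⟩
    simp only [Set.mem_preimage, Set.mem_pi, Finset.mem_coe, Set.mem_prod, Finset.mem_range, ht']
    constructor
    · intro h
      refine ⟨?_, fun i _ => ?_⟩
      · split_ifs with h0
        exacts [h 0 h0, trivial]
      · split_ifs with h0
        exacts [h _ h0, trivial]
    · rintro ⟨h0, h1⟩ i hi
      cases i with
      | zero => rw [if_pos hi] at h0; exact h0
      | succ i =>
        have := h1 i (by have := hN _ hi; omega)
        rw [if_pos hi] at this; exact this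
  rw [e, Measure.prod_prod, Measure.infinitePi_pi _ fun i _ => ht'm _, mul_comm,
    ← Finset.prod_range_succ' (fun i => μ (t' i))]
  symm
  calc ∏ i ∈ s, μ (t i) = ∏ i ∈ s, μ (t' i) :=
        Finset.prod_congr rfl fun i hi => by simp only [ht', if_pos hi]
    _ = _ := Finset.prod_subset (fun i hi => Finset.mem_range.2 (hN i hi))
        fun i _ hi => by simp only [ht', if_neg hi, measure_univ]

lemma lintegral_infinitePi_cons (μ : Measure X) [IsProbabilityMeasure μ] {F : (ℕ → X) → ℝ≥0∞}
    (hF : Measurable F) :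
    ∫⁻ w, F w ∂(Measure.infinitePi fun _ : ℕ => μ)
      = ∫⁻ v, ∫⁻ w, F (consSeq (v, w)) ∂(Measure.infinitePi fun _ : ℕ => μ) ∂μ := by
  conv_lhs => rw [infinitePi_eq_map_consSeq μ]
  have hm : Measurable fun p => F (consSeq p) := hF.comp measurable_consSeq
  rw [lintegral_map hF measurable_consSeq, lintegral_prod _ hm.aemeasurable]

end InfinitePi

/-! ### One step of TPA -/

section Step

lemma lintegral_unitInterval {F : ℝ → ℝ≥0∞} (hF : Measurable F) :
    ∫⁻ u : I, F u = ∫⁻ u in Set.Ioc (0 : ℝ) 1, F u := by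
  have := unitInterval.measurePreserving_coe.lintegral_comp (f := F) hF
  rw [this]
  exact setLIntegral_congr Ioc_ae_eq_Icc.symm

/-- The law of `s - ln u / h`, an exponential variable shifted by `s`, killed beyond `t`. -/
lemma lintegral_exp_step {h s t : ℝ} (hh : 0 < h) (hst : s ≤ t) {g : ℝ → ℝ≥0∞}
    (hg : Measurable g) (c : ℝ≥0∞) :
    ∫⁻ u : I, (if s - Real.log u / h ≤ t then g (s - Real.log u / h) else c)
      = (∫⁻ b in Set.Icc s t, ENNReal.ofReal (h * Real.exp (-h * (b - s))) * g b)
        + c * ENNReal.ofReal (Real.exp (-h * (t - s))) := by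
  set E := Real.exp (-h * (t - s)) with hE
  have hE0 : 0 < E := Real.exp_pos _
  have hE1 : E ≤ 1 := Real.exp_le_one_iff.2 (by nlinarith)
  set F : ℝ → ℝ≥0∞ := fun u => if s - Real.log u / h ≤ t then g (s - Real.log u / h) else c
  have hFm : Measurable F := by
    refine Measurable.ite (measurableSet_le (by fun_prop) measurable_const) (by fun_prop)
      measurable_const
  rw [lintegral_unitInterval hFm,
    -- For u ≥ E the new value is at most t and one substitutes u = e^{-h(b-s)}; for u < E, an event
    -- of probability E, the new value exceeds t.
    show Set.Ioc (0 : ℝ) 1 = Set.Icc E 1 ∪ Set.Ioo 0 E by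
      rw [Set.union_comm, Set.Ioo_union_Icc_eq_Ioc hE0 hE1],
    lintegral_union measurableSet_Ioo
      (Set.disjoint_left.2 fun x hx hx' => absurd hx.1 (not_le.2 hx'.2))]
  congr 1
  · have himg : (fun b => Real.exp (-h * (b - s))) '' Set.Icc s t = Set.Icc E 1 := by
      ext u
      constructor
      · rintro ⟨b, hb, rfl⟩
        exact ⟨Real.exp_le_exp.2 (by nlinarith [hb.2]),
          Real.exp_le_one_iff.2 (by nlinarith [hb.1])⟩
      · rintro ⟨h1, h2⟩
        have hu : 0 < u := hE0.trans_le h1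
        have hl1 : -h * (t - s) ≤ Real.log u := (Real.le_log_iff_exp_le hu).2 h1
        have hl2 : Real.log u ≤ 0 := Real.log_nonpos hu.le h2
        refine ⟨s - Real.log u / h, ⟨?_, ?_⟩, ?_⟩
        · have := div_nonpos_of_nonpos_of_nonneg hl2 hh.le; linarith
        · have : -(t - s) ≤ Real.log u / h := by rw [le_div_iff₀ hh]; linarith
          linarith
        · have : -h * (s - Real.log u / h - s) = Real.log u := by field_simp; ring
          simp only [this, Real.exp_log hu]
    rw [← himg, lintegral_image_eq_lintegral_abs_deriv_mul measurableSet_Icc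
      (f' := fun b => Real.exp (-h * (b - s)) * (-h * 1))]
    · refine setLIntegral_congr_fun measurableSet_Icc fun b hb => ?_
      have e1 : s - Real.log (Real.exp (-h * (b - s))) / h = b := by
        rw [Real.log_exp]; field_simp; ring
      have e2 : |Real.exp (-h * (b - s)) * (-h * 1)| = h * Real.exp (-h * (b - s)) := by
        rw [abs_of_nonpos (by nlinarith [Real.exp_pos (-h * (b - s))])]; ring
      simp only [F, e1, e2, if_pos hb.2]
    · intro b _
      exact ((((hasDerivAt_id b).sub_const s).const_mul (-h)).exp).hasDerivWithinAt
    · intro b _ b' _ hbb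
      have := Real.exp_injective hbb
      have h' : -h ≠ 0 := by linarith
      linarith [mul_left_cancel₀ h' this]
  · have : ∀ u ∈ Set.Ioo 0 E, F u = c := fun u hu => by
      have hl1 : Real.log u < -h * (t - s) := (Real.log_lt_iff_lt_exp hu.1).2 hu.2
      have : Real.log u / h < -(t - s) := by rw [div_lt_iff₀ hh]; linarith
      exact if_neg (by linarith)
    rw [setLIntegral_congr_fun measurableSet_Ioo this, setLIntegral_const, Real.volume_Ioo,
      sub_zero]

end Step

lemma nonempty_of_oracle {Ω S : Type*} [MeasurableSpace S] (ν : Measure S)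
    [IsProbabilityMeasure ν] (φ : ℝ → S → Ω) : Nonempty Ω := by
  obtain ⟨s⟩ := nonempty_of_isProbabilityMeasure ν
  exact ⟨φ 0 s⟩

/-! ### Integrals over one oracle call and one TPA step -/

section Oracle

variable {Ω : Type*} [Fintype Ω] {H : Ω → ℝ} {βmin βmax : ℝ} {S : Type*} [MeasurableSpace S]
  {ν : Measure S} {φ : ℝ → S → Ω}

lemma IsSamplingOracle.measurable_comp (hφ : IsSamplingOracle H βmin βmax ν φ) {E : Type*}
    [MeasurableSpace E] (h : Ω → E) : Measurable fun p : ℝ × S => h (φ p.1 p.2) := by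
  let _ : MeasurableSpace Ω := ⊤
  have : Measurable fun p : ℝ × S => φ p.1 p.2 :=
    measurable_to_countable' fun x => hφ.measurable x
  exact (measurable_from_top (f := h)).comp this

lemma IsSamplingOracle.measurable_comp_right (hφ : IsSamplingOracle H βmin βmax ν φ) {E : Type*}
    [MeasurableSpace E] (h : Ω → E) (β : ℝ) : Measurable fun s : S => h (φ β s) :=
  (hφ.measurable_comp h).comp measurable_prodMk_left

lemma IsSamplingOracle.lintegral_comp (hφ : IsSamplingOracle H βmin βmax ν φ) {β : ℝ}
    (hβ : β ∈ Set.Icc βmin βmax) (h : Ω → ℝ≥0∞) :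
    ∫⁻ s, h (φ β s) ∂ν = ∑ x, ENNReal.ofReal (gibbs H β x) * h x := by
  classical
  have e : ∀ s, h (φ β s) = ∑ x, {s | φ β s = x}.indicator (fun _ => h x) s := fun s => by
    simp [Set.indicator_apply]
  have hm : ∀ x, MeasurableSet {s | φ β s = x} := fun x =>
    measurable_prodMk_left (hφ.measurable x)
  simp_rw [e]
  rw [lintegral_finsetSum _ fun x _ => measurable_const.indicator (hm x)]
  exact Finset.sum_congr rfl fun x _ => by
    rw [lintegral_indicator_const (hm x), hφ.law β hβ, mul_comm]

/-- One step of TPA as a function of the current value and of the fresh draws. -/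
def tpaNext (H : Ω → ℝ) (βmin βmax : ℝ) (φ : ℝ → S → Ω) (β : ℝ) (v : S × I) : Option ℝ :=
  tpaStep H βmin βmax β (φ β v.1) v.2

/-- All measurability of TPA passes through `Option.elim`, so no σ-algebra on `Option ℝ` is
required. -/
lemma measurable_tpaNext_elim (hφ : IsSamplingOracle H βmin βmax ν φ) {X : Type*}
    [MeasurableSpace X] {b : X → ℝ} (hb : Measurable b) {v : X → S × I} (hv : Measurable v)
    {E : Type*} [MeasurableSpace E]
    {c : X → E} (hc : Measurable c) {g : X → ℝ → E} (hg : Measurable fun p : X × ℝ => g p.1 p.2) :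
    Measurable fun x => (tpaNext H βmin βmax φ (b x) (v x)).elim (c x) (g x) := by
  classical
  have hH : Measurable fun x => H (φ (b x) (v x).1) :=
    (hφ.measurable_comp H).comp (hb.prodMk hv.fst)
  have hT : Measurable fun x => b x - Real.log (v x).2 / H (φ (b x) (v x).1) :=
    hb.sub ((Real.measurable_log.comp (measurable_subtype_coe.comp hv.snd)).div hH)
  have : (fun x => (tpaNext H βmin βmax φ (b x) (v x)).elim (c x) (g x)) = fun x =>
      if H (φ (b x) (v x).1) ≠ 0 ∧
        b x - Real.log (v x).2 / H (φ (b x) (v x).1) ∈ Set.Icc βmin βmax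
      then g x (b x - Real.log (v x).2 / H (φ (b x) (v x).1)) else c x := by
    funext x
    unfold tpaNext tpaStep
    split_ifs <;> rfl
  rw [this]
  refine Measurable.ite ?_ (hg.comp (measurable_id.prodMk hT)) hc
  exact ((measurableSet_eq_fun hH measurable_const).compl).inter (hT measurableSet_Icc)

/-- Given the sample, the step is exponential of rate h = H(x). The Gibbs weight e^{-βh}/Z(β) times
the density h e^{-h(b-β)} is h e^{-bh}/Z(β), so summing over x leaves the first moment at b; the
survival terms sum to Z(βmax)/Z(β) in the same way. -/
lemma lintegral_tpaNext [IsProbabilityMeasure ν] (hφ : IsSamplingOracle H βmin βmax ν φ)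
    (hH : ∀ x, 0 ≤ H x) {β : ℝ}
    (hβ : β ∈ Set.Icc βmin βmax) {g : ℝ → ℝ≥0∞} (hg : Measurable g) (c : ℝ≥0∞) :
    ∫⁻ v, (tpaNext H βmin βmax φ β v).elim c g ∂(ν.prod (volume : Measure I))
      = (∫⁻ b in Set.Icc β βmax, ENNReal.ofReal (partitionFn₁ H b / partitionFn H β) * g b)
        + c * ENNReal.ofReal (partitionFn H βmax / partitionFn H β) := by
  classical
  have : Nonempty Ω := nonempty_of_oracle ν φ
  have hZ := partitionFn_pos H β
  have hm : Measurable fun v => (tpaNext H βmin βmax φ β v).elim c g :=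
    measurable_tpaNext_elim hφ (X := S × I) (b := fun _ => β)
      measurable_const (v := id) measurable_id measurable_const
      (g := fun _ => g) (hg.comp measurable_snd)
  rw [lintegral_prod _ hm.aemeasurable]
  have inner : ∀ x, ∫⁻ u : I, (tpaStep H βmin βmax β x u).elim c g
      = (∫⁻ b in Set.Icc β βmax, ENNReal.ofReal (H x * Real.exp (-H x * (b - β))) * g b)
        + c * ENNReal.ofReal (Real.exp (-H x * (βmax - β))) := fun x => by
    rcases (hH x).eq_or_lt with h | h
    · have : ∀ u : I, (tpaStep H βmin βmax β x u).elim c g = c := fun u => by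
        rw [tpaStep, if_neg (by simp [← h])]; rfl
      simp [this, ← h]
    · rw [← lintegral_exp_step h hβ.2 hg c]
      refine lintegral_congr fun u => ?_
      have h0 : 0 ≤ -(Real.log u / H x) := by
        rw [neg_nonneg]
        exact div_nonpos_of_nonpos_of_nonneg (Real.log_nonpos u.2.1 u.2.2) h.le
      have h1 : βmin ≤ β - Real.log u / H x := by linarith [hβ.1]
      unfold tpaStep
      by_cases h2 : β - Real.log u / H x ≤ βmax
      · rw [if_pos ⟨h.ne', h1, h2⟩, if_pos h2]; rfl
      · rw [if_neg fun h' => h2 h'.2.2, if_neg h2]; rfl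
  simp only [tpaNext, inner]
  rw [hφ.lintegral_comp hβ fun x => (∫⁻ b in Set.Icc β βmax,
    ENNReal.ofReal (H x * Real.exp (-H x * (b - β))) * g b)
        + c * ENNReal.ofReal (Real.exp (-H x * (βmax - β)))]
  have hgn : ∀ x, 0 ≤ gibbs H β x := fun x => div_nonneg (Real.exp_pos _).le hZ.le
  have hexp : ∀ x b, gibbs H β x * Real.exp (-H x * (b - β))
      = Real.exp (-b * H x) / partitionFn H β := fun x b => by
    rw [gibbs, div_mul_eq_mul_div, ← Real.exp_add]; congr 2; ring
  simp only [mul_add, Finset.sum_add_distrib]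
  congr 1
  · simp_rw [← lintegral_const_mul' _ _ ENNReal.ofReal_ne_top]
    rw [← lintegral_finsetSum _ fun x _ => by fun_prop]
    refine lintegral_congr fun b => ?_
    simp_rw [← mul_assoc, ← Finset.sum_mul, ← ENNReal.ofReal_mul (hgn _)]
    rw [← ENNReal.ofReal_sum_of_nonneg fun x _ =>
      mul_nonneg (hgn x) (mul_nonneg (hH x) (Real.exp_pos _).le)]
    congr 2
    rw [partitionFn₁, Finset.sum_div]
    exact Finset.sum_congr rfl fun x _ => by
      rw [mul_left_comm, hexp, mul_div_assoc]
  · simp_rw [mul_left_comm _ c, ← Finset.mul_sum, ← ENNReal.ofReal_mul (hgn _), hexp]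
    rw [← ENNReal.ofReal_sum_of_nonneg fun x _ => by positivity, ← Finset.sum_div]
    rfl

end Oracle

/-! ### The law of a run of TPA -/

section Intensity

variable {Ω : Type*} [Fintype Ω] (H : Ω → ℝ)

/-- The integral of `f` over `[s, t]` with respect to the intensity measure of TPA. -/
def intensity (f : ℝ → ℝ) (t s : ℝ) : ℝ := ∫ b in s..t, f b * meanH H b

/-- Bounded nonnegative measurable functions with countably many discontinuities. -/
structure IsWeight (f : ℝ → ℝ) : Prop where
  nonneg : ∀ b, 0 ≤ f b
  measurable : Measurable f
  bounded : ∃ M, ∀ b, f b ≤ M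
  continuousAt : ∃ C : Set ℝ, C.Countable ∧ ∀ b ∉ C, ContinuousAt f b

variable {H} {f : ℝ → ℝ}

lemma IsWeight.intervalIntegrable (hf : IsWeight f) {h : ℝ → ℝ} (hh : Continuous h) (s t : ℝ) :
    IntervalIntegrable (fun b => f b * h b) volume s t := by
  obtain ⟨M, hM⟩ := hf.bounded
  have := (hh.intervalIntegrable (μ := volume) s t)
  constructor
  · exact this.1.bdd_mul hf.measurable.aestronglyMeasurable
      (ae_of_all _ fun b => by rw [Real.norm_eq_abs, abs_of_nonneg (hf.nonneg b)]; exact hM b)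
  · exact this.2.bdd_mul hf.measurable.aestronglyMeasurable
      (ae_of_all _ fun b => by rw [Real.norm_eq_abs, abs_of_nonneg (hf.nonneg b)]; exact hM b)

lemma continuous_intensity [Nonempty Ω] (hf : IsWeight f) (t : ℝ) :
    Continuous (intensity H f t) := by
  have : intensity H f t = fun s => -∫ b in t..s, f b * meanH H b := by
    funext s; rw [intensity, intervalIntegral.integral_symm]
  rw [this]
  exact (intervalIntegral.continuous_primitive
    (fun a b => hf.intervalIntegrable (continuous_meanH H) a b) t).neg

lemma intensity_nonneg [Nonempty Ω] (hf : IsWeight f) (hH : ∀ x, 0 ≤ H x) {s t : ℝ}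
    (hst : s ≤ t) : 0 ≤ intensity H f t s :=
  intervalIntegral.integral_nonneg hst fun b _ => mul_nonneg (hf.nonneg b) (meanH_nonneg hH b)

/-- Away from countably many points the integrand is the derivative of -K^{n+1}/(n+1)!, with K the
intensity up to t. This is the recursion that produces the Poisson weights. -/
lemma integral_intensity_pow [Nonempty Ω] (hf : IsWeight f) {s t : ℝ} (hst : s ≤ t) (n : ℕ) :
    ∫ b in s..t, f b * (meanH H b * (intensity H f t b ^ n / n.factorial))
      = intensity H f t s ^ (n + 1) / (n + 1).factorial := by
  obtain ⟨C, hC, hfC⟩ := hf.continuousAt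
  have hK := continuous_intensity (H := H) hf t
  have := integral_eq_of_hasDerivAt_off_countable_of_le
    (fun b => -(intensity H f t b ^ (n + 1) / (n + 1).factorial))
    (fun b => f b * (meanH H b * (intensity H f t b ^ n / n.factorial))) hst hC
    (by fun_prop) (fun b hb => ?_)
    (hf.intervalIntegrable ((continuous_meanH H).mul ((hK.pow n).div_const _)) s t)
  · rw [this]; simp [intensity]
  · have hd : HasDerivAt (intensity H f t) (-(f b * meanH H b)) b :=
      intervalIntegral.integral_hasDerivAt_left
        (hf.intervalIntegrable (continuous_meanH H) b t)
        ((hf.measurable.mul (continuous_meanH H).measurable).stronglyMeasurable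
          |>.stronglyMeasurableAtFilter)
        ((hfC b hb.2).mul (continuous_meanH H).continuousAt)
    have hd' : HasDerivAt (fun b => -(intensity H f t b ^ (n + 1) / (n + 1).factorial))
        (-(((n + 1 : ℕ) : ℝ) * intensity H f t b ^ (n + 1 - 1) * -(f b * meanH H b)
          / (n + 1).factorial)) b := ((hd.pow (n + 1)).div_const _).neg
    refine hd'.congr_deriv ?_
    rw [Nat.factorial_succ]
    push_cast
    have h1 : (n.factorial : ℝ) ≠ 0 := by positivity
    have h2 : (n : ℝ) + 1 ≠ 0 := by positivity
    field_simp

end Intensity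

/-! ### Runs of TPA from an arbitrary starting point -/

section Run

variable {Ω : Type*} {S : Type*}

/-- The state of a run of TPA started at `s`. -/
def stateFrom (H : Ω → ℝ) (βmin βmax : ℝ) (φ : ℝ → S → Ω) :
    ℝ → (ℕ → S × I) → ℕ → Option ℝ
  | s, _, 0 => some s
  | s, w, i + 1 => (tpaNext H βmin βmax φ s (w 0)).bind fun b =>
      stateFrom H βmin βmax φ b (fun j => w (j + 1)) i

/-- The product of `f` over the points of a run started at `s`, on the event that it has exactly
`n` points. -/
def runWeight (H : Ω → ℝ) (βmin βmax : ℝ) (φ : ℝ → S → Ω) (f : ℝ → ℝ≥0∞) :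
    ℕ → ℝ → (ℕ → S × I) → ℝ≥0∞
  | 0, s, w => (tpaNext H βmin βmax φ s (w 0)).elim 1 fun _ => 0
  | n + 1, s, w => (tpaNext H βmin βmax φ s (w 0)).elim 0 fun b =>
      f b * runWeight H βmin βmax φ f n b fun j => w (j + 1)

lemma stateFrom_succ_left (H : Ω → ℝ) (βmin βmax : ℝ) (φ : ℝ → S → Ω) (s : ℝ) (w : ℕ → S × I)
    (i : ℕ) : stateFrom H βmin βmax φ s w (i + 1) = (tpaNext H βmin βmax φ s (w 0)).bind fun b =>
      stateFrom H βmin βmax φ b (fun j => w (j + 1)) i := rfl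

/-- `stateFrom` recurses on the first draw, as conditioning requires, whereas `tpaState` recurses on
the last one. This lemma reconciles them. -/
lemma stateFrom_succ (H : Ω → ℝ) (βmin βmax : ℝ) (φ : ℝ → S → Ω) (i : ℕ) :
    ∀ s (w : ℕ → S × I), stateFrom H βmin βmax φ s w (i + 1)
      = (stateFrom H βmin βmax φ s w i).bind fun b => tpaNext H βmin βmax φ b (w i) := by
  induction i with
  | zero =>
    intro s w
    simp only [stateFrom, Option.bind_some]
    cases tpaNext H βmin βmax φ s (w 0) <;> rfl
  | succ i ih =>
    intro s w
    rw [stateFrom]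
    conv_rhs => rw [stateFrom]
    rw [Option.bind_assoc]
    congr 1
    funext b
    exact ih b _

lemma tpaState_eq_stateFrom (H : Ω → ℝ) (βmin βmax : ℝ) (φ : ℝ → S → Ω) (w : ℕ → S × I) (i : ℕ) :
    tpaState H βmin βmax φ w i = stateFrom H βmin βmax φ βmin w i := by
  induction i with
  | zero => rfl
  | succ i ih => rw [stateFrom_succ, ← ih]; rfl

lemma runWeight_zero_cons (H : Ω → ℝ) (βmin βmax : ℝ) (φ : ℝ → S → Ω) (f : ℝ → ℝ≥0∞) (s : ℝ)
    (v : S × I) (w : ℕ → S × I) : runWeight H βmin βmax φ f 0 s (consSeq (v, w))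
      = (tpaNext H βmin βmax φ s v).elim 1 fun _ => 0 := rfl

lemma runWeight_succ_cons (H : Ω → ℝ) (βmin βmax : ℝ) (φ : ℝ → S → Ω) (f : ℝ → ℝ≥0∞) (n : ℕ)
    (s : ℝ) (v : S × I) (w : ℕ → S × I) : runWeight H βmin βmax φ f (n + 1) s (consSeq (v, w))
      = (tpaNext H βmin βmax φ s v).elim 0 fun b => f b * runWeight H βmin βmax φ f n b w := rfl

/-- The event that the run started at `s` has exactly `n` points. -/
def HasSize (H : Ω → ℝ) (βmin βmax : ℝ) (φ : ℝ → S → Ω) (n : ℕ) (s : ℝ) (w : ℕ → S × I) : Prop :=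
  stateFrom H βmin βmax φ s w n ≠ none ∧ stateFrom H βmin βmax φ s w (n + 1) = none

-- Unfolds the recursive weight into a product over the points. The default 0 is never reached when
-- the run has n points.
open Classical in
lemma runWeight_eq (H : Ω → ℝ) (βmin βmax : ℝ) (φ : ℝ → S → Ω) (f : ℝ → ℝ≥0∞) (n : ℕ) :
    ∀ s w, runWeight H βmin βmax φ f n s w = if HasSize H βmin βmax φ n s w
      then ∏ i ∈ Finset.range n, f ((stateFrom H βmin βmax φ s w (i + 1)).getD 0) else 0 := by
  induction n with
  | zero =>
    intro s w
    cases h : tpaNext H βmin βmax φ s (w 0) <;> simp [runWeight, HasSize, stateFrom, h]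
  | succ n ih =>
    intro s w
    rw [runWeight]
    cases h : tpaNext H βmin βmax φ s (w 0) with
    | none =>
      have : ¬ HasSize H βmin βmax φ (n + 1) s w := by
        rw [HasSize, stateFrom_succ_left, h]; simp
      rw [if_neg this]; rfl
    | some b =>
      have : HasSize H βmin βmax φ (n + 1) s w
          ↔ HasSize H βmin βmax φ n b fun j => w (j + 1) := by
        simp only [HasSize, stateFrom_succ_left _ _ _ _ s, h, Option.bind_some]
      rw [Option.elim_some, ih, if_congr this rfl rfl, mul_ite, mul_zero,
        Finset.prod_range_succ', mul_comm]
      refine if_congr Iff.rfl ?_ rfl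
      congr 1
      · refine Finset.prod_congr rfl fun i _ => ?_
        rw [stateFrom_succ_left _ _ _ _ s, h]; rfl
      · rw [stateFrom_succ_left _ _ _ _ s, h]; rfl

end Run

/-! ### The law of a single run -/

section RunLaw

variable {Ω : Type*} [Fintype Ω] {H : Ω → ℝ} {βmin βmax : ℝ} {S : Type*} [MeasurableSpace S]
  {ν : Measure S} {φ : ℝ → S → Ω}

lemma measurable_shift {X : Type*} [MeasurableSpace X] :
    Measurable fun (w : ℕ → X) (j : ℕ) => w (j + 1) :=
  measurable_pi_iff.2 fun j => measurable_pi_apply (j + 1)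

lemma measurable_runWeight (hφ : IsSamplingOracle H βmin βmax ν φ) {f : ℝ → ℝ≥0∞}
    (hf : Measurable f) (n : ℕ) :
    Measurable fun p : ℝ × (ℕ → S × I) => runWeight H βmin βmax φ f n p.1 p.2 := by
  have h0 : Measurable fun p : ℝ × (ℕ → S × I) => p.2 0 :=
    (measurable_pi_apply 0).comp measurable_snd
  induction n with
  | zero =>
    exact measurable_tpaNext_elim hφ measurable_fst h0 measurable_const measurable_const
  | succ n ih =>
    refine measurable_tpaNext_elim hφ measurable_fst h0 measurable_const
      (g := fun p b => f b * runWeight H βmin βmax φ f n b fun j => p.2 (j + 1)) ?_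
    exact (hf.comp measurable_snd).mul
      (ih.comp (measurable_snd.prodMk (measurable_shift.comp (measurable_snd.comp measurable_fst))))

omit [Fintype Ω] [MeasurableSpace S] in
lemma tpaNext_mem {b c : ℝ} {v : S × I} (h : tpaNext H βmin βmax φ b v = some c) :
    c ∈ Set.Icc βmin βmax := by
  unfold tpaNext tpaStep at h
  split_ifs at h with h'
  cases h
  exact h'.2

/-- The number of points of a run of TPA has a Poisson law, and so does its restriction to any
subset. -/
theorem lintegral_runWeight [IsProbabilityMeasure ν] (hφ : IsSamplingOracle H βmin βmax ν φ)
    (hH : ∀ x, 0 ≤ H x) {f : ℝ → ℝ} (hf : IsWeight f) (n : ℕ) :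
    ∀ s ∈ Set.Icc βmin βmax,
      ∫⁻ w, runWeight H βmin βmax φ (fun b => ENNReal.ofReal (f b)) n s w
          ∂(Measure.infinitePi fun _ : ℕ => ν.prod (volume : Measure I))
        = ENNReal.ofReal (partitionFn H βmax / partitionFn H s
            * (intensity H f βmax s ^ n / n.factorial)) := by
  have : Nonempty Ω := nonempty_of_oracle ν φ
  have hfm : Measurable fun b => ENNReal.ofReal (f b) := hf.measurable.ennreal_ofReal
  have hm := measurable_runWeight hφ hfm
  have hm' : ∀ n s, Measurable (runWeight H βmin βmax φ (fun b => ENNReal.ofReal (f b)) n s) :=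
    fun n s => (hm n).comp measurable_prodMk_left
  induction n with
  | zero =>
    intro s hs
    rw [lintegral_infinitePi_cons _ (hm' 0 s)]
    simp only [runWeight_zero_cons, lintegral_const, measure_univ, mul_one]
    rw [lintegral_tpaNext hφ hH hs measurable_const]
    simp
  | succ n ih =>
    intro s hs
    set μ := Measure.infinitePi fun _ : ℕ => ν.prod (volume : Measure I)
    rw [lintegral_infinitePi_cons _ (hm' (n + 1) s)]
    set G : ℝ → ℝ≥0∞ := fun b => ENNReal.ofReal (f b) *
      ∫⁻ w, runWeight H βmin βmax φ (fun b => ENNReal.ofReal (f b)) n b w ∂μ with hG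
    have hGm : Measurable G := hfm.mul (hm n).lintegral_prod_right'
    have e1 : ∀ v, ∫⁻ w, runWeight H βmin βmax φ (fun b => ENNReal.ofReal (f b)) (n + 1) s
        (consSeq (v, w)) ∂μ = (tpaNext H βmin βmax φ s v).elim 0 G := fun v => by
      simp only [runWeight_succ_cons]
      cases tpaNext H βmin βmax φ s v with
      | none => simp
      | some b =>
        simp only [Option.elim_some, hG]
        rw [lintegral_const_mul _ (hm' n b)]
    rw [lintegral_congr e1]
    rw [lintegral_tpaNext hφ hH hs hGm, zero_mul, add_zero]
    have hZs := partitionFn_pos H s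
    have hZt := partitionFn_pos H βmax
    set c := partitionFn H βmax / partitionFn H s with hc
    have hc0 : 0 ≤ c := (div_pos hZt hZs).le
    -- The partition functions telescope: the step density Z₁(b)/Z(s), with Z₁ = -Z', times the
    -- factor Z(βmax)/Z(b) from the induction hypothesis is Z(βmax)/Z(s) times `meanH H b`.
    have e2 : ∀ b ∈ Set.Icc s βmax,
        ENNReal.ofReal (partitionFn₁ H b / partitionFn H s) * G b = ENNReal.ofReal
          (c * (f b * (meanH H b * (intensity H f βmax b ^ n / n.factorial)))) := fun b hb => by
      have hZb := partitionFn_pos H b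
      simp only [hG]
      rw [ih b ⟨hs.1.trans hb.1, hb.2⟩, ← ENNReal.ofReal_mul (hf.nonneg b),
        ← ENNReal.ofReal_mul (div_nonneg (partitionFn₁_nonneg hH b) hZs.le)]
      congr 1
      rw [hc, meanH]
      field_simp
    rw [setLIntegral_congr_fun measurableSet_Icc e2, setLIntegral_congr Ioc_ae_eq_Icc.symm,
      ← ofReal_integral_eq_lintegral_ofReal]
    · rw [← intervalIntegral.integral_of_le hs.2, intervalIntegral.integral_const_mul,
        integral_intensity_pow hf hs.2]
    · exact ((hf.intervalIntegrable ((continuous_meanH H).mul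
        (((continuous_intensity hf βmax).pow n).div_const _)) s βmax).const_mul c).1
    · refine (ae_restrict_iff' measurableSet_Ioc).2 (ae_of_all _ fun b hb => ?_)
      have := intensity_nonneg hf hH hb.2
      have := hf.nonneg b
      have := meanH_nonneg hH b
      simp only [Pi.zero_apply]; positivity

end RunLaw

/-! ### The points output by TPA -/

section Points

variable {Ω : Type*} {S : Type*} {H : Ω → ℝ} {βmin βmax : ℝ} {φ : ℝ → S → Ω} {w : ℕ → S × I}
  {n : ℕ}

lemma hasSize_iff : HasSize H βmin βmax φ n βmin w ↔
    tpaState H βmin βmax φ w n ≠ none ∧ tpaState H βmin βmax φ w (n + 1) = none := by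
  rw [HasSize, tpaState_eq_stateFrom, tpaState_eq_stateFrom]

lemma tpaState_none_of_le {i j : ℕ} (hij : i ≤ j) (h : tpaState H βmin βmax φ w i = none) :
    tpaState H βmin βmax φ w j = none := by
  induction hij with
  | refl => exact h
  | step _ ih => rw [tpaState, ih]; rfl

lemma HasSize.tpaState_ne_none_iff (h : HasSize H βmin βmax φ n βmin w) {i : ℕ} :
    tpaState H βmin βmax φ w i ≠ none ↔ i ≤ n := by
  rw [hasSize_iff] at h
  constructor
  · intro hi
    by_contra hn
    exact hi (tpaState_none_of_le (by omega) h.2)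
  · exact fun hi h' => h.1 (tpaState_none_of_le hi h')

lemma HasSize.unique {m : ℕ} (h : HasSize H βmin βmax φ n βmin w)
    (h' : HasSize H βmin βmax φ m βmin w) : n = m :=
  le_antisymm (h'.tpaState_ne_none_iff.1 (hasSize_iff.1 h).1)
    (h.tpaState_ne_none_iff.1 (hasSize_iff.1 h').1)

lemma tpaState_ne_none_of_not_hasSize (h : ∀ n, ¬ HasSize H βmin βmax φ n βmin w) (i : ℕ) :
    tpaState H βmin βmax φ w i ≠ none := by
  induction i with
  | zero => simp [tpaState]
  | succ i ih => exact fun h' => h i (hasSize_iff.2 ⟨ih, h'⟩)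

lemma HasSize.tpaSize_eq (h : HasSize H βmin βmax φ n βmin w) :
    tpaSize H βmin βmax φ w = n := by
  have : {i : ℕ | tpaState H βmin βmax φ w (i + 1) ≠ none} = (Finset.range n : Set ℕ) := by
    ext i
    rw [Set.mem_ofPred_eq, h.tpaState_ne_none_iff, Finset.coe_range, Set.mem_Iio]; omega
  rw [tpaSize, this, Set.encard_coe_eq_coe_finsetCard, Finset.card_range]

lemma HasSize.tpaCalls_eq (h : HasSize H βmin βmax φ n βmin w) :
    tpaCalls H βmin βmax φ w = n + 1 := by
  have : {i : ℕ | tpaState H βmin βmax φ w i ≠ none} = (Finset.range (n + 1) : Set ℕ) := by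
    ext i
    rw [Set.mem_ofPred_eq, h.tpaState_ne_none_iff, Finset.coe_range, Set.mem_Iio]; omega
  rw [tpaCalls, this, Set.encard_coe_eq_coe_finsetCard, Finset.card_range]
  rfl

/-- The value of the `i`-th point of a run. -/
def tpaPoint (H : Ω → ℝ) (βmin βmax : ℝ) (φ : ℝ → S → Ω) (w : ℕ → S × I) (i : ℕ) : ℝ :=
  (stateFrom H βmin βmax φ βmin w (i + 1)).getD 0

lemma HasSize.tpaRun_eq (h : HasSize H βmin βmax φ n βmin w) :
    tpaRun H βmin βmax φ w = ((List.range n).map (tpaPoint H βmin βmax φ w) : List ℝ) := by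
  rw [tpaRun, h.tpaSize_eq, ENat.toNat_natCast, ← List.filterMap_eq_map]
  congr 1
  refine List.filterMap_congr fun i hi => ?_
  obtain ⟨b, hb⟩ := Option.ne_none_iff_exists'.1
    ((h.tpaState_ne_none_iff (i := i + 1)).2 (by have := List.mem_range.1 hi; omega))
  simp only [Function.comp_apply, tpaPoint, ← tpaState_eq_stateFrom, hb, Option.getD_some]

lemma tpaRun_eq_zero_of_not_hasSize (h : ∀ n, ¬ HasSize H βmin βmax φ n βmin w) :
    tpaRun H βmin βmax φ w = 0 := by
  have : {i : ℕ | tpaState H βmin βmax φ w (i + 1) ≠ none} = Set.univ :=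
    Set.eq_univ_of_forall fun i => tpaState_ne_none_of_not_hasSize h (i + 1)
  -- The number of points is ⊤, whose `toNat` is 0, so the list is empty.
  rw [tpaRun, tpaSize, this, Set.encard_univ]
  simp

lemma HasSize.prod_map (h : HasSize H βmin βmax φ n βmin w) (f : ℝ → ℝ≥0∞) :
    ((tpaRun H βmin βmax φ w).map f).prod = runWeight H βmin βmax φ f n βmin w := by
  classical
  rw [h.tpaRun_eq, runWeight_eq, if_pos h, Multiset.map_coe, List.map_map]
  rfl

lemma HasSize.tsum_runWeight (h : HasSize H βmin βmax φ n βmin w) (f : ℝ → ℝ≥0∞) :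
    ∑' m, runWeight H βmin βmax φ f m βmin w = runWeight H βmin βmax φ f n βmin w := by
  classical
  refine tsum_eq_single n fun m hm => ?_
  rw [runWeight_eq, if_neg fun h' => hm (h'.unique h)]

lemma mem_of_mem_tpaRun {b : ℝ} (hb : b ∈ tpaRun H βmin βmax φ w) : b ∈ Set.Icc βmin βmax := by
  rw [tpaRun, Multiset.mem_coe, List.mem_filterMap] at hb
  obtain ⟨i, -, hi⟩ := hb
  rw [tpaState] at hi
  obtain ⟨c, -, hc⟩ := Option.bind_eq_some_iff.1 hi
  exact tpaNext_mem hc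

lemma mem_of_mem_tpaUnion {k : ℕ} {w : Fin k → ℕ → S × I} {b : ℝ}
    (hb : b ∈ tpaUnion H βmin βmax φ w) : b ∈ Set.Icc βmin βmax := by
  rw [tpaUnion, Multiset.mem_sum] at hb
  obtain ⟨j, -, hj⟩ := hb
  exact mem_of_mem_tpaRun hj

end Points

/-! ### The output of TPA as a Poisson process -/

section PointsLaw

variable {Ω : Type*} [Fintype Ω] {H : Ω → ℝ} {βmin βmax : ℝ} {S : Type*} [MeasurableSpace S]
  {ν : Measure S} {φ : ℝ → S → Ω}

/-- The event is the support of the run weight with f = 1, whose measurability is known. -/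
lemma measurableSet_hasSize (hφ : IsSamplingOracle H βmin βmax ν φ) (n : ℕ) (s : ℝ) :
    MeasurableSet {w | HasSize H βmin βmax φ n s w} := by
  classical
  have hm : Measurable (runWeight H βmin βmax φ (fun _ => 1) n s) :=
    (measurable_runWeight hφ measurable_const n).comp measurable_prodMk_left
  have : {w | HasSize H βmin βmax φ n s w}
      = runWeight H βmin βmax φ (fun _ => 1) n s ⁻¹' {0}ᶜ := by
    ext w
    rw [Set.mem_preimage, runWeight_eq]
    by_cases h : HasSize H βmin βmax φ n s w <;> simp [h]
  rw [this]
  exact hm (measurableSet_singleton 0).compl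

lemma measurable_stateFrom (hφ : IsSamplingOracle H βmin βmax ν φ) (i : ℕ) :
    Measurable fun p : ℝ × (ℕ → S × I) => (stateFrom H βmin βmax φ p.1 p.2 i).getD 0 := by
  induction i with
  | zero => exact measurable_fst
  | succ i ih =>
    have e : (fun p : ℝ × (ℕ → S × I) => (stateFrom H βmin βmax φ p.1 p.2 (i + 1)).getD 0)
        = fun p => (tpaNext H βmin βmax φ p.1 (p.2 0)).elim 0 fun b =>
            (stateFrom H βmin βmax φ b (fun j => p.2 (j + 1)) i).getD 0 := by
      funext p
      rw [stateFrom_succ_left]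
      cases tpaNext H βmin βmax φ p.1 (p.2 0) <;> rfl
    rw [e]
    have h0 : Measurable fun p : ℝ × (ℕ → S × I) => p.2 0 :=
      (measurable_pi_apply 0).comp measurable_snd
    refine measurable_tpaNext_elim hφ measurable_fst h0 measurable_const
      (g := fun (p : ℝ × (ℕ → S × I)) b =>
          (stateFrom H βmin βmax φ b (fun j => p.2 (j + 1)) i).getD 0) ?_
    exact ih.comp
      (measurable_snd.prodMk (measurable_shift.comp (measurable_snd.comp measurable_fst)))

lemma measurable_tpaPoint (hφ : IsSamplingOracle H βmin βmax ν φ) (i : ℕ) :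
    Measurable fun w : ℕ → S × I => tpaPoint H βmin βmax φ w i :=
  (measurable_stateFrom hφ (i + 1)).comp measurable_prodMk_left

/-- The predicate depends on a parameter because counts are later integrated jointly over the runs
and over the position p. -/
lemma measurable_countP_tpaRun (hφ : IsSamplingOracle H βmin βmax ν φ) {X : Type*}
    [MeasurableSpace X] {P : X → ℝ → Prop} [∀ x, DecidablePred (P x)]
    (hP : MeasurableSet {p : X × ℝ | P p.1 p.2}) :
    Measurable fun p : X × (ℕ → S × I) =>
      (((tpaRun H βmin βmax φ p.2).countP (P p.1) : ℕ) : ℝ≥0∞) := by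
  classical
  have e : (fun p : X × (ℕ → S × I) =>
      (((tpaRun H βmin βmax φ p.2).countP (P p.1) : ℕ) : ℝ≥0∞))
      = fun p => ∑' n, (if HasSize H βmin βmax φ n βmin p.2 then
        ∑ i ∈ Finset.range n, (if P p.1 (tpaPoint H βmin βmax φ p.2 i) then 1 else 0) else 0) := by
    funext p
    by_cases h : ∃ n, HasSize H βmin βmax φ n βmin p.2
    · obtain ⟨n, h⟩ := h
      rw [tsum_eq_single n fun m hm => if_neg fun h' => hm (h'.unique h), if_pos h, h.tpaRun_eq,
        Multiset.coe_countP, List.countP_map, List.countP_eq_length_filter,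
        Finset.sum_boole]
      rfl
    · push Not at h
      simp [tpaRun_eq_zero_of_not_hasSize h, h]
  rw [e]
  refine Measurable.tsum fun n => Measurable.ite
    (measurable_snd (measurableSet_hasSize hφ n βmin)) ?_ measurable_const
  exact Finset.measurable_sum _ fun i _ => Measurable.ite
    (hP.preimage (measurable_fst.prodMk ((measurable_tpaPoint hφ i).comp measurable_snd)))
    measurable_const measurable_const

lemma measurable_countP_tpaUnion (hφ : IsSamplingOracle H βmin βmax ν φ) {k : ℕ} {X : Type*}
    [MeasurableSpace X] {P : X → ℝ → Prop} [∀ x, DecidablePred (P x)]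
    (hP : MeasurableSet {p : X × ℝ | P p.1 p.2}) :
    Measurable fun p : X × (Fin k → ℕ → S × I) =>
      (tpaUnion H βmin βmax φ p.2).countP (P p.1) := by
  have h : Measurable fun p : X × (Fin k → ℕ → S × I) =>
      (((tpaUnion H βmin βmax φ p.2).countP (P p.1) : ℕ) : ℝ≥0∞) := by
    have e : (fun p : X × (Fin k → ℕ → S × I) =>
        (((tpaUnion H βmin βmax φ p.2).countP (P p.1) : ℕ) : ℝ≥0∞))
        = fun p => ∑ j, (((tpaRun H βmin βmax φ (p.2 j)).countP (P p.1) : ℕ) : ℝ≥0∞) := by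
      funext p
      rw [tpaUnion, ← Multiset.coe_countPAddMonoidHom, map_sum, Nat.cast_sum]
    rw [e]
    refine Finset.measurable_sum _ fun j _ => ?_
    have h1 : Measurable fun p : X × (Fin k → ℕ → S × I) => (p.1, p.2 j) :=
      measurable_fst.prodMk ((measurable_pi_apply j).comp measurable_snd)
    have h2 := (measurable_countP_tpaRun hφ hP).comp h1
    simpa only [Function.comp_def] using h2
  refine measurable_to_countable' fun m => ?_
  have := h (measurableSet_singleton (m : ℝ≥0∞))
  convert this using 1
  ext p; simp

/-- The law of the randomness of one run of TPA. -/
abbrev runLaw (ν : Measure S) [IsProbabilityMeasure ν] : Measure (ℕ → S × I) :=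
  Measure.infinitePi fun _ : ℕ => ν.prod (volume : Measure I)

lemma isWeight_one : IsWeight fun _ => 1 :=
  ⟨fun _ => zero_le_one, measurable_const, ⟨1, fun _ => le_rfl⟩,
    ⟨∅, Set.countable_empty, fun _ _ => continuousAt_const⟩⟩

lemma intensity_one [Nonempty Ω] (s t : ℝ) :
    intensity H (fun _ => 1) t s = logZ H s - logZ H t := by
  have := intervalIntegral.integral_eq_sub_of_hasDerivAt (a := s) (b := t)
    (fun b _ => (hasDerivAt_logZ H b).neg)
    ((continuous_meanH H).neg.neg.intervalIntegrable _ _)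
  simp only [Pi.neg_apply, neg_neg] at this
  simp only [intensity, one_mul]
  rw [this]; ring

lemma partitionFn_div_eq_exp [Nonempty Ω] (s t : ℝ) :
    partitionFn H t / partitionFn H s = Real.exp (-(logZ H s - logZ H t)) := by
  rw [neg_sub, Real.exp_sub, exp_logZ, exp_logZ]

lemma tsum_lintegral_runWeight [IsProbabilityMeasure ν] (hφ : IsSamplingOracle H βmin βmax ν φ)
    (hβ : βmin ≤ βmax) (hH : ∀ x, 0 ≤ H x) {f : ℝ → ℝ} (hf : IsWeight f) :
    ∑' n, ∫⁻ w, runWeight H βmin βmax φ (fun b => ENNReal.ofReal (f b)) n βmin w ∂(runLaw ν)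
      = ENNReal.ofReal
        (Real.exp (intensity H f βmax βmin - (logZ H βmin - logZ H βmax))) := by
  have : Nonempty Ω := nonempty_of_oracle ν φ
  simp_rw [lintegral_runWeight hφ hH hf _ βmin ⟨le_rfl, hβ⟩, partitionFn_div_eq_exp]
  have h0 := intensity_nonneg hf hH hβ
  have hs := NormedSpace.expSeries_div_hasSum_exp (intensity H f βmax βmin)
  rw [← Real.exp_eq_exp_ℝ] at hs
  rw [← ENNReal.ofReal_tsum_of_nonneg (fun n => by positivity) (hs.summable.mul_left _),
    tsum_mul_left, hs.tsum_eq, ← Real.exp_add]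
  congr 2; ring

/-- For f = 1 the exponent vanishes, so the probabilities of having exactly n points add up to 1: a
run terminates almost surely. -/
lemma ae_exists_hasSize [IsProbabilityMeasure ν] (hφ : IsSamplingOracle H βmin βmax ν φ)
    (hβ : βmin ≤ βmax) (hH : ∀ x, 0 ≤ H x) :
    ∀ᵐ w ∂(runLaw ν), ∃ n, HasSize H βmin βmax φ n βmin w := by
  classical
  have : Nonempty Ω := nonempty_of_oracle ν φ
  have h := tsum_lintegral_runWeight hφ hβ hH isWeight_one
  rw [intensity_one, sub_self, Real.exp_zero, ENNReal.ofReal_one] at h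
  have hm : MeasurableSet {w | ∃ n, HasSize H βmin βmax φ n βmin w} := by
    rw [Set.ofPred_exists]; exact .iUnion fun n => measurableSet_hasSize hφ n βmin
  refine (prob_compl_eq_zero_iff hm).2 ?_
  rw [Set.ofPred_exists, measure_iUnion (f := fun n => {w | HasSize H βmin βmax φ n βmin w})
    (fun i j hij => Set.disjoint_left.2 fun w hi hj => hij (HasSize.unique hi hj))
    fun n => measurableSet_hasSize hφ n βmin, ← h]
  refine tsum_congr fun n => ?_
  simp_rw [runWeight_eq, Finset.prod_const_one]
  rw [← lintegral_indicator_one (measurableSet_hasSize hφ n βmin)]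
  rfl

lemma measurable_runWeight_right (hφ : IsSamplingOracle H βmin βmax ν φ) {f : ℝ → ℝ}
    (hf : IsWeight f) (n : ℕ) (s : ℝ) :
    Measurable (runWeight H βmin βmax φ (fun b => ENNReal.ofReal (f b)) n s) :=
  (measurable_runWeight hφ hf.measurable.ennreal_ofReal n).comp measurable_prodMk_left

lemma ae_prod_map_eq [IsProbabilityMeasure ν] (hφ : IsSamplingOracle H βmin βmax ν φ)
    (hβ : βmin ≤ βmax) (hH : ∀ x, 0 ≤ H x) (f : ℝ → ℝ≥0∞) :
    ∀ᵐ w ∂(runLaw ν), ((tpaRun H βmin βmax φ w).map f).prod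
      = ∑' n, runWeight H βmin βmax φ f n βmin w := by
  filter_upwards [ae_exists_hasSize hφ hβ hH] with w hw
  obtain ⟨n, h⟩ := hw
  rw [h.prod_map, h.tsum_runWeight]

lemma lintegral_prod_tpaRun [IsProbabilityMeasure ν] (hφ : IsSamplingOracle H βmin βmax ν φ)
    (hβ : βmin ≤ βmax) (hH : ∀ x, 0 ≤ H x) {f : ℝ → ℝ} (hf : IsWeight f) :
    ∫⁻ w, ((tpaRun H βmin βmax φ w).map fun b => ENNReal.ofReal (f b)).prod ∂(runLaw ν)
      = ENNReal.ofReal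
        (Real.exp (intensity H f βmax βmin - (logZ H βmin - logZ H βmax))) := by
  rw [lintegral_congr_ae (ae_prod_map_eq hφ hβ hH _),
    lintegral_tsum fun n => (measurable_runWeight_right hφ hf n βmin).aemeasurable]
  exact tsum_lintegral_runWeight hφ hβ hH hf

/-- The union of `k` independent runs of TPA is a Poisson process: its Laplace functional. -/
theorem lintegral_prod_tpaUnion [IsProbabilityMeasure ν] (hφ : IsSamplingOracle H βmin βmax ν φ)
    (hβ : βmin ≤ βmax) (hH : ∀ x, 0 ≤ H x) {f : ℝ → ℝ} (hf : IsWeight f) (k : ℕ) :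
    ∫⁻ w, ((tpaUnion H βmin βmax φ w).map fun b => ENNReal.ofReal (f b)).prod
        ∂(Measure.pi fun _ : Fin k => runLaw ν)
      = ENNReal.ofReal
        (Real.exp (k * (intensity H f βmax βmin - (logZ H βmin - logZ H βmax)))) := by
  have e : ∀ w : Fin k → ℕ → S × I,
      ((tpaUnion H βmin βmax φ w).map fun b => ENNReal.ofReal (f b)).prod
      = ∏ j, ((tpaRun H βmin βmax φ (w j)).map fun b => ENNReal.ofReal (f b)).prod := fun w => by
    rw [tpaUnion, ← Multiset.coe_mapAddMonoidHom, map_sum, Multiset.prod_sum]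
  set g : (ℕ → S × I) → ℝ≥0∞ := fun w =>
    ∑' n, runWeight H βmin βmax φ (fun b => ENNReal.ofReal (f b)) n βmin w with hg
  have hgm : Measurable g := Measurable.tsum fun n => measurable_runWeight_right hφ hf n βmin
  have hae : ∀ᵐ w ∂(Measure.pi fun _ : Fin k => runLaw ν),
      ((tpaUnion H βmin βmax φ w).map fun b => ENNReal.ofReal (f b)).prod
        = ∏ j, g (w j) := by
    have : ∀ j : Fin k, ∀ᵐ w ∂(Measure.pi fun _ : Fin k => runLaw ν),
        ((tpaRun H βmin βmax φ (w j)).map fun b => ENNReal.ofReal (f b)).prod = g (w j) :=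
      fun j => (Measure.quasiMeasurePreserving_eval (fun _ : Fin k => runLaw ν) j).ae
        (ae_prod_map_eq hφ hβ hH _)
    filter_upwards [ae_all_iff.2 this] with w hw
    rw [e]
    exact Finset.prod_congr rfl fun j _ => hw j
  have hind : iIndepFun (fun (j : Fin k) (w : Fin k → ℕ → S × I) => g (w j))
      (Measure.pi fun _ : Fin k => runLaw ν) :=
    iIndepFun_pi fun j => hgm.aemeasurable
  rw [lintegral_congr_ae hae, lintegral_prod_eq_prod_lintegral_of_indepFun _ _ hind
    fun j => hgm.comp (measurable_pi_apply j)]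
  have hj : ∀ j : Fin k, ∫⁻ w, g (w j) ∂(Measure.pi fun _ : Fin k => runLaw ν)
      = ENNReal.ofReal
        (Real.exp (intensity H f βmax βmin - (logZ H βmin - logZ H βmax))) := fun j => by
    rw [(measurePreserving_eval (fun _ : Fin k => runLaw ν) j).lintegral_comp hgm, hg,
      ← lintegral_prod_tpaRun hφ hβ hH hf]
    exact lintegral_congr_ae ((ae_prod_map_eq hφ hβ hH _).mono fun _ h => h.symm)
  rw [Finset.prod_congr rfl fun j _ => hj j, Finset.prod_const, Finset.card_univ,
    Fintype.card_fin, ← ENNReal.ofReal_pow (Real.exp_pos _).le, ← Real.exp_nat_mul]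

end PointsLaw

/-! ### Counts of points in disjoint intervals are independent Poisson variables -/

section Generating

/-- Uniqueness of power series. -/
lemma eq_zero_of_hasSum_zero {c : ℕ → ℝ} (hs : Summable fun n => |c n|)
    (h : ∀ x ∈ Set.Ioc (0 : ℝ) 1, HasSum (fun n => c n * x ^ n) 0) : ∀ n, c n = 0 := by
  intro n
  induction n using Nat.strong_induction_on with
  | _ n ih =>
    set M := ∑' i, |c i| with hM
    -- With the lower coefficients zero, the term c_n x^n is minus the tail of the series, which is
    -- at most x^{n+1} M; then x is taken small.
    have key : ∀ x ∈ Set.Ioc (0 : ℝ) 1, |c n| ≤ x * M := by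
      intro x hx
      have hx0 := hx.1
      have h1 := (hasSum_nat_add_iff' (f := fun n => c n * x ^ n) (n + 1)).2 (h x hx)
      rw [Finset.sum_range_succ, Finset.sum_eq_zero (s := Finset.range n)
        fun i hi => by rw [ih i (Finset.mem_range.1 hi), zero_mul], zero_add, zero_sub] at h1
      have hle : ∀ i, ‖c (i + (n + 1)) * x ^ (i + (n + 1))‖ ≤ x ^ (n + 1) * |c (i + (n + 1))| :=
        fun i => by
          rw [norm_mul, norm_pow, Real.norm_eq_abs, Real.norm_eq_abs, abs_of_pos hx0, mul_comm,
            pow_add, mul_comm (x ^ i), mul_assoc]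
          refine mul_le_mul_of_nonneg_left ?_ (by positivity)
          exact mul_le_of_le_one_left (by positivity) (pow_le_one₀ hx0.le hx.2)
      have hs' : Summable fun i => |c (i + (n + 1))| :=
        (summable_nat_add_iff (f := fun i => |c i|) (n + 1)).2 hs
      have h2 := tsum_of_norm_bounded (hs'.hasSum.mul_left (x ^ (n + 1))) hle
      rw [h1.tsum_eq, norm_neg, norm_mul, norm_pow, Real.norm_eq_abs, Real.norm_eq_abs,
        abs_of_pos hx0] at h2
      have hle' : ∑' i, |c (i + (n + 1))| ≤ M := by
        rw [hM, ← hs.sum_add_tsum_nat_add (n + 1)]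
        exact le_add_of_nonneg_left (Finset.sum_nonneg fun i _ => abs_nonneg _)
      have h3 : x ^ n * |c n| ≤ x ^ n * (x * M) := by
        calc x ^ n * |c n| = |c n| * x ^ n := mul_comm _ _
          _ ≤ x ^ (n + 1) * ∑' i, |c (i + (n + 1))| := h2
          _ ≤ x ^ (n + 1) * M := mul_le_mul_of_nonneg_left hle' (by positivity)
          _ = x ^ n * (x * M) := by ring
      exact le_of_mul_le_mul_left h3 (by positivity)
    have hM0 : 0 ≤ M := tsum_nonneg fun i => abs_nonneg _
    by_contra hc
    have hc' : 0 < |c n| := abs_pos.2 hc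
    have := key (min 1 (|c n| / (2 * (M + 1)))) ⟨by positivity, min_le_left _ _⟩
    have h4 : min 1 (|c n| / (2 * (M + 1))) * M ≤ |c n| / (2 * (M + 1)) * M := by
      gcongr; exact min_le_right _ _
    have h5 : |c n| / (2 * (M + 1)) * M < |c n| := by
      rw [div_mul_eq_mul_div, div_lt_iff₀ (by positivity)]; nlinarith
    linarith

/-- A sequence whose generating function is that of a multiple of a Poisson law. -/
lemma eq_poisson_of_tsum {a : ℕ → ℝ≥0∞} {C l : ℝ} (hC : 0 ≤ C)
    (h : ∀ x ∈ Set.Ioc (0 : ℝ) 1,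
      ∑' n, a n * ENNReal.ofReal x ^ n = ENNReal.ofReal (C * Real.exp (l * (x - 1)))) (n : ℕ) :
    a n = ENNReal.ofReal (C * (Real.exp (-l) * l ^ n / n.factorial)) := by
  have h1 : ∑' n, a n ≠ ⊤ := by
    have := h 1 ⟨one_pos, le_rfl⟩
    simp only [ENNReal.ofReal_one, one_pow, mul_one] at this
    rw [this]; exact ENNReal.ofReal_ne_top
  have hat : ∀ n, a n ≠ ⊤ := ENNReal.ne_top_of_tsum_ne_top h1
  have hb : ∀ x : ℝ, HasSum (fun n : ℕ => C * (Real.exp (-l) * l ^ n / n.factorial) * x ^ n)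
      (C * Real.exp (l * (x - 1))) := fun x => by
    have hs := NormedSpace.expSeries_div_hasSum_exp (l * x)
    rw [← Real.exp_eq_exp_ℝ] at hs
    have := hs.mul_left (C * Real.exp (-l))
    have e1 : (fun n : ℕ => C * (Real.exp (-l) * l ^ n / n.factorial) * x ^ n)
        = fun n => C * Real.exp (-l) * ((l * x) ^ n / n.factorial) := by
      funext n; rw [mul_pow]; ring
    have e2 : C * Real.exp (l * (x - 1)) = C * Real.exp (-l) * Real.exp (l * x) := by
      rw [mul_assoc, ← Real.exp_add]; congr 2; ring
    rw [e1, e2]; exact this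
  have ha : ∀ x ∈ Set.Ioc (0 : ℝ) 1, HasSum (fun n => (a n).toReal * x ^ n)
      (C * Real.exp (l * (x - 1))) := fun x hx => by
    have e : ∀ n, (a n).toReal * x ^ n = (a n * ENNReal.ofReal x ^ n).toReal := fun n => by
      rw [ENNReal.toReal_mul, ENNReal.toReal_pow, ENNReal.toReal_ofReal hx.1.le]
    simp_rw [e]
    have ht := ENNReal.hasSum_toReal (f := fun n => a n * ENNReal.ofReal x ^ n)
      (by rw [h x hx]; exact ENNReal.ofReal_ne_top)
    rwa [← ENNReal.tsum_toReal_eq fun n => ENNReal.mul_ne_top (hat n)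
      (ENNReal.pow_ne_top ENNReal.ofReal_ne_top), h x hx,
      ENNReal.toReal_ofReal (by positivity)] at ht
  have hz := eq_zero_of_hasSum_zero
    (c := fun n => (a n).toReal - C * (Real.exp (-l) * l ^ n / n.factorial))
    (by
      have s1 := (ha 1 ⟨one_pos, le_rfl⟩).summable
      have s2 := (hb 1).summable
      simpa using (s1.sub s2).abs)
    (fun x hx => by simpa [sub_mul] using (ha x hx).sub (hb x)) n
  rw [← sub_eq_zero.1 hz, ENNReal.ofReal_toReal (hat n)]

lemma lintegral_mul_pow {X : Type*} [MeasurableSpace X] {μ : Measure X} {N : X → ℕ}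
    (hN : Measurable N) {g : X → ℝ≥0∞} (hg : Measurable g) (x : ℝ≥0∞) :
    ∫⁻ ω, g ω * x ^ N ω ∂μ = ∑' n, (∫⁻ ω in N ⁻¹' {n}, g ω ∂μ) * x ^ n := by
  have hm : ∀ n, MeasurableSet (N ⁻¹' {n}) := fun n => hN (measurableSet_singleton n)
  have e : ∀ ω, g ω * x ^ N ω = ∑' n, (N ⁻¹' {n}).indicator g ω * x ^ n := fun ω => by
    rw [tsum_eq_single (N ω) fun n hn => by
      rw [Set.indicator_of_notMem (by simpa using hn.symm), zero_mul]]
    rw [Set.indicator_of_mem (by simp)]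
  simp_rw [e]
  rw [lintegral_tsum fun n => ((hg.indicator (hm n)).mul_const _).aemeasurable]
  refine tsum_congr fun n => ?_
  rw [lintegral_mul_const _ (hg.indicator (hm n)), lintegral_indicator (hm n)]

/-- Two counts with the joint generating function of independent Poisson variables. -/
lemma measure_counts_eq {X : Type*} [MeasurableSpace X] {μ : Measure X} {N N' : X → ℕ}
    (hN : Measurable N) (hN' : Measurable N') {l l' : ℝ} (hl : 0 ≤ l)
    (h : ∀ x ∈ Set.Ioc (0 : ℝ) 1, ∀ y ∈ Set.Ioc (0 : ℝ) 1,
      ∫⁻ ω, ENNReal.ofReal y ^ N' ω * ENNReal.ofReal x ^ N ω ∂μ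
        = ENNReal.ofReal (Real.exp (l' * (y - 1)) * Real.exp (l * (x - 1)))) (i j : ℕ) :
    μ (N ⁻¹' {i} ∩ N' ⁻¹' {j}) = ENNReal.ofReal
      ((Real.exp (-l) * l ^ i / i.factorial) * (Real.exp (-l') * l' ^ j / j.factorial)) := by
  refine eq_poisson_of_tsum (a := fun j => μ (N ⁻¹' {i} ∩ N' ⁻¹' {j}))
    (by positivity) (fun y hy => ?_) j
  -- For fixed y the coefficient of x^i is read off first. As a function of y it is again a multiple
  -- of a Poisson generating function, whose coefficients are the joint probabilities.
  have h1 := eq_poisson_of_tsum (a := fun i => ∫⁻ ω in N ⁻¹' {i}, ENNReal.ofReal y ^ N' ω ∂μ)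
    (C := Real.exp (l' * (y - 1))) (by positivity) (fun x hx => by
      rw [← lintegral_mul_pow hN (by fun_prop)]
      exact h x hx y hy) i
  have h2 := lintegral_mul_pow (μ := μ.restrict (N ⁻¹' {i})) hN' (g := fun _ => 1)
    measurable_const (ENNReal.ofReal y)
  simp only [one_mul] at h2
  rw [h1] at h2
  rw [mul_comm (Real.exp (-l) * l ^ i / i.factorial), h2]
  refine tsum_congr fun j => ?_
  rw [setLIntegral_one, Measure.restrict_apply (hN' (measurableSet_singleton j)),
    Set.inter_comm]

end Generating

/-! ### The joint law of two counts -/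

section Counts

variable {Ω : Type*} [Fintype Ω] {H : Ω → ℝ} {βmin βmax : ℝ} {S : Type*} [MeasurableSpace S]
  {ν : Measure S} {φ : ℝ → S → Ω}

/-- Expresses the joint generating function of two counts as the Laplace functional of a step
function. -/
lemma prod_map_two_weights (B : Multiset ℝ) (P P' : ℝ → Prop) [DecidablePred P]
    [DecidablePred P'] (x y : ℝ≥0∞) :
    (B.map fun b => (if P b then x else 1) * (if P' b then y else 1)).prod
      = y ^ B.countP P' * x ^ B.countP P := by
  induction B using Multiset.induction_on with
  | empty => simp
  | cons b B ih =>
    rw [Multiset.map_cons, Multiset.prod_cons, ih, Multiset.countP_cons, Multiset.countP_cons]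
    split_ifs <;> simp [pow_succ] <;> ring

lemma continuousAt_indicator_const {A : Set ℝ} {b : ℝ} (hb : b ∉ frontier A) (c : ℝ) :
    ContinuousAt (A.indicator fun _ => c) b := by
  by_cases h : b ∈ interior A
  · refine (continuousAt_const (y := c)).congr ?_
    filter_upwards [isOpen_interior.mem_nhds h] with x hx
    rw [Set.indicator_of_mem (interior_subset hx)]
  · have h' : b ∈ (closure A)ᶜ := fun hc => hb ⟨hc, h⟩
    refine (continuousAt_const (y := (0 : ℝ))).congr ?_
    filter_upwards [isClosed_closure.isOpen_compl.mem_nhds h'] with x hx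
    rw [Set.indicator_of_notMem fun hx' => hx (subset_closure hx')]

lemma integral_ite_Ioc [Nonempty Ω] {s t u v : ℝ} (hsu : s ≤ u) (huv : u ≤ v) (hvt : v ≤ t)
    {A : Set ℝ} (hA : A =ᵐ[volume] Set.Ioc u v) (c : ℝ) :
    ∫ b in s..t, A.indicator (fun b => c * meanH H b) b = c * (logZ H u - logZ H v) := by
  have h1 : ∫ b in s..t, A.indicator (fun b => c * meanH H b) b
      = ∫ b in s..t, (Set.Ioc u v).indicator (fun b => c * meanH H b) b :=
    intervalIntegral.integral_congr_ae
      ((indicator_ae_eq_of_ae_eq_set hA).mono fun b hb _ => hb)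
  rw [h1, intervalIntegral.integral_of_le (hsu.trans (huv.trans hvt)),
    setIntegral_indicator measurableSet_Ioc,
    Set.inter_eq_right.2 (Set.Ioc_subset_Ioc hsu hvt), ← intervalIntegral.integral_of_le huv,
    intervalIntegral.integral_const_mul]
  have := intensity_one (H := H) u v
  simp only [intensity, one_mul] at this
  rw [this]

/-- The numbers of points of `TPA(k)` in two adjacent intervals are independent Poisson
variables. -/
theorem measure_tpaUnion_counts [IsProbabilityMeasure ν]
    (hφ : IsSamplingOracle H βmin βmax ν φ) (hH : ∀ x, 0 ≤ H x) (k : ℕ) {u p v : ℝ}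
    (hu : βmin ≤ u) (hup : u ≤ p) (hpv : p ≤ v) (hv : v ≤ βmax) (i j : ℕ) :
    (Measure.pi fun _ : Fin k => runLaw ν)
      {w | (tpaUnion H βmin βmax φ w).countP (fun b => u ≤ b ∧ b ≤ p) = i ∧
        (tpaUnion H βmin βmax φ w).countP (fun b => p < b ∧ b ≤ v) = j}
      = ENNReal.ofReal
        ((Real.exp (-(k * (logZ H u - logZ H p))) * (k * (logZ H u - logZ H p)) ^ i / i.factorial)
        * (Real.exp (-(k * (logZ H p - logZ H v))) * (k * (logZ H p - logZ H v)) ^ j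
            / j.factorial)) := by
  classical
  have : Nonempty Ω := nonempty_of_oracle ν φ
  have hβ : βmin ≤ βmax := hu.trans (hup.trans (hpv.trans hv))
  have hz1 := sub_nonneg.2 (antitone_logZ hH hup)
  have hz2 := sub_nonneg.2 (antitone_logZ hH hpv)
  have hmeas : ∀ (P : ℝ → Prop) [DecidablePred P], MeasurableSet {b | P b} →
      Measurable fun w : Fin k → ℕ → S × I => (tpaUnion H βmin βmax φ w).countP P :=
    fun P _ hP => (measurable_countP_tpaUnion hφ (X := Unit) (P := fun _ => P)
      (measurable_snd hP)).comp (measurable_prodMk_left (x := ()))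
  have hN := hmeas (fun b => u ≤ b ∧ b ≤ p) measurableSet_Icc
  have hN' := hmeas (fun b => p < b ∧ b ≤ v) measurableSet_Ioc
  refine measure_counts_eq (μ := Measure.pi fun _ : Fin k => runLaw ν) hN hN'
    (by positivity) (fun x hx y hy => ?_) i j
  set f : ℝ → ℝ := fun b =>
    (if u ≤ b ∧ b ≤ p then x else 1) * (if p < b ∧ b ≤ v then y else 1) with hf
  have hfe : ∀ b, f b = 1 + ((Set.Icc u p).indicator (fun _ => x - 1) b
      + (Set.Ioc p v).indicator (fun _ => y - 1) b) := fun b => by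
    simp only [hf, Set.indicator_apply, Set.mem_Icc, Set.mem_Ioc]
    by_cases h1 : u ≤ b ∧ b ≤ p
    · have h2 : ¬(p < b ∧ b ≤ v) := fun h => absurd h1.2 (not_le.2 h.1)
      simp [h1, h2]
    · simp only [h1, if_false]; split_ifs <;> ring
  have hw : IsWeight f := by
    refine ⟨fun b => ?_, ?_, ⟨1, fun b => ?_⟩, ⟨{u, p, v}, by simp, fun b hb => ?_⟩⟩
    · have := hx.1.le; have := hy.1.le
      simp only [hf]; split_ifs <;> positivity
    · exact (Measurable.ite measurableSet_Icc measurable_const measurable_const).mul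
        (Measurable.ite measurableSet_Ioc measurable_const measurable_const)
    · refine mul_le_one₀ ?_ ?_ ?_ <;> split_ifs <;> linarith [hx.1, hx.2, hy.1, hy.2]
    · simp only [Set.mem_insert_iff, Set.mem_singleton_iff, not_or] at hb
      have : f = fun b => 1 + ((Set.Icc u p).indicator (fun _ => x - 1) b
        + (Set.Ioc p v).indicator (fun _ => y - 1) b) := funext hfe
      rw [this]
      refine continuousAt_const.add (ContinuousAt.add ?_ ?_)
      · refine continuousAt_indicator_const ?_ _
        rw [frontier_Icc hup]; simp [hb.1, hb.2.1]
      · refine continuousAt_indicator_const ?_ _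
        rcases hpv.eq_or_lt with h | h
        · simp [h]
        · rw [frontier_Ioc h]; simp [hb.2.1, hb.2.2]
  have hint : intensity H f βmax βmin - (logZ H βmin - logZ H βmax)
      = (x - 1) * (logZ H u - logZ H p) + (y - 1) * (logZ H p - logZ H v) := by
    rw [← intensity_one, ← integral_ite_Ioc (hu) hup (hpv.trans hv) Ioc_ae_eq_Icc.symm,
      ← integral_ite_Ioc (hu.trans hup) hpv hv (ae_eq_refl _), intensity, intensity]
    have hc := continuous_meanH H
    have i1 : ∀ (c : ℝ) (A : Set ℝ), MeasurableSet A → IntervalIntegrable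
        (A.indicator fun b => c * meanH H b) volume βmin βmax := fun c A hA =>
      ⟨((hc.const_mul c).intervalIntegrable _ _).1.indicator hA,
        ((hc.const_mul c).intervalIntegrable _ _).2.indicator hA⟩
    rw [← intervalIntegral.integral_add (i1 _ _ measurableSet_Icc) (i1 _ _ measurableSet_Ioc),
      sub_eq_iff_eq_add, ← intervalIntegral.integral_add
        ((i1 _ _ measurableSet_Icc).add (i1 _ _ measurableSet_Ioc))
        ((hc.const_mul 1).intervalIntegrable _ _)]
    refine intervalIntegral.integral_congr fun b _ => ?_
    simp only [hfe, Set.indicator_apply]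
    split_ifs <;> ring
  have hlap := lintegral_prod_tpaUnion hφ hβ hH hw k
  rw [hint] at hlap
  have e : ∀ w : Fin k → ℕ → S × I,
      ENNReal.ofReal y ^ (tpaUnion H βmin βmax φ w).countP (fun b => p < b ∧ b ≤ v)
        * ENNReal.ofReal x ^ (tpaUnion H βmin βmax φ w).countP (fun b => u ≤ b ∧ b ≤ p)
      = ((tpaUnion H βmin βmax φ w).map fun b => ENNReal.ofReal (f b)).prod := fun w => by
    rw [← prod_map_two_weights]
    refine congrArg Multiset.prod (Multiset.map_congr rfl fun b _ => ?_)
    simp only [hf]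
    split_ifs <;> simp [ENNReal.ofReal_mul, hx.1.le]
  rw [lintegral_congr e, hlap, ← Real.exp_add]
  congr 2; ring

end Counts

/-! ### Order statistics and the schedule -/

section Lists

/-- The number of elements of a sorted list satisfying a downward closed predicate. -/
lemma lt_countP_iff_of_sorted {L : List ℝ} (hL : L.Pairwise (· ≤ ·)) {P : ℝ → Prop}
    [DecidablePred P] (hP : ∀ x y, x ≤ y → P y → P x) {i : ℕ} (hi : i < L.length) :
    i < L.countP P ↔ P L[i] := by
  induction L generalizing i with
  | nil => simp at hi
  | cons a L ih =>
    rw [List.pairwise_cons] at hL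
    by_cases ha : P a
    · rw [List.countP_cons_of_pos (by simpa using ha)]
      cases i with
      | zero => simp [ha]
      | succ i =>
        rw [Nat.add_lt_add_iff_right, ih hL.2 (by simpa using hi)]; simp
    · have h0 : ∀ x ∈ a :: L, ¬ P x := by
        intro x hx
        rcases List.mem_cons.1 hx with rfl | hx
        · exact ha
        · exact fun h => ha (hP _ _ (hL.1 x hx) h)
      rw [List.countP_eq_zero.2 (by simpa using h0)]
      simp only [not_lt_zero, false_iff]
      exact h0 _ (List.getElem_mem hi)

/-- The `i`-th smallest element of a multiset (from `0`), with default value `a`. -/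
def ordStat (B : Multiset ℝ) (a : ℝ) (i : ℕ) : ℝ := (B.sort (· ≤ ·)).getD i a

lemma countP_sort (B : Multiset ℝ) (P : ℝ → Prop) [DecidablePred P] :
    (B.sort (· ≤ ·)).countP P = B.countP P := by
  conv_rhs => rw [← Multiset.sort_eq B (· ≤ ·)]
  rw [Multiset.coe_countP]

lemma ordStat_of_card_le {B : Multiset ℝ} {a : ℝ} {i : ℕ} (hi : B.card ≤ i) :
    ordStat B a i = a := by
  rw [ordStat, List.getD_eq_default]; simpa using hi

lemma ordStat_iff {B : Multiset ℝ} {a : ℝ} {i : ℕ} (hi : i < B.card) {P : ℝ → Prop}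
    [DecidablePred P] (hP : ∀ x y, x ≤ y → P y → P x) :
    P (ordStat B a i) ↔ i < B.countP P := by
  have hi' : i < (B.sort (· ≤ ·)).length := by simpa using hi
  rw [← countP_sort, lt_countP_iff_of_sorted (Multiset.pairwise_sort B (· ≤ ·)) hP hi', ordStat,
    List.getD_eq_getElem _ _ hi']

lemma ordStat_mem {B : Multiset ℝ} {a : ℝ} {i : ℕ} (hi : i < B.card) : ordStat B a i ∈ B := by
  have hi' : i < (B.sort (· ≤ ·)).length := by simpa using hi
  rw [ordStat, List.getD_eq_getElem _ _ hi', ← Multiset.mem_sort (r := (· ≤ ·))]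
  exact List.getElem_mem hi'

/-- The number of elements which are at most `p`. -/
def cnt (B : Multiset ℝ) (p : ℝ) : ℕ := B.countP (· ≤ p)

/-- The `j`-th element of `B ∩ (-∞, p]` from the right, or `a` if there is none. -/
def leftPt (B : Multiset ℝ) (a p : ℝ) (j : ℕ) : ℝ :=
  if j ≤ cnt B p then ordStat B a (cnt B p - j) else a

/-- The `l`-th element of `B ∩ (p, ∞)` from the left, or `b` if there is none. -/
def rightPt (B : Multiset ℝ) (b p : ℝ) (l : ℕ) : ℝ := ordStat B b (cnt B p + l - 1)

variable {B : Multiset ℝ} {a b p : ℝ}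

lemma countP_add_countP_Icc (B : Multiset ℝ) {u p : ℝ} (hup : u ≤ p) :
    B.countP (· < u) + B.countP (fun x => u ≤ x ∧ x ≤ p) = cnt B p := by
  unfold cnt
  induction B using Multiset.induction_on with
  | empty => simp
  | cons x B ih =>
    simp only [Multiset.countP_cons]
    have : (if x ≤ p then 1 else 0)
        = (if x < u then 1 else 0) + (if u ≤ x ∧ x ≤ p then 1 else 0) := by
      by_cases h1 : x < u
      · simp [h1, (h1.le.trans hup), not_le.2 h1]
      · simp [h1, not_lt.1 h1]
    rw [this]; omega

lemma countP_add_countP_Ioc (B : Multiset ℝ) {p v : ℝ} (hpv : p ≤ v) :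
    cnt B p + B.countP (fun x => p < x ∧ x ≤ v) = cnt B v := by
  unfold cnt
  induction B using Multiset.induction_on with
  | empty => simp
  | cons x B ih =>
    simp only [Multiset.countP_cons]
    have : (if x ≤ v then 1 else 0)
        = (if x ≤ p then 1 else 0) + (if p < x ∧ x ≤ v then 1 else 0) := by
      by_cases h1 : x ≤ p
      · simp [h1, (h1.trans hpv), not_lt.2 h1]
      · simp [h1, not_le.1 h1]
    rw [this]; omega

lemma cnt_le_card (B : Multiset ℝ) (p : ℝ) : cnt B p ≤ B.card := Multiset.countP_le_card _ _

/-- Together with `lt_rightPt_iff` this turns positions of points into counts, whose law is Poisson.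
If there are too few points the default lies beyond the threshold, so the equivalence persists. -/
lemma leftPt_lt_iff {u : ℝ} (hau : a < u) (hup : u ≤ p) {j : ℕ} (hj : 1 ≤ j) :
    leftPt B a p j < u ↔ B.countP (fun x => u ≤ x ∧ x ≤ p) < j := by
  have h := countP_add_countP_Icc B hup
  have hc := cnt_le_card B p
  unfold leftPt
  split_ifs with hjp
  · rw [ordStat_iff (P := (· < u)) (by omega) fun x y hxy hy => hxy.trans_lt hy]
    omega
  · exact iff_of_true hau (by omega)

lemma lt_rightPt_iff {v : ℝ} (hpv : p ≤ v) (hvb : v < b) {l : ℕ} (hl : 1 ≤ l) :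
    v < rightPt B b p l ↔ B.countP (fun x => p < x ∧ x ≤ v) < l := by
  have h := countP_add_countP_Ioc B hpv
  have hc := cnt_le_card B v
  unfold rightPt
  by_cases hi : cnt B p + l - 1 < B.card
  · rw [← not_le, ordStat_iff (P := (· ≤ v)) hi fun x y hxy hy => hxy.trans hy]
    change ¬ (_ < cnt B v) ↔ _
    omega
  · rw [ordStat_of_card_le (not_lt.1 hi)]
    exact iff_of_true hvb (by omega)

lemma leftPt_mem (hB : ∀ x ∈ B, x ∈ Set.Icc a b) (hp : p ∈ Set.Icc a b) {j : ℕ} (hj : 1 ≤ j) :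
    leftPt B a p j ∈ Set.Icc a p := by
  have hc := cnt_le_card B p
  unfold leftPt
  split_ifs with hjp
  · have hi : cnt B p - j < B.card := by omega
    refine ⟨(hB _ (ordStat_mem hi)).1, ?_⟩
    rw [ordStat_iff (P := (· ≤ p)) hi fun x y hxy hy => hxy.trans hy]
    change _ < cnt B p
    omega
  · exact ⟨le_rfl, hp.1⟩

lemma rightPt_mem (hB : ∀ x ∈ B, x ∈ Set.Icc a b) (hp : p ∈ Set.Icc a b) {l : ℕ} (hl : 1 ≤ l) :
    rightPt B b p l ∈ Set.Icc p b := by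
  unfold rightPt
  by_cases hi : cnt B p + l - 1 < B.card
  · refine ⟨?_, (hB _ (ordStat_mem hi)).2⟩
    refine le_of_not_ge fun h => ?_
    have := (ordStat_iff (P := (· ≤ p)) hi fun x y hxy hy => hxy.trans hy).1 h
    change _ < cnt B p at this
    omega
  · rw [ordStat_of_card_le (not_lt.1 hi)]; exact ⟨hp.2, le_rfl⟩

lemma lt_rightPt (hpb : p < b) {l : ℕ} (hl : 1 ≤ l) : p < rightPt B b p l := by
  rw [lt_rightPt_iff le_rfl hpb hl]
  rw [Multiset.countP_eq_zero.2]
  · omega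
  · intro x _ h; exact absurd h.1 (not_lt.2 h.2)

lemma getElem_mem_keepEvery {d : ℕ} {c : Fin d} {L : List ℝ} {i : ℕ} (hi : i < L.length)
    (hc : i % d = c) : L[i] ∈ keepEvery c L := by
  unfold keepEvery
  rw [List.mem_filterMap]
  refine ⟨(L[i], i), ?_, by simp [hc]⟩
  rw [List.mem_zipIdx_iff_getElem?]
  simp [hi]

lemma filterMap_zipIdx_sublist (L : List ℝ) (P : ℕ → Prop) [DecidablePred P] (n : ℕ) :
    ((L.zipIdx n).filterMap fun p => if P p.2 then some p.1 else none).Sublist L := by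
  induction L generalizing n with
  | nil => simp
  | cons x L ih =>
    rw [List.zipIdx_cons, List.filterMap_cons]
    by_cases h : P n
    · simp only [h, if_true]; exact (ih (n + 1)).cons_cons x
    · simp only [h, if_false]; exact (ih (n + 1)).cons x

lemma keepEvery_sublist {d : ℕ} (c : Fin d) (L : List ℝ) : (keepEvery c L).Sublist L :=
  filterMap_zipIdx_sublist L (fun i => i % d = c) 0

/-- Each position has exactly one residue modulo d, so the d sublists partition L. The initial index
is general for the sake of the induction. -/
lemma sum_length_filterMap_zipIdx {d : ℕ} (hd : 0 < d) (L : List ℝ) (n : ℕ) :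
    ∑ c : Fin d, ((L.zipIdx n).filterMap fun p =>
      if p.2 % d = c then some p.1 else none).length = L.length := by
  induction L generalizing n with
  | nil => simp
  | cons x L ih =>
    have : ∀ c : Fin d, (((x :: L).zipIdx n).filterMap fun p =>
        if p.2 % d = c then some p.1 else none).length
        = (if (⟨n % d, Nat.mod_lt _ hd⟩ : Fin d) = c then 1 else 0)
          + ((L.zipIdx (n + 1)).filterMap fun p =>
            if p.2 % d = c then some p.1 else none).length := fun c => by
      rw [List.zipIdx_cons, List.filterMap_cons]
      by_cases h : n % d = c
      · simp [h, add_comm]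
      · have h' : ¬ ((⟨n % d, Nat.mod_lt _ hd⟩ : Fin d) = c) := fun h' => h (by rw [← h'])
        simp [h, h']
    simp_rw [this]
    rw [Finset.sum_add_distrib, ih (n + 1)]
    simp [add_comm]

lemma sum_length_keepEvery {d : ℕ} (hd : 0 < d) (L : List ℝ) :
    ∑ c : Fin d, (keepEvery c L).length = L.length :=
  sum_length_filterMap_zipIdx hd L 0

/-- Sort a multiset, keep every `d`-th value, and add `a` and `b`. -/
def scheduleOf (B : Multiset ℝ) (a b : ℝ) {d : ℕ} (c : Fin d) : List ℝ :=
  a :: (keepEvery c (B.sort (· ≤ ·)) ++ [b])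

lemma mem_scheduleOf (hab : a ≤ b) (hB : ∀ x ∈ B, x ∈ Set.Icc a b) {d : ℕ} {c : Fin d} {x : ℝ}
    (hx : x ∈ scheduleOf B a b c) : x ∈ Set.Icc a b := by
  rw [scheduleOf, List.mem_cons, List.mem_append, List.mem_singleton] at hx
  rcases hx with rfl | hx | rfl
  · exact ⟨le_rfl, hab⟩
  · exact hB x (by simpa using (keepEvery_sublist c _).subset hx)
  · exact ⟨hab, le_rfl⟩

lemma pairwise_scheduleOf (hab : a ≤ b) (hB : ∀ x ∈ B, x ∈ Set.Icc a b) {d : ℕ} (c : Fin d) :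
    (scheduleOf B a b c).Pairwise (· ≤ ·) := by
  have hk : ∀ x ∈ keepEvery c (B.sort (· ≤ ·)), x ∈ Set.Icc a b := fun x hx =>
    hB x (by simpa using (keepEvery_sublist c _).subset hx)
  rw [scheduleOf, List.pairwise_cons, List.pairwise_append]
  refine ⟨fun x hx => ?_, (Multiset.pairwise_sort B (· ≤ ·)).sublist (keepEvery_sublist c _),
    List.pairwise_singleton _ _, fun x hx y hy => ?_⟩
  · rcases List.mem_append.1 hx with hx | hx
    · exact (hk x hx).1
    · rw [List.mem_singleton.1 hx]; exact hab
  · rw [List.mem_singleton.1 hy]; exact (hk x hx).2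

lemma ordStat_mem_scheduleOf {d : ℕ} {c : Fin d} {i : ℕ} (hi : i < B.card) (hc : i % d = c)
    (a' : ℝ) : ordStat B a' i ∈ scheduleOf B a b c := by
  have hi' : i < (B.sort (· ≤ ·)).length := by simpa using hi
  rw [ordStat, List.getD_eq_getElem _ _ hi', scheduleOf]
  exact List.mem_cons_of_mem _ (List.mem_append_left _ (getElem_mem_keepEvery hi' hc))

/-- The interval of the schedule containing `p` lies between the points obtained by counting from
`p` to the left and to the right. -/
lemma scheduleOf_interval (hab : a ≤ b) (hB : ∀ x ∈ B, x ∈ Set.Icc a b) {d : ℕ} {c : Fin d}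
    {l₁ l₂ : List ℝ} {s s' : ℝ} (hl : scheduleOf B a b c = l₁ ++ s :: s' :: l₂)
    (hp : p ∈ Set.Ico s s') {t : ℕ} (ht : t < d) (htc : (cnt B p + t) % d = c) :
    leftPt B a p (d - t) ≤ s ∧ s' ≤ rightPt B b p (t + 1) := by
  have hs : s ∈ Set.Icc a b := mem_scheduleOf hab hB (c := c) (by rw [hl]; simp)
  have hs' : s' ∈ Set.Icc a b := mem_scheduleOf hab hB (c := c) (by rw [hl]; simp)
  have hpab : p ∈ Set.Icc a b := ⟨hs.1.trans hp.1, hp.2.le.trans hs'.2⟩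
  have hsort := pairwise_scheduleOf hab hB c
  rw [hl, List.pairwise_append, List.pairwise_cons, List.pairwise_cons] at hsort
  obtain ⟨-, ⟨h1, h2, -⟩, h3⟩ := hsort
  -- No schedule point lies strictly between s and s'. Both points counted from p belong to the
  -- schedule: their indices `cnt B p - (d - t)` and `cnt B p + t` are congruent to c modulo d, and
  -- a missing point is replaced by the endpoint a or b, which was added.
  have hmem : ∀ x ∈ scheduleOf B a b c, x ≤ s ∨ s' ≤ x := fun x hx => by
    rw [hl, List.mem_append, List.mem_cons, List.mem_cons] at hx
    rcases hx with hx | rfl | rfl | hx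
    · exact .inl (h3 x hx s (by simp))
    · exact .inl le_rfl
    · exact .inr le_rfl
    · exact .inr (h2 x hx)
  constructor
  · have hle := (leftPt_mem hB hpab (j := d - t) (by omega)).2
    have : leftPt B a p (d - t) ∈ scheduleOf B a b c := by
      unfold leftPt
      split_ifs with h
      · have := cnt_le_card B p
        refine ordStat_mem_scheduleOf (by omega) ?_ a
        rw [← htc, ← Nat.add_mod_right]
        congr 1
        omega
      · simp [scheduleOf]
    exact (hmem _ this).resolve_right fun h => absurd (h.trans hle) (not_le.2 hp.2)
  · have hlt := lt_rightPt (B := B) (hp.2.trans_le hs'.2) (l := t + 1) (by omega)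
    have : rightPt B b p (t + 1) ∈ scheduleOf B a b c := by
      unfold rightPt
      by_cases hi : cnt B p + (t + 1) - 1 < B.card
      · refine ordStat_mem_scheduleOf hi ?_ b
        rw [← htc]; congr 1
      · rw [ordStat_of_card_le (not_lt.1 hi)]; simp [scheduleOf]
    exact (hmem _ this).resolve_left fun h => absurd (h.trans hp.1) (not_le.2 hlt)

end Lists

/-! ### Erlang laws -/

section Erlang

/-- The density of the sum of `n + 1` independent exponential variables. -/
def erlangPDF (n : ℕ) (t : ℝ) : ℝ := t ^ n * Real.exp (-t) / n.factorial

/-- The law of the sum of `n + 1` independent exponential variables. -/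
def erlang (n : ℕ) : Measure ℝ :=
  (volume.restrict (Set.Ioi 0)).withDensity fun t => ENNReal.ofReal (erlangPDF n t)

/-- The tail `P(N ≤ n)` of the Erlang law, where `N` is a Poisson variable of mean `y`. -/
def erlangTail (n : ℕ) (y : ℝ) : ℝ :=
  ∑ i ∈ Finset.range (n + 1), Real.exp (-y) * y ^ i / i.factorial

lemma continuous_erlangPDF (n : ℕ) : Continuous (erlangPDF n) := by unfold erlangPDF; fun_prop

lemma erlangPDF_nonneg (n : ℕ) {t : ℝ} (ht : 0 ≤ t) : 0 ≤ erlangPDF n t := by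
  unfold erlangPDF; positivity

lemma erlangTail_succ (n : ℕ) (y : ℝ) :
    erlangTail (n + 1) y = erlangTail n y + erlangPDF (n + 1) y := by
  rw [erlangTail, Finset.sum_range_succ, ← erlangTail, erlangPDF, mul_comm (Real.exp (-y))]

lemma erlangTail_zero (n : ℕ) : erlangTail n 0 = 1 := by
  induction n with
  | zero => simp [erlangTail]
  | succ n ih => rw [erlangTail_succ, ih]; simp [erlangPDF]

lemma erlangTail_nonneg (n : ℕ) {y : ℝ} (hy : 0 ≤ y) : 0 ≤ erlangTail n y :=
  Finset.sum_nonneg fun i _ => by positivity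

lemma hasDerivAt_erlangTail (n : ℕ) (y : ℝ) : HasDerivAt (erlangTail n) (-erlangPDF n y) y := by
  have he : HasDerivAt (fun y : ℝ => Real.exp (-y)) (Real.exp (-y) * -1) y :=
    (hasDerivAt_neg y).exp
  induction n with
  | zero =>
    have : erlangTail 0 = fun y => Real.exp (-y) := by funext y; simp [erlangTail]
    rw [this]
    exact he.congr_deriv (by simp [erlangPDF])
  | succ n ih =>
    have h1 : HasDerivAt (erlangPDF (n + 1))
        ((((n + 1 : ℕ) : ℝ) * y ^ n * Real.exp (-y) + y ^ (n + 1) * (Real.exp (-y) * -1))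
          / (n + 1).factorial) y :=
      (((hasDerivAt_pow (n + 1) y)).mul he).div_const _
    have : erlangTail (n + 1) = fun y => erlangTail n y + erlangPDF (n + 1) y :=
      funext (erlangTail_succ n)
    rw [this]
    refine (ih.add h1).congr_deriv ?_
    have h2 : (n.factorial : ℝ) ≠ 0 := by positivity
    have h3 : (n : ℝ) + 1 ≠ 0 := by positivity
    simp only [erlangPDF, Nat.factorial_succ]
    push_cast
    field_simp
    ring

lemma tendsto_erlangTail (n : ℕ) : Tendsto (erlangTail n) atTop (𝓝 0) := by
  have : Tendsto (fun y : ℝ => ∑ i ∈ Finset.range (n + 1), y ^ i * Real.exp (-y) / i.factorial)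
      atTop (𝓝 (∑ i ∈ Finset.range (n + 1), 0 / (i.factorial : ℝ))) :=
    tendsto_finsetSum _ fun i _ =>
      (Real.tendsto_pow_mul_exp_neg_atTop_nhds_zero i).div_const _
  simp only [zero_div, Finset.sum_const_zero] at this
  refine this.congr fun y => Finset.sum_congr rfl fun i _ => by rw [mul_comm (Real.exp (-y))]

lemma integral_erlangPDF (n : ℕ) {y : ℝ} (hy : 0 ≤ y) :
    IntegrableOn (erlangPDF n) (Set.Ioi y) ∧
      ∫ t in Set.Ioi y, erlangPDF n t = erlangTail n y := by
  have hd : ∀ t ∈ Set.Ici y, HasDerivAt (fun t => -erlangTail n t) (erlangPDF n t) t :=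
    fun t _ => (hasDerivAt_erlangTail n t).neg.congr_deriv (neg_neg _)
  have hl : Tendsto (fun t => -erlangTail n t) atTop (𝓝 0) := by
    simpa using (tendsto_erlangTail n).neg
  have hnn : ∀ t ∈ Set.Ioi y, 0 ≤ erlangPDF n t := fun t ht =>
    erlangPDF_nonneg n (hy.trans (le_of_lt ht))
  exact ⟨integrableOn_Ioi_deriv_of_nonneg' hd hnn hl, by
    rw [integral_Ioi_of_hasDerivAt_of_nonneg' hd hnn hl]; ring⟩

lemma lintegral_erlangPDF (n : ℕ) {y : ℝ} (hy : 0 ≤ y) :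
    ∫⁻ t in Set.Ioi y, ENNReal.ofReal (erlangPDF n t) = ENNReal.ofReal (erlangTail n y) := by
  have h := integral_erlangPDF n hy
  rw [← h.2, ofReal_integral_eq_lintegral_ofReal h.1]
  exact (ae_restrict_iff' measurableSet_Ioi).2 (ae_of_all _ fun t ht =>
    erlangPDF_nonneg n (hy.trans (le_of_lt ht)))

lemma erlang_Ioi (n : ℕ) {y : ℝ} (hy : 0 ≤ y) :
    erlang n (Set.Ioi y) = ENNReal.ofReal (erlangTail n y) := by
  rw [erlang, withDensity_apply _ measurableSet_Ioi, Measure.restrict_restrict measurableSet_Ioi,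
    Set.inter_eq_left.2 (Set.Ioi_subset_Ioi hy), lintegral_erlangPDF n hy]

instance isProbabilityMeasure_erlang (n : ℕ) : IsProbabilityMeasure (erlang n) := ⟨by
  rw [erlang, withDensity_apply _ .univ, Measure.restrict_univ, lintegral_erlangPDF n le_rfl,
    erlangTail_zero, ENNReal.ofReal_one]⟩

lemma erlang_Ioi_of_neg (n : ℕ) {y : ℝ} (hy : y ≤ 0) : erlang n (Set.Ioi y) = 1 := by
  refine le_antisymm prob_le_one ?_
  have : erlang n (Set.Ioi 0) = 1 := by
    rw [erlang_Ioi n le_rfl, erlangTail_zero, ENNReal.ofReal_one]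
  rw [← this]
  exact measure_mono (Set.Ioi_subset_Ioi hy)

/-- The integrand of Γ(n+2, c) is (n+1)! times the Erlang density of shape n + 2. -/
lemma upperGamma_eq (n : ℕ) {c : ℝ} (hc : 0 ≤ c) :
    upperGamma (n + 2) c = (n + 1).factorial * erlangTail (n + 1) c := by
  rw [upperGamma, ← (integral_erlangPDF (n + 1) hc).2, ← integral_const_mul]
  refine setIntegral_congr_fun measurableSet_Ioi fun t _ => ?_
  have h1 : ((n : ℝ) + 2 - 1) = ((n + 1 : ℕ) : ℝ) := by push_cast; ring
  have h2 : ((n + 1).factorial : ℝ) ≠ 0 := by positivity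
  simp only [h1, Real.rpow_natCast, erlangPDF]
  field_simp

/-- The truncated mean of the Erlang law. -/
lemma lintegral_erlang_truncated (n : ℕ) {c : ℝ} (hc : 0 ≤ c) :
    ∫⁻ t, (Set.Ioi c).indicator ENNReal.ofReal t ∂(erlang n)
      = ENNReal.ofReal (upperGamma (n + 2) c / n.factorial) := by
  rw [lintegral_indicator measurableSet_Ioi, erlang,
    restrict_withDensity measurableSet_Ioi, Measure.restrict_restrict measurableSet_Ioi,
    Set.inter_eq_left.2 (Set.Ioi_subset_Ioi hc),
    lintegral_withDensity_eq_lintegral_mul _ (continuous_erlangPDF n).measurable.ennreal_ofReal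
      ENNReal.measurable_ofReal]
  -- Size biasing: multiplying the density by t raises the shape by one, up to the factor n + 1.
  have e : ∀ t ∈ Set.Ioi c, ((fun t => ENNReal.ofReal (erlangPDF n t)) * ENNReal.ofReal) t
      = ENNReal.ofReal (n + 1) * ENNReal.ofReal (erlangPDF (n + 1) t) := fun t ht => by
    have ht0 : 0 ≤ t := hc.trans (le_of_lt ht)
    rw [Pi.mul_apply, ← ENNReal.ofReal_mul (erlangPDF_nonneg n ht0),
      ← ENNReal.ofReal_mul (by positivity)]
    congr 1
    have h2 : (n.factorial : ℝ) ≠ 0 := by positivity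
    have h3 : (n : ℝ) + 1 ≠ 0 := by positivity
    simp only [erlangPDF, Nat.factorial_succ]
    push_cast
    field_simp
    ring
  rw [setLIntegral_congr_fun measurableSet_Ioi e,
    lintegral_const_mul _ (continuous_erlangPDF (n + 1)).measurable.ennreal_ofReal,
    lintegral_erlangPDF (n + 1) hc, ← ENNReal.ofReal_mul (by positivity), upperGamma_eq n hc]
  congr 1
  rw [Nat.factorial_succ]
  push_cast
  field_simp

/-- The Beta integral, by parts: each integration moves one power from y - s to s. -/
lemma integral_pow_mul_sub_pow (n i : ℕ) (y : ℝ) :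
    ∫ s in (0 : ℝ)..y, s ^ n / n.factorial * ((y - s) ^ i / i.factorial)
      = y ^ (n + i + 1) / (n + i + 1).factorial := by
  induction i generalizing n with
  | zero =>
    simp only [pow_zero, Nat.factorial_zero, Nat.cast_one, div_one, mul_one, add_zero]
    rw [intervalIntegral.integral_div, integral_pow, Nat.factorial_succ]
    push_cast
    simp only [ne_eq, Nat.add_eq_zero_iff, one_ne_zero, and_false, not_false_eq_true, zero_pow,
      sub_zero]
    rw [div_div]
  | succ i ih =>
    have hd : ∀ s ∈ Set.uIcc 0 y, HasDerivAt
        (fun s : ℝ => s ^ (n + 1) / (n + 1).factorial * ((y - s) ^ (i + 1) / (i + 1).factorial))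
        (s ^ n / n.factorial * ((y - s) ^ (i + 1) / (i + 1).factorial)
          - s ^ (n + 1) / (n + 1).factorial * ((y - s) ^ i / i.factorial)) s := fun s _ => by
      have h1 : HasDerivAt (fun s : ℝ => s ^ (n + 1) / ((n + 1).factorial : ℝ))
          (((n + 1 : ℕ) : ℝ) * s ^ n / (n + 1).factorial) s :=
        (hasDerivAt_pow (n + 1) s).div_const _
      have h0 : HasDerivAt (fun s : ℝ => y - s) (-1) s := by
        simpa using (hasDerivAt_id s).const_sub y
      have h2 : HasDerivAt (fun s : ℝ => (y - s) ^ (i + 1) / ((i + 1).factorial : ℝ))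
          (((i + 1 : ℕ) : ℝ) * (y - s) ^ i * (-1) / (i + 1).factorial) s :=
        (h0.pow (i + 1)).div_const _
      refine (h1.mul h2).congr_deriv ?_
      have f1 : (n.factorial : ℝ) ≠ 0 := by positivity
      have f2 : (n : ℝ) + 1 ≠ 0 := by positivity
      have f3 : (i.factorial : ℝ) ≠ 0 := by positivity
      have f4 : (i : ℝ) + 1 ≠ 0 := by positivity
      simp only [Nat.factorial_succ]
      push_cast
      field_simp
      ring
    have := intervalIntegral.integral_eq_sub_of_hasDerivAt hd
      (Continuous.intervalIntegrable (by fun_prop) _ _)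
    rw [intervalIntegral.integral_sub (Continuous.intervalIntegrable (by fun_prop) _ _)
      (Continuous.intervalIntegrable (by fun_prop) _ _), ih (n + 1)] at this
    simp only [sub_self, ne_eq, Nat.add_eq_zero_iff, one_ne_zero, and_false, not_false_eq_true,
      zero_pow, zero_div, mul_zero, zero_mul] at this
    rw [sub_eq_zero.1 this]
    congr 2 <;> ring_nf

/-- For independent Erlang variables S and T this is P(S ≤ y < S + T). Raising m adds one term to
the tail; in it the exponentials combine to e^{-y} and a Beta integral remains. -/
lemma integral_erlangPDF_mul_tail (n m : ℕ) (y : ℝ) :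
    ∫ s in (0 : ℝ)..y, erlangPDF n s * erlangTail m (y - s)
      = erlangTail (n + m + 1) y - erlangTail n y := by
  induction m with
  | zero =>
    rw [add_zero, erlangTail_succ, add_sub_cancel_left, erlangPDF]
    have := integral_pow_mul_sub_pow n 0 y
    rw [add_zero] at this
    rw [mul_div_right_comm, ← this, ← intervalIntegral.integral_mul_const]
    refine intervalIntegral.integral_congr fun s _ => ?_
    have : Real.exp (-y) = Real.exp (-s) * Real.exp (-(y - s)) := by
      rw [← Real.exp_add]; congr 1; ring
    simp [erlangPDF, erlangTail, this]
    ring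
  | succ m ih =>
    have hc : Continuous (erlangTail m) :=
      continuous_iff_continuousAt.2 fun y => (hasDerivAt_erlangTail m y).continuousAt
    have hp := continuous_erlangPDF
    have e : ∀ s, erlangPDF n s * erlangTail (m + 1) (y - s)
        = erlangPDF n s * erlangTail m (y - s) + s ^ n / n.factorial *
          ((y - s) ^ (m + 1) / (m + 1).factorial) * Real.exp (-y) := fun s => by
      have : Real.exp (-y) = Real.exp (-s) * Real.exp (-(y - s)) := by
        rw [← Real.exp_add]; congr 1; ring
      rw [erlangTail_succ, mul_add, this]
      simp only [erlangPDF]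
      ring
    have i1 : Continuous fun s => erlangPDF n s * erlangTail m (y - s) := by fun_prop
    have i2 : Continuous fun s : ℝ => s ^ n / n.factorial *
        ((y - s) ^ (m + 1) / (m + 1).factorial) * Real.exp (-y) := by fun_prop
    simp_rw [e]
    rw [intervalIntegral.integral_add (i1.intervalIntegrable _ _) (i2.intervalIntegrable _ _), ih,
      intervalIntegral.integral_mul_const, integral_pow_mul_sub_pow,
      show n + (m + 1) + 1 = (n + m + 1) + 1 by ring, erlangTail_succ (n + m + 1), erlangPDF]
    ring

/-- The sum of independent Erlang variables is an Erlang variable. -/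
lemma erlang_prod_apply (n m : ℕ) {y : ℝ} (hy : 0 ≤ y) :
    ((erlang n).prod (erlang m)) {x | y < x.1 + x.2} = erlang (n + m + 1) (Set.Ioi y) := by
  have hmeas : MeasurableSet {x : ℝ × ℝ | y < x.1 + x.2} :=
    measurableSet_lt measurable_const (by fun_prop)
  have hslice : ∀ s, Prod.mk s ⁻¹' {x : ℝ × ℝ | y < x.1 + x.2} = Set.Ioi (y - s) := fun s => by
    ext t; simp [sub_lt_iff_lt_add']
  have hmm : Measurable fun s => erlang m (Set.Ioi (y - s)) := by
    have := measurable_measure_prodMk_left (ν := erlang m) hmeas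
    simpa only [hslice] using this
  have hc : Continuous (erlangTail m) :=
    continuous_iff_continuousAt.2 fun y => (hasDerivAt_erlangTail m y).continuousAt
  rw [Measure.prod_apply hmeas]
  simp_rw [hslice]
  rw [erlang, lintegral_withDensity_eq_lintegral_mul _
    (continuous_erlangPDF n).measurable.ennreal_ofReal hmm,
    ← Set.Ioc_union_Ioi_eq_Ioi hy, lintegral_union measurableSet_Ioi
      (Set.Ioc_disjoint_Ioi le_rfl)]
  have e1 : ∀ s ∈ Set.Ioc 0 y, ((fun t => ENNReal.ofReal (erlangPDF n t)) *
      fun s => erlang m (Set.Ioi (y - s))) s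
      = ENNReal.ofReal (erlangPDF n s * erlangTail m (y - s)) := fun s hs => by
    rw [Pi.mul_apply, erlang_Ioi m (sub_nonneg.2 hs.2),
      ENNReal.ofReal_mul (erlangPDF_nonneg n hs.1.le)]
  have e2 : ∀ s ∈ Set.Ioi y, ((fun t => ENNReal.ofReal (erlangPDF n t)) *
      fun s => erlang m (Set.Ioi (y - s))) s = ENNReal.ofReal (erlangPDF n s) := fun s hs => by
    rw [Pi.mul_apply, erlang_Ioi_of_neg m (sub_nonpos.2 (le_of_lt hs)), mul_one]
  rw [setLIntegral_congr_fun measurableSet_Ioc e1, setLIntegral_congr_fun measurableSet_Ioi e2,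
    lintegral_erlangPDF n hy, erlang_Ioi _ hy, ← ofReal_integral_eq_lintegral_ofReal,
    ← intervalIntegral.integral_of_le hy, integral_erlangPDF_mul_tail, ← ENNReal.ofReal_add,
    sub_add_cancel]
  · rw [← integral_erlangPDF_mul_tail]
    exact intervalIntegral.integral_nonneg hy fun s hs =>
      mul_nonneg (erlangPDF_nonneg n hs.1) (erlangTail_nonneg m (sub_nonneg.2 hs.2))
  · exact erlangTail_nonneg n hy
  · exact (((continuous_erlangPDF n).mul (hc.comp (by fun_prop))).intervalIntegrable 0 y).1
  · exact (ae_restrict_iff' measurableSet_Ioc).2 (ae_of_all _ fun s hs =>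
      mul_nonneg (erlangPDF_nonneg n hs.1.le) (erlangTail_nonneg m (sub_nonneg.2 hs.2)))

end Erlang

/-! ### Stochastic domination and truncated means -/

section Domination

variable {X : Type*} [MeasurableSpace X] {μ : Measure X} [IsProbabilityMeasure μ]

/-- Stochastic domination is preserved by sums of independent variables. -/
lemma measure_lt_add_le {A C : X → ℝ} (hA : Measurable A) (hC : Measurable C)
    (hind : IndepFun A C μ) {γ γ' : Measure ℝ} [IsProbabilityMeasure γ] [IsProbabilityMeasure γ']
    (h : ∀ y, μ {ω | y < A ω} ≤ γ (Set.Ioi y)) (h' : ∀ y, μ {ω | y < C ω} ≤ γ' (Set.Ioi y))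
    (y : ℝ) : μ {ω | y < A ω + C ω} ≤ (γ.prod γ') {x | y < x.1 + x.2} := by
  have hmeas : MeasurableSet {x : ℝ × ℝ | y < x.1 + x.2} :=
    measurableSet_lt measurable_const (by fun_prop)
  have hs : ∀ s, Prod.mk s ⁻¹' {x : ℝ × ℝ | y < x.1 + x.2} = Set.Ioi (y - s) := fun s => by
    ext t; simp [sub_lt_iff_lt_add']
  have hs' : ∀ t, (fun s => (s, t)) ⁻¹' {x : ℝ × ℝ | y < x.1 + x.2} = Set.Ioi (y - t) :=
    fun t => by ext s; simp [sub_lt_iff_lt_add]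
  have := Measure.isProbabilityMeasure_map (μ := μ) hA.aemeasurable
  have := Measure.isProbabilityMeasure_map (μ := μ) hC.aemeasurable
  calc μ {ω | y < A ω + C ω}
      = (μ.map fun ω => (A ω, C ω)) {x | y < x.1 + x.2} := by
        rw [Measure.map_apply (hA.prodMk hC) hmeas]; rfl
    _ = ((μ.map A).prod (μ.map C)) {x | y < x.1 + x.2} := by
        rw [(indepFun_iff_map_prod_eq_prod_map_map hA.aemeasurable hC.aemeasurable).1 hind]
    _ ≤ ((μ.map A).prod γ') {x | y < x.1 + x.2} := by
        rw [Measure.prod_apply hmeas, Measure.prod_apply hmeas]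
        refine lintegral_mono fun s => ?_
        simp only [hs]
        rw [Measure.map_apply hC measurableSet_Ioi]
        exact h' _
    _ ≤ (γ.prod γ') {x | y < x.1 + x.2} := by
        rw [Measure.prod_apply_symm hmeas, Measure.prod_apply_symm hmeas]
        refine lintegral_mono fun t => ?_
        simp only [hs']
        rw [Measure.map_apply hA measurableSet_Ioi]
        exact h _

/-- The layer-cake formula: for y ≥ 0 the truncated variable exceeds y exactly when E exceeds both y
and c. Truncated means are therefore monotone in the tails. -/
lemma lintegral_truncated_eq (κ : Measure X) {E : X → ℝ} (hE : Measurable E) {c : ℝ}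
    (hc : 0 ≤ c) : ∫⁻ ω, (Set.Ioi c).indicator ENNReal.ofReal (E ω) ∂κ
      = ∫⁻ y in Set.Ioi 0, κ {ω | max y c < E ω} := by
  have hm : Measurable fun ω => (Set.Ioi c).indicator (fun t => t) (E ω) :=
    (measurable_id.indicator measurableSet_Ioi).comp hE
  have e : ∀ ω, (Set.Ioi c).indicator ENNReal.ofReal (E ω)
      = ENNReal.ofReal ((Set.Ioi c).indicator (fun t => t) (E ω)) := fun ω => by
    simp only [Set.indicator_apply]; split_ifs <;> simp
  have hnn : ∀ ω, 0 ≤ (Set.Ioi c).indicator (fun t => t) (E ω) := fun ω =>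
    Set.indicator_nonneg (fun t ht => hc.trans (le_of_lt ht)) _
  simp_rw [e]
  rw [lintegral_eq_lintegral_meas_lt κ (ae_of_all _ hnn) hm.aemeasurable]
  refine setLIntegral_congr_fun measurableSet_Ioi fun y hy => ?_
  congr 1
  ext ω
  simp only [Set.mem_ofPred_eq, Set.indicator_apply, Set.mem_Ioi, max_lt_iff]
  split_ifs with h
  · simp [h]
  · simp only [h, and_false, iff_false, not_lt]; exact le_of_lt hy

/-- Stochastic domination bounds truncated means. -/
lemma lintegral_truncated_le (μ : Measure X) {D : X → ℝ} (hD : Measurable D) {γ : Measure ℝ}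
    {c : ℝ} (hc : 0 ≤ c)
    (h : ∀ y, 0 ≤ y → μ {ω | y < D ω} ≤ γ (Set.Ioi y)) :
    ∫⁻ ω, (Set.Ioi c).indicator ENNReal.ofReal (D ω) ∂μ
      ≤ ∫⁻ t, (Set.Ioi c).indicator ENNReal.ofReal t ∂γ := by
  rw [lintegral_truncated_eq μ hD hc, lintegral_truncated_eq γ (E := fun t => t) measurable_id hc]
  exact setLIntegral_mono' measurableSet_Ioi fun y hy => h _ (le_max_of_le_right hc)

end Domination

/-! ### The distance between the neighbours of a fixed point -/

section Neighbours

variable {Ω : Type*} [Fintype Ω] {H : Ω → ℝ} {βmin βmax : ℝ} {S : Type*} [MeasurableSpace S]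
  {ν : Measure S} {φ : ℝ → S → Ω} {k : ℕ}

lemma measurable_countP_fixed (hφ : IsSamplingOracle H βmin βmax ν φ) (P : ℝ → Prop)
    [DecidablePred P] (hP : MeasurableSet {b | P b}) :
    Measurable fun w : Fin k → ℕ → S × I => (tpaUnion H βmin βmax φ w).countP P :=
  (measurable_countP_tpaUnion hφ (X := Unit) (P := fun _ => P)
    (measurable_snd hP)).comp (measurable_prodMk_left (x := ()))

lemma measurable_card (hφ : IsSamplingOracle H βmin βmax ν φ) :
    Measurable fun w : Fin k → ℕ → S × I => (tpaUnion H βmin βmax φ w).card := by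
  have := measurable_countP_fixed (k := k) hφ (fun _ => True) (by simp)
  simpa only [Multiset.countP_True] using this

lemma measurable_ordStat (hφ : IsSamplingOracle H βmin βmax ν φ) (a : ℝ) (i : ℕ) :
    Measurable fun w : Fin k → ℕ → S × I => ordStat (tpaUnion H βmin βmax φ w) a i := by
  refine measurable_of_Iio fun u => ?_
  have e : (fun w : Fin k → ℕ → S × I => ordStat (tpaUnion H βmin βmax φ w) a i) ⁻¹' Set.Iio u
      = {w | i < (tpaUnion H βmin βmax φ w).card} ∩
          {w | i < (tpaUnion H βmin βmax φ w).countP (· < u)}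
        ∪ {w | i < (tpaUnion H βmin βmax φ w).card}ᶜ ∩ {_w | a < u} := by
    ext w
    simp only [Set.mem_preimage, Set.mem_Iio, Set.mem_union, Set.mem_inter_iff,
      Set.mem_compl_iff, Set.mem_ofPred_eq]
    by_cases h : i < (tpaUnion H βmin βmax φ w).card
    · rw [ordStat_iff (P := (· < u)) h fun x y hxy hy => hxy.trans_lt hy]; simp [h]
    · rw [ordStat_of_card_le (not_lt.1 h)]; simp [h]
  have h1 : MeasurableSet {w : Fin k → ℕ → S × I | i < (tpaUnion H βmin βmax φ w).card} :=
    measurableSet_lt measurable_const (measurable_card hφ)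
  rw [e]
  exact (h1.inter (measurableSet_lt measurable_const
    (measurable_countP_fixed hφ (· < u) measurableSet_Iio))).union (h1.compl.inter (.const _))

lemma measurable_cnt (hφ : IsSamplingOracle H βmin βmax ν φ) :
    Measurable fun q : ℝ × (Fin k → ℕ → S × I) => cnt (tpaUnion H βmin βmax φ q.2) q.1 :=
  measurable_countP_tpaUnion hφ (P := fun p b => b ≤ p)
    (measurableSet_le measurable_snd measurable_fst)

lemma measurable_ordStat_index (hφ : IsSamplingOracle H βmin βmax ν φ) (a : ℝ) {X : Type*}
    [MeasurableSpace X] {g : X → ℕ} (hg : Measurable g) {w : X → Fin k → ℕ → S × I}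
    (hw : Measurable w) :
    Measurable fun x => ordStat (tpaUnion H βmin βmax φ (w x)) a (g x) := by
  have : Measurable fun p : ℕ × (Fin k → ℕ → S × I) =>
      ordStat (tpaUnion H βmin βmax φ p.2) a p.1 :=
    measurable_from_prod_countable_right fun i => measurable_ordStat hφ a i
  simpa only [Function.comp_def] using this.comp (hg.prodMk hw)

lemma measurable_leftPt (hφ : IsSamplingOracle H βmin βmax ν φ) (a : ℝ) (j : ℕ) :
    Measurable fun q : ℝ × (Fin k → ℕ → S × I) =>
      leftPt (tpaUnion H βmin βmax φ q.2) a q.1 j := by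
  unfold leftPt
  exact Measurable.ite (measurableSet_le measurable_const (measurable_cnt hφ))
    (measurable_ordStat_index hφ a ((measurable_cnt hφ).sub_const j) measurable_snd)
    measurable_const

lemma measurable_rightPt (hφ : IsSamplingOracle H βmin βmax ν φ) (b : ℝ) (l : ℕ) :
    Measurable fun q : ℝ × (Fin k → ℕ → S × I) =>
      rightPt (tpaUnion H βmin βmax φ q.2) b q.1 l := by
  unfold rightPt
  exact measurable_ordStat_index hφ b (((measurable_cnt hφ).add_const l).sub_const 1)
    measurable_snd

/-- The decrease of `ln Z` between the `(d - t)`-th point to the left of `p` and the `(t + 1)`-th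
point to the right. -/
def gapAt (H : Ω → ℝ) (βmin βmax : ℝ) (d t : ℕ) (B : Multiset ℝ) (p : ℝ) : ℝ :=
  logZ H (leftPt B βmin p (d - t)) - logZ H (rightPt B βmax p (t + 1))

lemma measurable_gapAt [Nonempty Ω] (hφ : IsSamplingOracle H βmin βmax ν φ) (d t : ℕ) :
    Measurable fun q : ℝ × (Fin k → ℕ → S × I) =>
      gapAt H βmin βmax d t (tpaUnion H βmin βmax φ q.2) q.1 :=
  ((continuous_logZ H).measurable.comp (measurable_leftPt hφ βmin (d - t))).sub
    ((continuous_logZ H).measurable.comp (measurable_rightPt hφ βmax (t + 1)))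

lemma measurable_leftPt_fixed (hφ : IsSamplingOracle H βmin βmax ν φ) (p : ℝ) (j : ℕ) :
    Measurable fun w : Fin k → ℕ → S × I => leftPt (tpaUnion H βmin βmax φ w) βmin p j := by
  simpa only [Function.comp_def] using
    (measurable_leftPt hφ βmin j).comp (measurable_prodMk_left (x := p))

lemma measurable_rightPt_fixed (hφ : IsSamplingOracle H βmin βmax ν φ) (p : ℝ) (l : ℕ) :
    Measurable fun w : Fin k → ℕ → S × I => rightPt (tpaUnion H βmin βmax φ w) βmax p l := by
  simpa only [Function.comp_def] using
    (measurable_rightPt hφ βmax l).comp (measurable_prodMk_left (x := p))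

variable [IsProbabilityMeasure ν]

lemma measure_counts_lt (hφ : IsSamplingOracle H βmin βmax ν φ) (hH : ∀ x, 0 ≤ H x)
    {u p v : ℝ} (hu : βmin ≤ u) (hup : u ≤ p) (hpv : p ≤ v) (hv : v ≤ βmax) (j l : ℕ) :
    (Measure.pi fun _ : Fin k => runLaw ν)
      {w | (tpaUnion H βmin βmax φ w).countP (fun b => u ≤ b ∧ b ≤ p) < j + 1 ∧
        (tpaUnion H βmin βmax φ w).countP (fun b => p < b ∧ b ≤ v) < l + 1}
      = ENNReal.ofReal (erlangTail j (k * (logZ H u - logZ H p)))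
        * ENNReal.ofReal (erlangTail l (k * (logZ H p - logZ H v))) := by
  have : Nonempty Ω := nonempty_of_oracle ν φ
  have hz1 := sub_nonneg.2 (antitone_logZ hH hup)
  have hz2 := sub_nonneg.2 (antitone_logZ hH hpv)
  have hN := measurable_countP_fixed (k := k) hφ (fun b => u ≤ b ∧ b ≤ p) measurableSet_Icc
  have hN' := measurable_countP_fixed (k := k) hφ (fun b => p < b ∧ b ≤ v) measurableSet_Ioc
  set N := fun w : Fin k → ℕ → S × I =>
    (tpaUnion H βmin βmax φ w).countP (fun b => u ≤ b ∧ b ≤ p)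
  set N' := fun w : Fin k → ℕ → S × I =>
    (tpaUnion H βmin βmax φ w).countP (fun b => p < b ∧ b ≤ v)
  have e : {w | N w < j + 1 ∧ N' w < l + 1}
      = ⋃ x ∈ Finset.range (j + 1) ×ˢ Finset.range (l + 1), {w | N w = x.1 ∧ N' w = x.2} := by
    ext w
    simp only [Set.mem_ofPred_eq, Set.mem_iUnion, Finset.mem_product, Finset.mem_range,
      exists_prop, Prod.exists]
    constructor
    · intro h; exact ⟨_, _, h, rfl, rfl⟩
    · rintro ⟨a, b, h, h1, h2⟩; rw [h1, h2]; exact h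
  refine (congrArg _ e).trans ?_
  rw [measure_biUnion_finset]
  · rw [← ENNReal.ofReal_mul (erlangTail_nonneg _ (by positivity)), erlangTail, erlangTail,
      Finset.sum_mul_sum, ← Finset.sum_product', ENNReal.ofReal_sum_of_nonneg
        fun x _ => by positivity]
    exact Finset.sum_congr rfl fun x _ =>
      measure_tpaUnion_counts hφ hH k hu hup hpv hv x.1 x.2
  · rintro x - y - hxy
    refine Set.disjoint_left.2 fun w hx hy => hxy ?_
    exact Prod.ext (hx.1.symm.trans hy.1) (hx.2.symm.trans hy.2)
  · exact fun x _ => (hN (measurableSet_singleton x.1)).inter (hN' (measurableSet_singleton x.2))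

lemma measure_count_left_lt (hφ : IsSamplingOracle H βmin βmax ν φ) (hH : ∀ x, 0 ≤ H x)
    {u p : ℝ} (hu : βmin ≤ u) (hup : u ≤ p) (hp : p ≤ βmax) (j : ℕ) :
    (Measure.pi fun _ : Fin k => runLaw ν)
      {w | (tpaUnion H βmin βmax φ w).countP (fun b => u ≤ b ∧ b ≤ p) < j + 1}
      = ENNReal.ofReal (erlangTail j (k * (logZ H u - logZ H p))) := by
  have := measure_counts_lt (k := k) hφ hH hu hup le_rfl hp j 0
  rw [sub_self, mul_zero, erlangTail_zero, ENNReal.ofReal_one, mul_one] at this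
  rw [← this]
  congr 1
  ext w
  simp only [Set.mem_ofPred_eq]
  have : (tpaUnion H βmin βmax φ w).countP (fun b => p < b ∧ b ≤ p) = 0 :=
    Multiset.countP_eq_zero.2 fun x _ h => absurd h.1 (not_lt.2 h.2)
  rw [this]
  simp

/-- The left interval degenerates to {p}. It could contain points, but only with probability zero,
so its constraint can be dropped. -/
lemma measure_count_right_lt (hφ : IsSamplingOracle H βmin βmax ν φ) (hH : ∀ x, 0 ≤ H x)
    {p v : ℝ} (hp : βmin ≤ p) (hpv : p ≤ v) (hv : v ≤ βmax) (l : ℕ) :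
    (Measure.pi fun _ : Fin k => runLaw ν)
      {w | (tpaUnion H βmin βmax φ w).countP (fun b => p < b ∧ b ≤ v) < l + 1}
      = ENNReal.ofReal (erlangTail l (k * (logZ H p - logZ H v))) := by
  have h1 := measure_counts_lt (k := k) hφ hH hp le_rfl hpv hv 0 l
  have h2 := measure_count_left_lt (k := k) hφ hH hp le_rfl (hpv.trans hv) 0
  rw [sub_self, mul_zero, erlangTail_zero, ENNReal.ofReal_one] at h2
  rw [sub_self, mul_zero, erlangTail_zero, ENNReal.ofReal_one, one_mul] at h1
  rw [← h1]
  have hm := measurable_countP_fixed (k := k) hφ (fun b => p ≤ b ∧ b ≤ p) measurableSet_Icc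
    (measurableSet_Iio (a := 0 + 1))
  have hae : ∀ᵐ w ∂(Measure.pi fun _ : Fin k => runLaw ν),
      (tpaUnion H βmin βmax φ w).countP (fun b => p ≤ b ∧ b ≤ p) < 0 + 1 :=
    (prob_compl_eq_zero_iff hm).2 h2
  refine measure_congr ?_
  filter_upwards [hae] with w hw
  exact propext ⟨fun h => ⟨hw, h⟩, fun h => h.2⟩

/-- It suffices to test half-lines opening to the left for the left point and to the right for the
right point. These events are trivial outside the range, and otherwise are count events on adjacent
intervals, whose probabilities factor. -/
lemma indepFun_leftPt_rightPt (hφ : IsSamplingOracle H βmin βmax ν φ) (hH : ∀ x, 0 ≤ H x)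
    {p : ℝ} (hp : p ∈ Set.Icc βmin βmax) (j l : ℕ) :
    IndepFun (fun w : Fin k → ℕ → S × I => leftPt (tpaUnion H βmin βmax φ w) βmin p (j + 1))
      (fun w => rightPt (tpaUnion H βmin βmax φ w) βmax p (l + 1))
      (Measure.pi fun _ : Fin k => runLaw ν) := by
  set L := fun w : Fin k → ℕ → S × I => leftPt (tpaUnion H βmin βmax φ w) βmin p (j + 1)
  set R := fun w : Fin k → ℕ → S × I => rightPt (tpaUnion H βmin βmax φ w) βmax p (l + 1)
  have hL : Measurable L := measurable_leftPt_fixed hφ p (j + 1)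
  have hR : Measurable R := measurable_rightPt_fixed hφ p (l + 1)
  have hLmem : ∀ w, L w ∈ Set.Icc βmin p := fun w =>
    leftPt_mem (fun x hx => mem_of_mem_tpaUnion hx) hp (by omega)
  have hRmem : ∀ w, R w ∈ Set.Icc p βmax := fun w =>
    rightPt_mem (fun x hx => mem_of_mem_tpaUnion hx) hp (by omega)
  refine (IndepFun_iff_Indep L R _).2 ?_
  refine IndepSets.indep hL.comap_le hR.comap_le (isPiSystem_Iio.comap L) (isPiSystem_Ioi.comap R)
    (p1 := {s | ∃ t ∈ Set.range Set.Iio, L ⁻¹' t = s})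
    (p2 := {s | ∃ t ∈ Set.range Set.Ioi, R ⁻¹' t = s}) ?_ ?_ ?_
  · rw [borel_eq_generateFrom_Iio ℝ |> (BorelSpace.measurable_eq (α := ℝ)).trans,
      MeasurableSpace.comap_generateFrom]
    rfl
  · rw [borel_eq_generateFrom_Ioi ℝ |> (BorelSpace.measurable_eq (α := ℝ)).trans,
      MeasurableSpace.comap_generateFrom]
    rfl
  · rw [IndepSets_iff]
    rintro _ _ ⟨_, ⟨u, rfl⟩, rfl⟩ ⟨_, ⟨v, rfl⟩, rfl⟩
    rcases le_or_gt u βmin with hu | hu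
    · have : L ⁻¹' Set.Iio u = ∅ := Set.eq_empty_of_forall_notMem fun w hw =>
        absurd (hu.trans (hLmem w).1) (not_le.2 hw)
      simp [this]
    rcases lt_or_ge p u with hup | hup
    · have : L ⁻¹' Set.Iio u = Set.univ := Set.eq_univ_of_forall fun w =>
        (hLmem w).2.trans_lt hup
      simp [this]
    rcases le_or_gt βmax v with hv | hv
    · have : R ⁻¹' Set.Ioi v = ∅ := Set.eq_empty_of_forall_notMem fun w hw =>
        absurd ((hRmem w).2.trans hv) (not_le.2 hw)
      simp [this]
    rcases lt_or_ge v p with hpv | hpv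
    · have : R ⁻¹' Set.Ioi v = Set.univ := Set.eq_univ_of_forall fun w =>
        hpv.trans_le (hRmem w).1
      simp [this]
    have e1 : L ⁻¹' Set.Iio u = {w | (tpaUnion H βmin βmax φ w).countP
        (fun b => u ≤ b ∧ b ≤ p) < j + 1} := by
      ext w; exact leftPt_lt_iff hu hup (by omega)
    have e2 : R ⁻¹' Set.Ioi v = {w | (tpaUnion H βmin βmax φ w).countP
        (fun b => p < b ∧ b ≤ v) < l + 1} := by
      ext w; exact lt_rightPt_iff hpv hv (by omega)
    rw [e1, e2, measure_count_left_lt hφ hH hu.le hup hp.2,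
      measure_count_right_lt hφ hH hp.1 hpv hv.le, ← measure_counts_lt hφ hH hu.le hup hpv hv.le]
    rfl

/-- If z(u) = z(p) + y/k, the gap exceeds y only when [u, p] has at most j points, and that count is
Poisson of mean y. If z(βmin) does not exceed z(p) + y/k the event is empty; stopping at βmin is why
this is only domination. -/
lemma measure_lt_left_gap_le (hφ : IsSamplingOracle H βmin βmax ν φ) (hH : ∀ x, 0 ≤ H x)
    (hk : 0 < k) {p : ℝ} (hp : p ∈ Set.Icc βmin βmax) (j : ℕ) (y : ℝ) :
    (Measure.pi fun _ : Fin k => runLaw ν) {w | y < k *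
        (logZ H (leftPt (tpaUnion H βmin βmax φ w) βmin p (j + 1)) - logZ H p)}
      ≤ erlang j (Set.Ioi y) := by
  have : Nonempty Ω := nonempty_of_oracle ν φ
  have hk' : (0 : ℝ) < k := Nat.cast_pos.2 hk
  rcases lt_or_ge y 0 with hy | hy
  · rw [erlang_Ioi_of_neg _ hy.le]; exact prob_le_one
  have hmem : ∀ w : Fin k → ℕ → S × I,
      leftPt (tpaUnion H βmin βmax φ w) βmin p (j + 1) ∈ Set.Icc βmin p := fun w =>
    leftPt_mem (fun x hx => mem_of_mem_tpaUnion hx) hp (by omega)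
  rcases le_or_gt (logZ H βmin) (logZ H p + y / k) with h | h
  · refine (measure_mono_null (t := ∅) (fun w hw => ?_) measure_empty).trans_le zero_le
    have h1 := antitone_logZ hH (hmem w).1
    have h2 : y < k * (logZ H (leftPt (tpaUnion H βmin βmax φ w) βmin p (j + 1)) - logZ H p) := hw
    rw [← div_lt_iff₀' hk'] at h2
    linarith
  · have hy' : 0 ≤ y / k := by positivity
    obtain ⟨u, hu, hzu⟩ := intermediate_value_Icc' hp.1 (continuous_logZ H).continuousOn
      (show logZ H p + y / k ∈ Set.Icc (logZ H p) (logZ H βmin) from ⟨by linarith, h.le⟩)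
    have hu' : βmin < u := lt_of_le_of_ne hu.1 fun h' => by
      rw [← h'] at hzu; exact absurd hzu h.ne'
    have hT := measure_count_left_lt (k := k) hφ hH hu.1 hu.2 hp.2 j
    rw [hzu, add_sub_cancel_left, mul_div_cancel₀ _ hk'.ne'] at hT
    rw [erlang_Ioi _ hy, ← hT]
    refine measure_mono fun w hw => ?_
    have h2 : y < k * (logZ H (leftPt (tpaUnion H βmin βmax φ w) βmin p (j + 1)) - logZ H p) := hw
    rw [← div_lt_iff₀' hk'] at h2
    refine (leftPt_lt_iff hu' hu.2 (by omega)).1 (lt_of_not_ge fun h3 => ?_)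
    have := antitone_logZ hH h3
    linarith

lemma measure_lt_right_gap_le (hφ : IsSamplingOracle H βmin βmax ν φ) (hH : ∀ x, 0 ≤ H x)
    (hk : 0 < k) {p : ℝ} (hp : p ∈ Set.Icc βmin βmax) (l : ℕ) (y : ℝ) :
    (Measure.pi fun _ : Fin k => runLaw ν) {w | y < k *
        (logZ H p - logZ H (rightPt (tpaUnion H βmin βmax φ w) βmax p (l + 1)))}
      ≤ erlang l (Set.Ioi y) := by
  have : Nonempty Ω := nonempty_of_oracle ν φ
  have hk' : (0 : ℝ) < k := Nat.cast_pos.2 hk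
  rcases lt_or_ge y 0 with hy | hy
  · rw [erlang_Ioi_of_neg _ hy.le]; exact prob_le_one
  have hmem : ∀ w : Fin k → ℕ → S × I,
      rightPt (tpaUnion H βmin βmax φ w) βmax p (l + 1) ∈ Set.Icc p βmax := fun w =>
    rightPt_mem (fun x hx => mem_of_mem_tpaUnion hx) hp (by omega)
  rcases le_or_gt (logZ H p - y / k) (logZ H βmax) with h | h
  · refine (measure_mono_null (t := ∅) (fun w hw => ?_) measure_empty).trans_le zero_le
    have h1 := antitone_logZ hH (hmem w).2
    have h2 : y < k * (logZ H p - logZ H (rightPt (tpaUnion H βmin βmax φ w) βmax p (l + 1))) :=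
      hw
    rw [← div_lt_iff₀' hk'] at h2
    linarith
  · have hy' : 0 ≤ y / k := by positivity
    obtain ⟨v, hv, hzv⟩ := intermediate_value_Icc' hp.2 (continuous_logZ H).continuousOn
      (show logZ H p - y / k ∈ Set.Icc (logZ H βmax) (logZ H p) from ⟨h.le, by linarith⟩)
    have hv' : v < βmax := lt_of_le_of_ne hv.2 fun h' => by
      rw [h'] at hzv; exact absurd hzv h.ne
    have hT := measure_count_right_lt (k := k) hφ hH hp.1 hv.1 hv.2 l
    rw [hzv, sub_sub_cancel, mul_div_cancel₀ _ hk'.ne'] at hT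
    rw [erlang_Ioi _ hy, ← hT]
    refine measure_mono fun w hw => ?_
    have h2 : y < k * (logZ H p - logZ H (rightPt (tpaUnion H βmin βmax φ w) βmax p (l + 1))) :=
      hw
    rw [← div_lt_iff₀' hk'] at h2
    refine (lt_rightPt_iff hv.1 hv' (by omega)).1 (lt_of_not_ge fun h3 => ?_)
    have := antitone_logZ hH h3
    linarith

/-- The truncated mean of the gap around a fixed point is at most that of an Erlang variable. -/
theorem lintegral_gapAt_le (hφ : IsSamplingOracle H βmin βmax ν φ) (hH : ∀ x, 0 ≤ H x)
    (hk : 0 < k) {p : ℝ} (hp : p ∈ Set.Icc βmin βmax) {d t : ℕ} (ht : t < d) {c : ℝ}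
    (hc : 0 ≤ c) :
    ∫⁻ w, (Set.Ioi c).indicator ENNReal.ofReal
        (k * gapAt H βmin βmax d t (tpaUnion H βmin βmax φ w) p)
        ∂(Measure.pi fun _ : Fin k => runLaw ν)
      ≤ ENNReal.ofReal (upperGamma (d + 2) c / d.factorial) := by
  have : Nonempty Ω := nonempty_of_oracle ν φ
  -- The sides contribute d - t = j + 1 and t + 1 exponential gaps, together d + 1, hence `erlang d`
  -- for every t.
  obtain ⟨j, rfl⟩ : ∃ j, d = j + t + 1 := ⟨d - t - 1, by omega⟩
  have hj : j + t + 1 - t = j + 1 := by omega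
  have hL := measurable_leftPt_fixed hφ (k := k) p (j + 1)
  have hR := measurable_rightPt_fixed hφ (k := k) p (t + 1)
  have hz := (continuous_logZ H).measurable
  have hind := (indepFun_leftPt_rightPt (k := k) hφ hH hp j t).comp
    (φ := fun x => k * (logZ H x - logZ H p)) (ψ := fun x => k * (logZ H p - logZ H x))
    (by fun_prop) (by fun_prop)
  have e : ∀ w : Fin k → ℕ → S × I,
      k * gapAt H βmin βmax (j + t + 1) t (tpaUnion H βmin βmax φ w) p
      = k * (logZ H (leftPt (tpaUnion H βmin βmax φ w) βmin p (j + 1)) - logZ H p)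
        + k * (logZ H p - logZ H (rightPt (tpaUnion H βmin βmax φ w) βmax p (t + 1))) :=
    fun w => by rw [gapAt, hj]; ring
  rw [← lintegral_erlang_truncated _ hc]
  simp_rw [e]
  refine lintegral_truncated_le _ (by fun_prop) hc fun y hy => ?_
  rw [← erlang_prod_apply j t hy]
  exact measure_lt_add_le (by fun_prop) (by fun_prop) hind
    (measure_lt_left_gap_le hφ hH hk hp j) (measure_lt_right_gap_le hφ hH hk hp t) y

end Neighbours

/-! ### The total curvature of the schedule -/

section Deterministic

variable {Ω : Type*} [Fintype Ω] (H : Ω → ℝ)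

/-- The sum of the curvatures of the intervals of a schedule. -/
def totalCurvature : List ℝ → ℝ
  | s :: s' :: l => curvature H s s' + totalCurvature (s' :: l)
  | _ => 0

variable {H} [Nonempty Ω]

lemma totalCurvature_cons_le (hH : ∀ x, 0 ≤ H x) {b : ℝ} (l : List ℝ) {s : ℝ} (hs : s ≤ b)
    (hl : ∀ x ∈ l, x ≤ b) (h : (s :: l).IsChain (· ≤ ·)) :
    totalCurvature H (s :: l) ≤ logZ H s - logZ H b := by
  induction l generalizing s with
  | nil => simpa [totalCurvature] using antitone_logZ hH hs
  | cons s' l ih =>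
    rw [List.isChain_cons_cons] at h
    have := ih (hl s' (by simp)) (fun x hx => hl x (by simp [hx])) h.2
    have := curvature_le_sub hH h.1
    rw [totalCurvature]; linarith

/-- Spreading the decrease of ln(-z') over the points p of the interval allows the decrease of z to
be bounded separately at each p, by a quantity whose law is known for fixed p. -/
lemma ofReal_curvature_le (hH : ∀ x, 0 ≤ H x) {s s' : ℝ} (hss : s ≤ s') {D : ℝ → ℝ}
    (hD : ∀ p ∈ Set.Ico s s', logZ H s - logZ H s' ≤ D p) (hpos : s < s' → 0 < meanH H s') :
    ENNReal.ofReal (curvature H s s') ≤ 2⁻¹ *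
      ∫⁻ p in Set.Ico s s', ENNReal.ofReal (D p) * ENNReal.ofReal (slopeRate H p) := by
  rcases hss.eq_or_lt with rfl | hlt
  · have : (s + s) / 2 = s := by ring
    rw [curvature, this, show logZ H s + logZ H s - 2 * logZ H s = 0 by ring]; simp
  have hz := sub_nonneg.2 (antitone_logZ hH hss)
  calc ENNReal.ofReal (curvature H s s')
      ≤ ENNReal.ofReal (1 / 2 * (logZ H s - logZ H s') *
        (Real.log (meanH H s) - Real.log (meanH H s'))) :=
        ENNReal.ofReal_le_ofReal (curvature_le_mul_log hH hss (hpos hlt))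
    _ = 2⁻¹ * ∫⁻ p in Set.Ico s s', ENNReal.ofReal (logZ H s - logZ H s') *
          ENNReal.ofReal (slopeRate H p) := by
        rw [lintegral_const_mul _ (measurable_slopeRate H).ennreal_ofReal,
          lintegral_slopeRate hH hss (hpos hlt), ENNReal.ofReal_mul (by positivity),
          ENNReal.ofReal_mul (by norm_num), mul_assoc, one_div, ENNReal.ofReal_inv_of_pos two_pos,
          ENNReal.ofReal_ofNat]
    _ ≤ _ := by
        gcongr 2⁻¹ * ?_
        refine setLIntegral_mono' measurableSet_Ico fun p hp => ?_
        gcongr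
        exact hD p hp

/-- The total curvature of a schedule, where `D p` bounds the decrease of `ln Z` on the interval
containing `p`. -/
lemma ofReal_totalCurvature_le (hH : ∀ x, 0 ≤ H x) {b b' : ℝ} {D : ℝ → ℝ}
    (l : List ℝ) {s : ℝ} (hs : s ≤ b) (hpos : s < b → 0 < meanH H b) (hl : ∀ x ∈ l, x ≤ b')
    (h : (s :: l).IsChain fun s s' => s ≤ s' ∧ ∀ p ∈ Set.Ico s s', logZ H s - logZ H s' ≤ D p) :
    ENNReal.ofReal (totalCurvature H (s :: l)) ≤
      2⁻¹ * (∫⁻ p in Set.Ico s b, ENNReal.ofReal (D p) * ENNReal.ofReal (slopeRate H p))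
        + ENNReal.ofReal (D b) + ENNReal.ofReal (logZ H b - logZ H b') := by
  induction l generalizing s with
  | nil => simp [totalCurvature]
  | cons s' l ih =>
    rw [List.isChain_cons_cons] at h
    obtain ⟨⟨hss, hD⟩, h⟩ := h
    have hl' : ∀ x ∈ l, x ≤ b' := fun x hx => hl x (by simp [hx])
    rw [totalCurvature]
    refine ENNReal.ofReal_add_le.trans ?_
    -- Intervals left of b add to the integral. The one with s ≤ b < s' is bounded crudely by D b,
    -- and all later ones telescope to at most z(b) - z(b').
    rcases le_or_gt s' b with hsb | hsb
    · have h1 := ih hsb (fun h => hpos (hss.trans_lt h)) hl' h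
      have h2 := ofReal_curvature_le hH hss hD fun hlt =>
        meanH_pos_of_pos hH (hpos (hlt.trans_le hsb)) s'
      refine (add_le_add h2 h1).trans ?_
      rw [← add_assoc, ← add_assoc, ← mul_add, ← lintegral_union measurableSet_Ico
        (Set.Ico_disjoint_Ico_same), Set.Ico_union_Ico_eq_Ico hss hsb]
    · have h1 := (curvature_le_sub hH hss).trans (hD b ⟨hs, hsb⟩)
      have h2 := totalCurvature_cons_le hH l (hl s' (by simp)) hl' (h.imp fun _ _ h => h.1)
      have h3 := antitone_logZ hH hsb.le
      refine add_le_add ((ENNReal.ofReal_le_ofReal h1).trans le_add_self)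
        (ENNReal.ofReal_le_ofReal (by linarith))

lemma isChain_scheduleOf (hH : ∀ x, 0 ≤ H x) {a b : ℝ} (hab : a ≤ b) {B : Multiset ℝ}
    (hB : ∀ x ∈ B, x ∈ Set.Icc a b) {d : ℕ} (c : Fin d) {t : ℝ → ℕ} (ht : ∀ p, t p < d)
    (htc : ∀ p, (cnt B p + t p) % d = c) :
    (scheduleOf B a b c).IsChain fun s s' => s ≤ s' ∧
      ∀ p ∈ Set.Ico s s', logZ H s - logZ H s' ≤ gapAt H a b d (t p) B p := by
  rw [List.isChain_iff_forall_rel_of_append_cons_cons]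
  intro s s' l₁ l₂ hl
  refine ⟨?_, fun p hp => ?_⟩
  · have := (pairwise_scheduleOf hab hB c)
    rw [hl, List.pairwise_append, List.pairwise_cons] at this
    exact this.2.1.1 s' (by simp)
  · obtain ⟨h1, h2⟩ := scheduleOf_interval hab hB hl hp (ht p) (htc p)
    exact sub_le_sub (antitone_logZ hH h1) (antitone_logZ hH h2)

end Deterministic

/-! ### Residues and the random first index -/

section Offsets

/-- The distance from `N` to the next number congruent to `c` modulo `d`. -/
def offset {d : ℕ} (c : Fin d) (N : ℕ) : Fin d :=
  c - ⟨N % d, Nat.mod_lt _ c.pos⟩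

lemma add_offset_mod {d : ℕ} (c : Fin d) (N : ℕ) : (N + offset c N) % d = c := by
  have : NeZero d := ⟨c.pos.ne'⟩
  have h : (⟨N % d, Nat.mod_lt _ c.pos⟩ : Fin d) + offset c N = c := by
    rw [offset]; exact add_sub_cancel _ _
  have := congrArg Fin.val h
  rw [Fin.val_add] at this
  simpa using this

/-- For fixed N the offset is a bijective function of c. A uniform c therefore makes the offset
uniform whatever the points are, so the gap can be studied for a deterministic offset. -/
lemma sum_offset {d : ℕ} {M : Type*} [AddCommMonoid M] (f : Fin d → M) (N : ℕ) :
    ∑ c, f (offset c N) = ∑ t, f t := by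
  rcases Nat.eq_zero_or_pos d with rfl | hd
  · simp
  have : NeZero d := ⟨hd.ne'⟩
  exact Equiv.sum_comp (Equiv.subRight (⟨N % d, Nat.mod_lt _ hd⟩ : Fin d)) f

lemma lintegral_uniformOn_fin {d : ℕ} (f : Fin d → ℝ≥0∞) :
    ∫⁻ c, f c ∂(uniformOn (Set.univ : Set (Fin d))) = (∑ c, f c) / d := by
  rw [uniformOn, ProbabilityTheory.cond, lintegral_smul_measure, Measure.restrict_univ,
    lintegral_count,
    tsum_fintype]
  simp [ENNReal.div_eq_inv_mul]

end Offsets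

/-! ### Markov's inequality for the total curvature of the random schedule -/

section GoodSchedules

variable {Ω : Type*} [Fintype Ω] {H : Ω → ℝ} {βmin βmax : ℝ} {S : Type*} [MeasurableSpace S]
  {ν : Measure S} {φ : ℝ → S → Ω} {k d : ℕ}

/-- The bound `gapAt` for the offset determined by `c`. -/
def gapBound (H : Ω → ℝ) (βmin βmax : ℝ) (c : Fin d) (B : Multiset ℝ) (p : ℝ) : ℝ :=
  gapAt H βmin βmax d (offset c (cnt B p)) B p

lemma measurable_gapBound [Nonempty Ω] (hφ : IsSamplingOracle H βmin βmax ν φ) :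
    Measurable fun q : ℝ × ((Fin k → ℕ → S × I) × Fin d) =>
      gapBound H βmin βmax q.2.2 (tpaUnion H βmin βmax φ q.2.1) q.1 := by
  have h1 : Measurable fun q : Fin d × (ℝ × (Fin k → ℕ → S × I)) =>
      gapAt H βmin βmax d q.1 (tpaUnion H βmin βmax φ q.2.2) q.2.1 :=
    measurable_from_prod_countable_right fun t => measurable_gapAt hφ d t
  have h2 : Measurable fun q : Fin d × ℕ => offset q.1 q.2 := measurable_of_countable _
  have h3 : Measurable fun q : ℝ × ((Fin k → ℕ → S × I) × Fin d) =>
      cnt (tpaUnion H βmin βmax φ q.2.1) q.1 := by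
    simpa only [Function.comp_def] using
      (measurable_cnt (k := k) hφ).comp (f := fun q : ℝ × ((Fin k → ℕ → S × I) × Fin d) =>
        (q.1, q.2.1)) (by fun_prop)
  have h4 : Measurable fun q : ℝ × ((Fin k → ℕ → S × I) × Fin d) =>
      offset q.2.2 (cnt (tpaUnion H βmin βmax φ q.2.1) q.1) := by
    simpa only [Function.comp_def] using h2.comp ((measurable_snd.comp measurable_snd).prodMk h3)
  have h5 : Measurable fun q : ℝ × ((Fin k → ℕ → S × I) × Fin d) => (q.1, q.2.1) := by fun_prop
  unfold gapBound
  simpa only [Function.comp_def] using h1.comp (h4.prodMk h5)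

variable [IsProbabilityMeasure ν]

/-- The truncated mean of the gap, over the runs and over the choice of the first kept point. -/
lemma lintegral_gapBound_le (hφ : IsSamplingOracle H βmin βmax ν φ) (hH : ∀ x, 0 ≤ H x)
    (hk : 0 < k) (hd : 0 < d) {p : ℝ} (hp : p ∈ Set.Icc βmin βmax) {c : ℝ} (hc : 0 ≤ c) :
    ∫⁻ q, (Set.Ioi c).indicator ENNReal.ofReal
        (k * gapBound H βmin βmax q.2 (tpaUnion H βmin βmax φ q.1) p)
        ∂((Measure.pi fun _ : Fin k => runLaw ν).prod (uniformOn (Set.univ : Set (Fin d))))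
      ≤ ENNReal.ofReal (upperGamma (d + 2) c / d.factorial) := by
  have : Nonempty Ω := nonempty_of_oracle ν φ
  have : NeZero d := ⟨hd.ne'⟩
  have hF : Measurable ((Set.Ioi c).indicator ENNReal.ofReal) :=
    ENNReal.measurable_ofReal.indicator measurableSet_Ioi
  have hm : Measurable fun q : (Fin k → ℕ → S × I) × Fin d =>
      k * gapBound H βmin βmax q.2 (tpaUnion H βmin βmax φ q.1) p := by
    have := (measurable_gapBound (k := k) (d := d) hφ).comp (measurable_prodMk_left (x := p))
    simp only [Function.comp_def] at this
    exact this.const_mul _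
  have hmt : ∀ t : Fin d, Measurable fun w : Fin k → ℕ → S × I =>
      k * gapAt H βmin βmax d t (tpaUnion H βmin βmax φ w) p := fun t => by
    have := (measurable_gapAt (k := k) hφ d t).comp (measurable_prodMk_left (x := p))
    simp only [Function.comp_def] at this
    exact this.const_mul _
  have hm' : Measurable fun q : (Fin k → ℕ → S × I) × Fin d =>
      (Set.Ioi c).indicator ENNReal.ofReal
        (k * gapBound H βmin βmax q.2 (tpaUnion H βmin βmax φ q.1) p) := by
    simpa only [Function.comp_def] using hF.comp hm
  have hmt' : ∀ t : Fin d, Measurable fun w : Fin k → ℕ → S × I =>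
      (Set.Ioi c).indicator ENNReal.ofReal
        (k * gapAt H βmin βmax d t (tpaUnion H βmin βmax φ w) p) := fun t => by
    simpa only [Function.comp_def] using hF.comp (hmt t)
  rw [lintegral_prod _ hm'.aemeasurable]
  have e : ∀ w : Fin k → ℕ → S × I, ∫⁻ c' : Fin d, (Set.Ioi c).indicator ENNReal.ofReal
      (k * gapBound H βmin βmax c' (tpaUnion H βmin βmax φ w) p)
        ∂(uniformOn (Set.univ : Set (Fin d)))
      = (d : ℝ≥0∞)⁻¹ * ∑ t : Fin d, (Set.Ioi c).indicator ENNReal.ofReal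
        (k * gapAt H βmin βmax d t (tpaUnion H βmin βmax φ w) p) := fun w => by
    rw [lintegral_uniformOn_fin, ENNReal.div_eq_inv_mul]
    congr 1
    exact sum_offset (fun t : Fin d => (Set.Ioi c).indicator ENNReal.ofReal
      (k * gapAt H βmin βmax d t (tpaUnion H βmin βmax φ w) p)) _
  rw [lintegral_congr e, lintegral_const_mul _ (Finset.measurable_sum _ fun t _ => hmt' t),
    lintegral_finsetSum _ fun t _ => hmt' t]
  calc _ ≤ (d : ℝ≥0∞)⁻¹ * ∑ _t : Fin d, ENNReal.ofReal (upperGamma (d + 2) c / d.factorial) := by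
        gcongr with t
        exact lintegral_gapAt_le hφ hH hk hp t.2 hc
    _ = _ := by
        rw [Finset.sum_const, Finset.card_univ, Fintype.card_fin, nsmul_eq_mul, ← mul_assoc,
          ENNReal.inv_mul_cancel (by simpa using hd.ne') (by simp), one_mul]

/-- With probability at least `ρ`, the schedule has small total curvature. -/
theorem exists_good_schedules {n : ℝ} (hφ : IsSamplingOracle H βmin βmax ν φ)
    (hn : 1 ≤ n) (hH : ∀ x, H x = 0 ∨ H x ∈ Set.Icc 1 n) (hβ : βmin ≤ βmax)
    (hk : 0 < k) (hd : 0 < d) {m : ℝ} (hm : (k : ℝ) = m * d) {lam : ℝ}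
    (hlam : lam ∈ Set.Ioo (0 : ℝ) 1) {τ τp ρ : ℝ} (hτ : 0 ≤ τ) (hτp : 0 < τp)
    (hΓ : upperGamma (d + 2) (τ * d) / (τp * d * d.factorial) ≤ 1 - ρ) :
    ∃ G : Set ((Fin k → ℕ → S × I) × Fin d), MeasurableSet G ∧
      ENNReal.ofReal ρ ≤ ((Measure.pi fun _ : Fin k => runLaw ν).prod
        (uniformOn (Set.univ : Set (Fin d)))) G ∧
      ∀ q ∈ G, totalCurvature H (scheduleOf (tpaUnion H βmin βmax φ q.1) βmin βmax q.2)
        ≤ (τ + τp) * (2 + Real.log (n / lam)) / (2 * m) - Real.log (1 - lam) := by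
  have : Nonempty Ω := nonempty_of_oracle ν φ
  have : NeZero d := ⟨hd.ne'⟩
  have hH0 : ∀ x, 0 ≤ H x := fun x => by
    rcases hH x with h | h
    · exact h.ge
    · linarith [h.1]
  have hk' : (0 : ℝ) < k := Nat.cast_pos.2 hk
  have hd' : (0 : ℝ) < d := Nat.cast_pos.2 hd
  have hm0 : 0 < m := by
    by_contra h
    have := mul_nonpos_of_nonpos_of_nonneg (not_lt.1 h) hd'.le
    linarith
  obtain ⟨b, hb, hb1, hb2, hb3⟩ := exists_cutoff hn hH hlam hβ
  set M : ℝ := 2 + Real.log (n / lam) with hM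
  have hlog : 0 ≤ Real.log (n / lam) :=
    Real.log_nonneg (by rw [le_div_iff₀ hlam.1]; linarith [hlam.2])
  have hM0 : 0 < M := by linarith
  -- The atom has mass 2 because D b enters the curvature bound without the factor ½. The bound
  -- becomes ½ ∫ D dκ plus the contribution beyond b, and κ has mass at most M.
  set κ : Measure ℝ := (volume.restrict (Set.Ico βmin b)).withDensity
    (fun p => ENNReal.ofReal (slopeRate H p)) + (2 : ℝ≥0∞) • Measure.dirac b with hκ
  have hsl := (measurable_slopeRate H).ennreal_ofReal
  have hκint : ∀ f : ℝ → ℝ≥0∞, Measurable f → ∫⁻ p, f p ∂κ =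
      (∫⁻ p in Set.Ico βmin b, f p * ENNReal.ofReal (slopeRate H p)) + 2 * f b := fun f hf => by
    rw [hκ, lintegral_add_measure, lintegral_withDensity_eq_lintegral_mul _ hsl hf,
      lintegral_smul_measure, lintegral_dirac' _ hf]
    simp only [Pi.mul_apply, smul_eq_mul]
    congr 1
    exact lintegral_congr fun p => mul_comm _ _
  have hκM : κ Set.univ ≤ ENNReal.ofReal M := by
    rw [← lintegral_one, hκint _ measurable_const]
    simp only [one_mul, mul_one]
    rw [hM, ENNReal.ofReal_add (by norm_num) hlog, add_comm, ENNReal.ofReal_ofNat]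
    gcongr
  have : IsFiniteMeasure κ := ⟨hκM.trans_lt ENNReal.ofReal_lt_top⟩
  have hκae : ∀ᵐ p ∂κ, p ∈ Set.Icc βmin βmax := by
    rw [ae_iff]
    have hs : MeasurableSet {p | ¬ p ∈ Set.Icc βmin βmax} := measurableSet_Icc.compl
    rw [← lintegral_indicator_one hs, hκint _ (measurable_one.indicator hs)]
    have hb' : b ∉ {p | ¬ p ∈ Set.Icc βmin βmax} := fun h => h hb
    rw [Set.indicator_of_notMem hb', mul_zero, add_zero]
    refine (setLIntegral_congr_fun measurableSet_Ico fun p hp => ?_).trans lintegral_zero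
    have : p ∉ {p | ¬ p ∈ Set.Icc βmin βmax} := fun h => h ⟨hp.1, hp.2.le.trans hb.2⟩
    simp only [Set.indicator_of_notMem this, zero_mul]
  set P := (Measure.pi fun _ : Fin k => runLaw ν).prod (uniformOn (Set.univ : Set (Fin d)))
  set D : ℝ → ((Fin k → ℕ → S × I) × Fin d) → ℝ := fun p q =>
    gapBound H βmin βmax q.2 (tpaUnion H βmin βmax φ q.1) p
  set F : ℝ → ℝ≥0∞ := (Set.Ioi (τ * d)).indicator ENNReal.ofReal
  have hF : Measurable F := ENNReal.measurable_ofReal.indicator measurableSet_Ioi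
  have hDm : Measurable (Function.uncurry D) := measurable_gapBound hφ
  have hFD : Measurable (Function.uncurry fun p q => F (k * D p q)) := by
    have := hF.comp (hDm.const_mul (k : ℝ))
    simpa only [Function.comp_def, Function.uncurry_def] using this
  set J : ((Fin k → ℕ → S × I) × Fin d) → ℝ≥0∞ := fun q => ∫⁻ p, F (k * D p q) ∂κ with hJ
  have hJm : Measurable J := Measurable.lintegral_prod_left' hFD
  set G₀ : ℝ := upperGamma (d + 2) (τ * d) / d.factorial
  have hEJ : ∫⁻ q, J q ∂P ≤ ENNReal.ofReal M * ENNReal.ofReal G₀ := by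
    rw [hJ, lintegral_lintegral_swap]
    swap
    · have := hFD.comp measurable_swap
      simpa only [Function.comp_def, Function.uncurry_def, Prod.fst_swap, Prod.snd_swap]
        using this.aemeasurable
    calc _ ≤ ∫⁻ _p, ENNReal.ofReal G₀ ∂κ := by
          refine lintegral_mono_ae ?_
          filter_upwards [hκae] with p hp
          exact lintegral_gapBound_le hφ hH0 hk hd hp (by positivity)
      _ = ENNReal.ofReal G₀ * κ Set.univ := lintegral_const _
      _ ≤ _ := by rw [mul_comm]; gcongr
  set A : ℝ := M * (τp * d) with hA
  have hA0 : 0 < A := by positivity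
  refine ⟨{q | J q < ENNReal.ofReal A}, hJm measurableSet_Iio, ?_, fun q hq => ?_⟩
  -- Markov's inequality: the mean of J is at most M Γ(d+2, τd)/d!, and by `hΓ` this is at most (1 -
  -- ρ) A.
  · have hmk : P {q | ENNReal.ofReal A ≤ J q} ≤ ENNReal.ofReal (1 - ρ) := by
      refine (meas_ge_le_lintegral_div hJm.aemeasurable (by simpa using hA0)
        ENNReal.ofReal_ne_top).trans ?_
      rw [ENNReal.div_le_iff (by simpa using hA0) ENNReal.ofReal_ne_top]
      refine hEJ.trans ?_
      rw [← ENNReal.ofReal_mul hM0.le, ← ENNReal.ofReal_mul' hA0.le]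
      refine ENNReal.ofReal_le_ofReal ?_
      have : upperGamma (d + 2) (τ * d) / (τp * d * d.factorial) = G₀ / (τp * d) := by
        simp only [G₀]; rw [div_div]; congr 1; ring
      rw [this, div_le_iff₀ (by positivity)] at hΓ
      rw [hA]; nlinarith
    have hc : {q | J q < ENNReal.ofReal A} = {q | ENNReal.ofReal A ≤ J q}ᶜ := by
      ext q; simp
    have hms : MeasurableSet {q | ENNReal.ofReal A ≤ J q} := hJm measurableSet_Ici
    rw [hc, prob_compl_eq_one_sub hms]
    refine ENNReal.le_sub_of_add_le_right (by finiteness) ?_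
    rcases le_or_gt ρ 0 with h | h
    · rw [ENNReal.ofReal_of_nonpos h, zero_add]; exact prob_le_one
    have h1 : ENNReal.ofReal ρ + P {q | ENNReal.ofReal A ≤ J q}
        ≤ ENNReal.ofReal ρ + ENNReal.ofReal (1 - ρ) := by gcongr
    refine h1.trans ?_
    rcases le_or_gt ρ 1 with h' | h'
    · rw [← ENNReal.ofReal_add h.le (by linarith)]; simp
    · exfalso
      have : 0 ≤ upperGamma (d + 2) (τ * d) :=
        setIntegral_nonneg measurableSet_Ioi fun t ht => by
          have : 0 < t := lt_of_le_of_lt (by positivity) ht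
          positivity
      have : 0 ≤ upperGamma (d + 2) (τ * d) / (τp * d * d.factorial) := by positivity
      linarith
  · have hB : ∀ x ∈ tpaUnion H βmin βmax φ q.1, x ∈ Set.Icc βmin βmax :=
      fun x hx => mem_of_mem_tpaUnion hx
    have hchain := isChain_scheduleOf hH0 hβ hB q.2
      (t := fun p => offset q.2 (cnt (tpaUnion H βmin βmax φ q.1) p)) (fun p => Fin.is_lt _)
      fun p => add_offset_mod _ _
    have hmem := fun x hx => (mem_scheduleOf (x := x) hβ hB (c := q.2) hx).2
    have hbound := ofReal_totalCurvature_le hH0 (b := b) (b' := βmax) (D := fun p => D p q) _ hb.1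
      (fun h => hb2 h) (fun x hx => hmem x (List.mem_cons_of_mem _ hx)) hchain
    have hDq : Measurable fun p => ENNReal.ofReal (D p q) := by
      have := (hDm.comp (measurable_prodMk_right (y := q))).ennreal_ofReal
      simpa only [Function.comp_def, Function.uncurry_def] using this
    have hDκ : (k : ℝ≥0∞) * ∫⁻ p, ENNReal.ofReal (D p q) ∂κ
        ≤ ENNReal.ofReal ((τ + τp) * d * M) := by
      rw [← lintegral_const_mul _ hDq]
      -- Only the part above τd is random in the estimate: its κ-integral is J q < M τ⁺ d, and the
      -- constant part contributes τ d M.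
      have : ∀ p, (k : ℝ≥0∞) * ENNReal.ofReal (D p q)
          ≤ ENNReal.ofReal (τ * d) + F (k * D p q) := fun p => by
        rw [← ENNReal.ofReal_natCast, ← ENNReal.ofReal_mul hk'.le]
        by_cases h : k * D p q ∈ Set.Ioi (τ * d)
        · simp only [F, Set.indicator_of_mem h]; exact le_add_self
        · simp only [F, Set.indicator_of_notMem h, add_zero]
          exact ENNReal.ofReal_le_ofReal (not_lt.1 h)
      refine (lintegral_mono this).trans ?_
      rw [lintegral_add_left measurable_const, lintegral_const]
      calc _ ≤ ENNReal.ofReal (τ * d) * ENNReal.ofReal M + ENNReal.ofReal A := by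
            gcongr; exact le_of_lt hq
        _ = _ := by
            rw [← ENNReal.ofReal_mul (by positivity), ← ENNReal.ofReal_add (by positivity) hA0.le]
            congr 1; rw [hA]; ring
    have hDκ' : ∫⁻ p, ENNReal.ofReal (D p q) ∂κ ≤ ENNReal.ofReal ((τ + τp) * M / m) := by
      rw [← ENNReal.ofReal_natCast, mul_comm, ← ENNReal.le_div_iff_mul_le
        (.inl (by simpa using hk.ne')) (.inl ENNReal.ofReal_ne_top),
        ← ENNReal.ofReal_div_of_pos hk'] at hDκ
      refine hDκ.trans (le_of_eq ?_)
      congr 1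
      rw [hm]; field_simp
    have hfin : ENNReal.ofReal (totalCurvature H
        (scheduleOf (tpaUnion H βmin βmax φ q.1) βmin βmax q.2))
        ≤ ENNReal.ofReal ((τ + τp) * M / (2 * m) - Real.log (1 - lam)) := by
      refine hbound.trans ?_
      have hl : 0 ≤ -Real.log (1 - lam) := by
        rw [neg_nonneg]; exact Real.log_nonpos (by linarith [hlam.2]) (by linarith [hlam.1])
      rw [sub_eq_add_neg _ (Real.log (1 - lam)), ENNReal.ofReal_add (by positivity) hl]
      refine add_le_add ?_ (ENNReal.ofReal_le_ofReal hb1)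
      have h2 : (2 : ℝ≥0∞)⁻¹ * 2 = 1 := ENNReal.inv_mul_cancel (by simp) (by simp)
      calc _ = 2⁻¹ * ∫⁻ p, ENNReal.ofReal (D p q) ∂κ := by
            rw [hκint _ hDq, mul_add, ← mul_assoc 2⁻¹ 2, h2, one_mul]
        _ ≤ 2⁻¹ * ENNReal.ofReal ((τ + τp) * M / m) := by gcongr
        _ = _ := by
            rw [show (2 : ℝ≥0∞)⁻¹ = ENNReal.ofReal 2⁻¹ by
              rw [ENNReal.ofReal_inv_of_pos two_pos, ENNReal.ofReal_ofNat],
              ← ENNReal.ofReal_mul (by norm_num)]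
            congr 1; field_simp
    have hnn : 0 ≤ (τ + τp) * M / (2 * m) - Real.log (1 - lam) := by
      have hl : 0 ≤ -Real.log (1 - lam) := by
        rw [neg_nonneg]; exact Real.log_nonpos (by linarith [hlam.2]) (by linarith [hlam.1])
      have : 0 ≤ (τ + τp) * M / (2 * m) := by positivity
      linarith
    exact (ENNReal.ofReal_le_ofReal_iff hnn).1 hfin

end GoodSchedules

/-! ### Chebyshev's inequality for the paired product estimator -/

section Chebyshev

/-- Chebyshev's inequality for the average of `r` independent copies of a nonnegative random
variable with mean `exp a` and second moment `exp (2 a + κ)`. -/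
lemma measure_average_le {T : Type*} [MeasurableSpace T] (P : Measure T) [IsProbabilityMeasure P]
    {X : T → ℝ} (hX : Measurable X) (hX0 : ∀ t, 0 ≤ X t) {a κ : ℝ}
    (h1 : ∫⁻ t, ENNReal.ofReal (X t) ∂P = ENNReal.ofReal (Real.exp a))
    (h2 : ∫⁻ t, ENNReal.ofReal (X t ^ 2) ∂P = ENNReal.ofReal (Real.exp (2 * a + κ)))
    {r : ℕ} (hr : 0 < r) {η : ℝ} (hη : 0 < η) :
    (Measure.pi fun _ : Fin r => P) {t | η * Real.exp a ≤ |(∑ i, X (t i)) / r - Real.exp a|}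
      ≤ ENNReal.ofReal ((Real.exp κ - 1) / (r * η ^ 2)) := by
  have hr' : (0 : ℝ) < r := Nat.cast_pos.2 hr
  have hmean : ∫ t, X t ∂P = Real.exp a := by
    rw [integral_eq_lintegral_of_nonneg_ae (ae_of_all _ hX0) hX.aestronglyMeasurable, h1,
      ENNReal.toReal_ofReal (Real.exp_pos _).le]
  have hsq : ∫ t, X t ^ 2 ∂P = Real.exp (2 * a + κ) := by
    rw [integral_eq_lintegral_of_nonneg_ae (ae_of_all _ fun t => sq_nonneg _)
      (hX.pow_const 2).aestronglyMeasurable, h2, ENNReal.toReal_ofReal (Real.exp_pos _).le]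
  have hL : MemLp X 2 P := by
    rw [memLp_two_iff_integrable_sq hX.aestronglyMeasurable]
    refine ⟨(hX.pow_const 2).aestronglyMeasurable, ?_⟩
    rw [hasFiniteIntegral_iff_ofReal (ae_of_all _ fun t => sq_nonneg _), h2]
    exact ENNReal.ofReal_lt_top
  have hvar : Var[X; P] = Real.exp a ^ 2 * (Real.exp κ - 1) := by
    rw [variance_eq_sub hL]
    simp only [Pi.pow_apply]
    rw [hsq, hmean, Real.exp_add, two_mul, Real.exp_add]; ring
  have hmp := fun i : Fin r => measurePreserving_eval (fun _ : Fin r => P) i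
  have hLi : ∀ i : Fin r, MemLp (fun t : Fin r → T => X (t i)) 2 (Measure.pi fun _ => P) :=
    fun i => hL.comp_measurePreserving (hmp i)
  have hS : MemLp (∑ i, fun t : Fin r → T => X (t i)) 2 (Measure.pi fun _ => P) :=
    memLp_finsetSum' _ fun i _ => hLi i
  have hSvar : Var[∑ i, fun t : Fin r → T => X (t i); Measure.pi fun _ => P]
      = r * (Real.exp a ^ 2 * (Real.exp κ - 1)) := by
    rw [variance_sum_pi fun _ => hL]; simp [hvar]
  have hSmean : ∫ t, (∑ i, fun t : Fin r → T => X (t i)) t ∂(Measure.pi fun _ => P)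
      = r * Real.exp a := by
    simp only [Finset.sum_apply]
    rw [integral_finsetSum _ fun i _ => (hLi i).integrable (by norm_num)]
    have : ∀ i : Fin r, ∫ t : Fin r → T, X (t i) ∂(Measure.pi fun _ => P) = Real.exp a :=
      fun i => by
        have := integral_map (μ := Measure.pi fun _ : Fin r => P)
          (hmp i).measurable.aemeasurable (f := X) hX.aestronglyMeasurable
        rw [(hmp i).map_eq, hmean] at this
        exact this.symm
    simp [this]
  have hcheb := meas_ge_le_variance_div_sq hS (c := r * (η * Real.exp a)) (by positivity)
  rw [hSvar, hSmean] at hcheb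
  refine (measure_mono fun t ht => ?_).trans (hcheb.trans (le_of_eq ?_))
  · have ht' : η * Real.exp a ≤ |(∑ i, X (t i)) / r - Real.exp a| := ht
    simp only [Finset.sum_apply, Set.mem_ofPred_eq]
    rw [show ∑ i, X (t i) - r * Real.exp a = r * ((∑ i, X (t i)) / r - Real.exp a) by
      field_simp, abs_mul, abs_of_pos hr']
    gcongr
  · congr 1
    have := Real.exp_pos a
    field_simp

/-- Relative errors of less than `epsTilde ε` in the numerator and in the denominator. -/
lemma div_mem_Ioo_of_abs_sub_lt {ε : ℝ} (hε : 0 < ε) {x y a b : ℝ} (ha : 0 < a) (hb : 0 < b)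
    (hx : |x - a| < epsTilde ε * a) (hy : |y - b| < epsTilde ε * b) :
    x / y ∈ Set.Ioo (a / b / (1 + ε)) (a / b * (1 + ε)) := by
  set s := Real.sqrt (1 + ε) with hs
  have hs2 : s ^ 2 = 1 + ε := Real.sq_sqrt (by linarith)
  have hs1 : 1 < s := by rw [hs, Real.lt_sqrt] <;> linarith
  have hs0 : 0 < s := by linarith
  have he : epsTilde ε = 1 - s⁻¹ := by
    rw [epsTilde, Real.rpow_neg (by linarith), ← Real.sqrt_eq_rpow]
  -- Here 1 - ε̃ = 1/s and 1 + ε̃ = 2 - 1/s ≤ s, so both relative errors lie in (1/s, s), and a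
  -- quotient of two such factors lies in (1/s², s²).
  have hle : 2 - s⁻¹ ≤ s := by
    rw [← sub_nonneg, show s - (2 - s⁻¹) = (s - 1) ^ 2 / s by field_simp; ring]
    positivity
  rw [abs_lt, he] at hx hy
  have hx1 : a / s < x := by rw [div_eq_mul_inv]; nlinarith
  have hx2 : x < a * s := by nlinarith
  have hy1 : b / s < y := by rw [div_eq_mul_inv]; nlinarith
  have hy2 : y < b * s := by nlinarith
  have hy0 : 0 < y := lt_trans (by positivity) hy1
  have hx0 : 0 < x := lt_trans (by positivity) hx1
  rw [← hs2]
  constructor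
  · rw [lt_div_iff₀ hy0]
    calc a / b / s ^ 2 * y < a / b / s ^ 2 * (b * s) := by gcongr
      _ = a / s := by field_simp
      _ < x := hx1
  · rw [div_lt_iff₀ hy0]
    calc x < a * s := hx2
      _ = a / b * s ^ 2 * (b / s) := by field_simp
      _ < _ := by gcongr

lemma epsTilde_pos {ε : ℝ} (hε : 0 < ε) : 0 < epsTilde ε := by
  rw [epsTilde, sub_pos]
  exact Real.rpow_lt_one_of_one_lt_of_neg (by linarith) (by norm_num)

end Chebyshev

/-! ### Moments of the paired product estimator -/

section Estimator

variable {Ω : Type*} [Fintype Ω] {H : Ω → ℝ} {βmin βmax : ℝ} {S : Type*} [MeasurableSpace S]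
  {ν : Measure S} {φ : ℝ → S → Ω}

/-- The exponential moments of H are ratios of partition functions. Shifting by half an interval
evaluates Z at its midpoint, from either end. -/
lemma sum_gibbs_mul_exp [Nonempty Ω] (β δ : ℝ) :
    ∑ x, ENNReal.ofReal (gibbs H β x) * ENNReal.ofReal (Real.exp (-δ * H x))
      = ENNReal.ofReal (Real.exp (logZ H (β + δ) - logZ H β)) := by
  have hg : ∀ x, 0 ≤ gibbs H β x := fun x =>
    div_nonneg (Real.exp_pos _).le (partitionFn_pos H β).le
  simp_rw [← ENNReal.ofReal_mul (hg _)]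
  rw [← ENNReal.ofReal_sum_of_nonneg fun x _ => mul_nonneg (hg x) (Real.exp_pos _).le]
  congr 1
  rw [show logZ H (β + δ) - logZ H β = -(logZ H β - logZ H (β + δ)) by ring,
    ← partitionFn_div_eq_exp]
  unfold gibbs
  simp_rw [div_mul_eq_mul_div]
  rw [← Finset.sum_div]
  congr 1
  exact Finset.sum_congr rfl fun x _ => by rw [← Real.exp_add]; congr 1; ring

/-- The common form of the two products in the paired product estimator. -/
def expProd (H : Ω → ℝ) (φ : ℝ → S → Ω) (δ b : ℕ → ℝ) (e : ℕ → ℕ) (N : ℕ) (t : ℕ → S) : ℝ :=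
  ∏ i ∈ Finset.range N, Real.exp (-δ i * H (φ (b i) (t (e i))))

lemma measurable_expProd (hφ : IsSamplingOracle H βmin βmax ν φ) (δ b : ℕ → ℝ) (e : ℕ → ℕ)
    (N : ℕ) : Measurable (expProd H φ δ b e N) :=
  Finset.measurable_prod _ fun i _ =>
    (hφ.measurable_comp_right (fun x => Real.exp (-δ i * H x)) (b i)).comp
      (measurable_pi_apply (e i))

variable [IsProbabilityMeasure ν]

lemma lintegral_expProd (hφ : IsSamplingOracle H βmin βmax ν φ) (δ : ℕ → ℝ) {b : ℕ → ℝ}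
    {e : ℕ → ℕ} (he : e.Injective) {N : ℕ} (hb : ∀ i < N, b i ∈ Set.Icc βmin βmax) :
    ∫⁻ t, ENNReal.ofReal (expProd H φ δ b e N t) ∂(Measure.infinitePi fun _ : ℕ => ν)
      = ENNReal.ofReal (Real.exp (∑ i ∈ Finset.range N,
        (logZ H (b i + δ i) - logZ H (b i)))) := by
  have : Nonempty Ω := nonempty_of_oracle ν φ
  have hg : ∀ i, Measurable fun s : S => ENNReal.ofReal (Real.exp (-δ i * H (φ (b i) s))) :=
    fun i => hφ.measurable_comp_right (fun x => ENNReal.ofReal (Real.exp (-δ i * H x))) (b i)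
  have hind : iIndepFun (fun (i : ℕ) (t : ℕ → S) =>
      ENNReal.ofReal (Real.exp (-δ i * H (φ (b i) (t (e i))))))
      (Measure.infinitePi fun _ : ℕ => ν) :=
    ((iIndepFun_infinitePi (P := fun _ : ℕ => ν) (X := fun _ => id)
      (fun _ => measurable_id)).precomp he).comp
      (fun i s => ENNReal.ofReal (Real.exp (-δ i * H (φ (b i) s)))) hg
  unfold expProd
  simp_rw [ENNReal.ofReal_prod_of_nonneg fun i _ => (Real.exp_pos _).le]
  rw [lintegral_prod_eq_prod_lintegral_of_indepFun _ _ hind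
    fun i => (hg i).comp (measurable_pi_apply (e i)), Real.exp_sum,
    ENNReal.ofReal_prod_of_nonneg fun i _ => (Real.exp_pos _).le]
  refine Finset.prod_congr rfl fun i hi => ?_
  rw [(measurePreserving_eval_infinitePi (fun _ : ℕ => ν) (e i)).lintegral_comp (hg i),
    hφ.lintegral_comp (hb i (Finset.mem_range.1 hi))
      (fun x => ENNReal.ofReal (Real.exp (-δ i * H x))), sum_gibbs_mul_exp]

/-- Squaring the product doubles every δ, so its second moment comes from the same formula as its
mean; comparing the two gives κ. -/
lemma measure_average_expProd_le (hφ : IsSamplingOracle H βmin βmax ν φ) {δ : ℕ → ℝ}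
    {b : ℕ → ℝ} {e : ℕ → ℕ} (he : e.Injective) {N : ℕ} (hb : ∀ i < N, b i ∈ Set.Icc βmin βmax)
    {r : ℕ} (hr : 0 < r) {η : ℝ} (hη : 0 < η) {a κ : ℝ}
    (ha : a = ∑ i ∈ Finset.range N, (logZ H (b i + δ i) - logZ H (b i)))
    (hκ : κ = ∑ i ∈ Finset.range N,
      (logZ H (b i) + logZ H (b i + 2 * δ i) - 2 * logZ H (b i + δ i))) :
    (Measure.pi fun _ : Fin r => Measure.infinitePi fun _ : ℕ => ν)
      {t | η * Real.exp a ≤ |(∑ i, expProd H φ δ b e N (t i)) / r - Real.exp a|}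
      ≤ ENNReal.ofReal ((Real.exp κ - 1) / (r * η ^ 2)) := by
  refine measure_average_le _ (measurable_expProd hφ δ b e N)
    (fun t => Finset.prod_nonneg fun i _ => (Real.exp_pos _).le) ?_ ?_ hr hη
  · rw [lintegral_expProd hφ δ he hb, ha]
  · have h2 : ∀ t, expProd H φ δ b e N t ^ 2 = expProd H φ (fun i => 2 * δ i) b e N t :=
      fun t => by
        unfold expProd
        rw [← Finset.prod_pow]
        refine Finset.prod_congr rfl fun i _ => ?_
        rw [← Real.exp_nat_mul]; congr 1; push_cast; ring
    simp_rw [h2]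
    rw [lintegral_expProd hφ _ he hb, ha, hκ, Finset.mul_sum, ← Finset.sum_add_distrib]
    congr 3
    funext i
    ring

lemma totalCurvature_eq_sum (B : List ℝ) :
    totalCurvature H B
      = ∑ i ∈ Finset.range (B.length - 1), curvature H (B.getD i 0) (B.getD (i + 1) 0) := by
  induction B with
  | nil => simp [totalCurvature]
  | cons s l ih =>
    cases l with
    | nil => simp [totalCurvature]
    | cons s' l =>
      rw [totalCurvature, ih]
      simp [Finset.sum_range_succ' _ l.length, add_comm]

/-- For a fixed schedule with small total curvature, the estimate is likely to be accurate. -/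
lemma measure_estimate_compl_le (hφ : IsSamplingOracle H βmin βmax ν φ) {B l : List ℝ}
    (hBl : B = βmin :: (l ++ [βmax])) (hB : ∀ x ∈ B, x ∈ Set.Icc βmin βmax) {r : ℕ} (hr : 0 < r)
    {ε : ℝ} (hε : 0 < ε) :
    (Measure.pi fun _ : Fin r => Measure.infinitePi fun _ : ℕ => ν)
      {t | ((∑ a, estV H φ B (t a)) / r) / ((∑ a, estW H φ B (t a)) / r) ∉
        Set.Ioo (partitionFn H βmin / partitionFn H βmax / (1 + ε))
          (partitionFn H βmin / partitionFn H βmax * (1 + ε))}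
      ≤ ENNReal.ofReal ((Real.exp (totalCurvature H B) - 1) / (r * epsTilde ε ^ 2))
        + ENNReal.ofReal ((Real.exp (totalCurvature H B) - 1) / (r * epsTilde ε ^ 2)) := by
  have : Nonempty Ω := nonempty_of_oracle ν φ
  have hη := epsTilde_pos hε
  set N := B.length - 1 with hN
  set β : ℕ → ℝ := fun i => B.getD i 0 with hβ
  set δ : ℕ → ℝ := fun i => (β (i + 1) - β i) / 2 with hδ
  have hβmem : ∀ i ≤ N, β i ∈ Set.Icc βmin βmax := fun i hi => by
    have : i < B.length := by rw [hBl] at hN ⊢; simp at hN ⊢; omega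
    simp only [hβ]
    rw [List.getD_eq_getElem _ _ this]
    exact hB _ (List.getElem_mem this)
  set aW := ∑ i ∈ Finset.range N, (logZ H (β i + δ i) - logZ H (β i)) with haW
  set aV := ∑ i ∈ Finset.range N, (logZ H (β (i + 1) + -δ i) - logZ H (β (i + 1))) with haV
  -- W moves from the left end of each interval and V from the right end. A shift by δ reaches the
  -- midpoint and a double shift the opposite end, so both have the total curvature as κ.
  have hmid : ∀ i, β i + δ i = (β i + β (i + 1)) / 2 := fun i => by simp only [hδ]; ring
  have hmid' : ∀ i, β (i + 1) + -δ i = (β i + β (i + 1)) / 2 := fun i => by simp only [hδ]; ring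
  have hend : ∀ i, β i + 2 * δ i = β (i + 1) := fun i => by simp only [hδ]; ring
  have hend' : ∀ i, β (i + 1) + 2 * -δ i = β i := fun i => by simp only [hδ]; ring
  have hW := measure_average_expProd_le hφ (δ := δ) (b := β) (e := id) Function.injective_id
    (N := N) (fun i hi => hβmem i hi.le) hr hη (κ := totalCurvature H B) haW
    (by rw [totalCurvature_eq_sum]
        exact Finset.sum_congr rfl fun i _ => by rw [hend, hmid]; rfl)
  have hV := measure_average_expProd_le hφ (δ := fun i => -δ i) (b := fun i => β (i + 1))
    (e := fun i => i + 1) (add_left_injective 1)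
    (N := N) (fun i hi => hβmem _ hi) hr hη (κ := totalCurvature H B) haV
    (by rw [totalCurvature_eq_sum]
        refine Finset.sum_congr rfl fun i _ => ?_
        rw [hend', hmid', curvature]
        ring)
  have hVe : ∀ t : ℕ → S, expProd H φ (fun i => -δ i) (fun i => β (i + 1)) (fun i => i + 1) N t
      = estV H φ B t := fun t => by
    unfold expProd estV
    exact Finset.prod_congr rfl fun i _ => by rw [neg_neg]
  have hWe : ∀ t : ℕ → S, expProd H φ δ β id N t = estW H φ B t := fun t => rfl
  simp_rw [hVe] at hV
  simp_rw [hWe] at hW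
  -- The midpoint values cancel between the two exponents and the endpoint values telescope.
  have hQ : Real.exp aV / Real.exp aW = partitionFn H βmin / partitionFn H βmax := by
    have h0 : β 0 = βmin := by simp [hβ, hBl]
    have hNe : β N = βmax := by
      simp only [hβ, hN, hBl]
      simp
    rw [← exp_logZ, ← exp_logZ, ← Real.exp_sub, ← Real.exp_sub, haV, haW,
      ← Finset.sum_sub_distrib]
    congr 1
    have := Finset.sum_range_sub' (fun i => logZ H (β i)) N
    rw [h0, hNe] at this
    rw [← this]
    exact Finset.sum_congr rfl fun i _ => by rw [hmid, hmid']; ring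
  refine (measure_mono fun t ht => ?_).trans ((measure_union_le _ _).trans (add_le_add hV hW))
  by_contra hcon
  rw [Set.mem_union, not_or] at hcon
  refine ht ?_
  rw [← hQ]
  exact div_mem_Ioo_of_abs_sub_lt hε (Real.exp_pos _) (Real.exp_pos _) (not_le.1 hcon.1)
    (not_le.1 hcon.2)

end Estimator

/-! ### Accuracy of the output -/

section Accuracy

variable {Ω : Type*} [Fintype Ω] {H : Ω → ℝ} {βmin βmax : ℝ} {S : Type*} [MeasurableSpace S]
  {ν : Measure S} [IsProbabilityMeasure ν] {φ : ℝ → S → Ω} {k d r : ℕ}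

lemma measurePreserving_drawsLaw (hd : 0 < d) :
    MeasurePreserving (fun q : ((Fin k → ℕ → S × I) × Fin d) × (Fin r → ℕ → S) =>
        ((q.1.1, q.2, q.1.2) : Draws S d k r))
      (((Measure.pi fun _ : Fin k => runLaw ν).prod (uniformOn (Set.univ : Set (Fin d)))).prod
        (Measure.pi fun _ : Fin r => Measure.infinitePi fun _ : ℕ => ν))
      (drawsLaw ν d k r) := by
  have : NeZero d := ⟨hd.ne'⟩
  have h1 := measurePreserving_prodAssoc (Measure.pi fun _ : Fin k => runLaw ν)
    (uniformOn (Set.univ : Set (Fin d)))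
    (Measure.pi fun _ : Fin r => Measure.infinitePi fun _ : ℕ => ν)
  have h2 := (MeasurePreserving.id (Measure.pi fun _ : Fin k => runLaw ν)).prod
    (Measure.measurePreserving_swap (μ := uniformOn (Set.univ : Set (Fin d)))
      (ν := Measure.pi fun _ : Fin r => Measure.infinitePi fun _ : ℕ => ν))
  exact h2.comp h1

/-- Fubini as a lower bound: the estimator is analysed for each good schedule separately. A
measurable hull of E avoids proving that E is measurable. -/
lemma mul_le_drawsLaw (hd : 0 < d) {E : Set (Draws S d k r)}
    {G : Set ((Fin k → ℕ → S × I) × Fin d)} (hG : MeasurableSet G) {p : ℝ≥0∞}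
    (h : ∀ q ∈ G, p ≤ (Measure.pi fun _ : Fin r => Measure.infinitePi fun _ : ℕ => ν)
      {t | ((q.1, t, q.2) : Draws S d k r) ∈ E}) :
    p * ((Measure.pi fun _ : Fin k => runLaw ν).prod (uniformOn (Set.univ : Set (Fin d)))) G
      ≤ drawsLaw ν d k r E := by
  have : NeZero d := ⟨hd.ne'⟩
  have hmp := measurePreserving_drawsLaw (ν := ν) (k := k) (r := r) hd
  set E' := toMeasurable (drawsLaw ν d k r) E
  have hE' : MeasurableSet E' := measurableSet_toMeasurable _ _
  rw [← measure_toMeasurable E, ← hmp.measure_preimage hE'.nullMeasurableSet,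
    Measure.prod_apply (hmp.measurable hE'), ← setLIntegral_const]
  refine le_trans ?_ (setLIntegral_le_lintegral G _)
  refine setLIntegral_mono' hG fun q hq => (h q hq).trans (measure_mono fun t ht => ?_)
  exact subset_toMeasurable _ _ ht

theorem le_drawsLaw_estimate {n : ℝ} (hφ : IsSamplingOracle H βmin βmax ν φ)
    (hn : 1 ≤ n) (hH : ∀ x, H x = 0 ∨ H x ∈ Set.Icc 1 n) (hβ : βmin ≤ βmax)
    (hk : 0 < k) (hd : 0 < d) (hr : 0 < r) {m : ℝ} (hm : (k : ℝ) = m * d) {ε : ℝ} (hε : 0 < ε)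
    {γ lam : ℝ} (hγ : γ ∈ Set.Ioo (0 : ℝ) 0.25) (hlam : lam ∈ Set.Ioo (0 : ℝ) 1)
    (hS : SizeCondition n ε m d r γ lam) :
    ENNReal.ofReal 0.75 ≤ drawsLaw ν d k r {ω | estimate H βmin βmax φ ω ∈
      Set.Ioo (partitionFn H βmin / partitionFn H βmax / (1 + ε))
        (partitionFn H βmin / partitionFn H βmax * (1 + ε))} := by
  have : Nonempty Ω := nonempty_of_oracle ν φ
  have hd' : (0 : ℝ) < d := Nat.cast_pos.2 hd
  have hk' : (0 : ℝ) < k := Nat.cast_pos.2 hk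
  have hr' : (0 : ℝ) < r := Nat.cast_pos.2 hr
  have hη := epsTilde_pos hε
  have hm0 : 0 < m := by
    by_contra h
    have := mul_nonpos_of_nonpos_of_nonneg (not_lt.1 h) hd'.le
    linarith
  obtain ⟨hS1, hS2⟩ := hS
  set R := (r : ℝ) * epsTilde ε ^ 2 with hR
  have hR0 : 0 < R := by positivity
  set X := 1 + 1 / 2 * γ * r * epsTilde ε ^ 2 with hX
  have hXR : X = 1 + 1 / 2 * γ * R := by rw [hX, hR]; ring
  have hγ0 := hγ.1
  have hX0 : 0 < X := by rw [hXR]; positivity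
  set ρ : ℝ := 0.75 / (1 - γ) with hρ
  have hγ1 : 0 < 1 - γ := by have := hγ.2; norm_num at this; linarith
  have hρ0 : 0 < ρ := div_pos (by norm_num) hγ1
  have hρ1 : ρ < 1 := by
    rw [hρ, div_lt_one hγ1]; have := hγ.2; norm_num at this ⊢; linarith
  have hlog : 0 ≤ Real.log (n / lam) :=
    Real.log_nonneg (by rw [le_div_iff₀ hlam.1]; linarith [hlam.2])
  have hl1 : 0 < 1 - lam := by linarith [hlam.2]
  set M := 2 + Real.log (n / lam) with hM
  have hM0 : 0 < M := by linarith
  set L := Real.log (X * (1 - lam)) with hL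
  have hL0 : 0 < L := Real.log_pos hS1
  have hLX : L = Real.log X + Real.log (1 - lam) := Real.log_mul hX0.ne' hl1.ne'
  rw [ge_iff_le, div_le_iff₀ (by positivity)] at hS2
  -- Feasible because ρ < 1, which is γ < ¼: take τ = 0 and τ⁺ large.
  have hne : {y | ∃ τ τp : ℝ, 0 ≤ τ ∧ 0 < τp ∧
      upperGamma (d + 2) (τ * d) / (τp * d * d.factorial) ≤ 1 - ρ ∧ y = τ + τp}.Nonempty := by
    set c := upperGamma (d + 2) (0 * d) / (d * d.factorial) with hc
    have h1 : 0 < 1 - ρ := by linarith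
    refine ⟨_, 0, |c| / (1 - ρ) + 1, le_rfl, by positivity, ?_, rfl⟩
    have e : ∀ x : ℝ, upperGamma (d + 2) (0 * d) / (x * d * d.factorial) = c / x := fun x => by
      rw [hc, div_div]; congr 1; ring
    rw [e, div_le_iff₀ (by positivity), mul_add, mul_div_cancel₀ _ h1.ne']
    linarith [le_abs_self c]
  -- `tauRho` is an infimum, so near-optimal τ, τ⁺ are used and cost a factor e^θ in the moment
  -- bound. As θ → 0 the success probability tends to (1 - 2(X-1)/R) ρ = (1 - γ) ρ = 0.75.
  have main : ∀ θ : ℝ, 0 < θ → ENNReal.ofReal ((1 - 2 * ((X * Real.exp θ - 1) / R)) * ρ)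
      ≤ drawsLaw ν d k r {ω | estimate H βmin βmax φ ω ∈
      Set.Ioo (partitionFn H βmin / partitionFn H βmax / (1 + ε))
        (partitionFn H βmin / partitionFn H βmax * (1 + ε))} := fun θ hθ => by
    obtain ⟨_, ⟨τ, τp, hτ, hτp, hΓ, rfl⟩, hlt⟩ := exists_lt_of_csInf_lt hne
      (show tauRho ρ d < tauRho ρ d + θ * (2 * m) / M from
        lt_add_of_pos_right _ (by positivity))
    obtain ⟨G, hGm, hGρ, hG⟩ := exists_good_schedules hφ hn hH hβ hk hd hm hlam hτ hτp hΓ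
    have hκ : ∀ q ∈ G, Real.exp (totalCurvature H
        (scheduleOf (tpaUnion H βmin βmax φ q.1) βmin βmax q.2)) ≤ X * Real.exp θ :=
      fun q hq => by
        rw [← Real.exp_log hX0, ← Real.exp_add]
        refine Real.exp_le_exp.2 ((hG q hq).trans ?_)
        have h1 : (τ + τp) * M ≤ m * (2 * L) + θ * (2 * m) :=
          calc (τ + τp) * M ≤ (tauRho ρ d + θ * (2 * m) / M) * M := by gcongr
            _ = tauRho ρ d * M + θ * (2 * m) := by field_simp
            _ ≤ _ := by linarith
        have h2 : (τ + τp) * M / (2 * m) ≤ L + θ := by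
          rw [div_le_iff₀ (by positivity)]; linarith
        linarith
    rw [ENNReal.ofReal_mul' hρ0.le]
    refine (mul_le_mul_right hGρ _).trans (mul_le_drawsLaw hd hGm fun q hq => ?_)
    set B := scheduleOf (tpaUnion H βmin βmax φ q.1) βmin βmax q.2 with hB
    have hfail := measure_estimate_compl_le hφ (B := B) rfl
      (fun x hx => mem_scheduleOf hβ (fun x hx => mem_of_mem_tpaUnion hx) hx) hr hε
    set Good := {t : Fin r → ℕ → S | ((∑ a, estV H φ B (t a)) / r) /
      ((∑ a, estW H φ B (t a)) / r) ∈
        Set.Ioo (partitionFn H βmin / partitionFn H βmax / (1 + ε))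
          (partitionFn H βmin / partitionFn H βmax * (1 + ε))} with hGood
    have hx : 0 ≤ (X * Real.exp θ - 1) / R := by
      have : 1 ≤ X := by rw [hXR]; linarith [show 0 < 1 / 2 * γ * R by positivity]
      have := Real.one_le_exp hθ.le
      exact div_nonneg (by nlinarith) hR0.le
    have hfail' : (Measure.pi fun _ : Fin r => Measure.infinitePi fun _ : ℕ => ν) Goodᶜ
        ≤ ENNReal.ofReal (2 * ((X * Real.exp θ - 1) / R)) := by
      refine hfail.trans ?_
      rw [two_mul, ENNReal.ofReal_add hx hx]
      have := hκ q hq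
      gcongr
    have h1 : (1 : ℝ≥0∞) ≤ (Measure.pi fun _ : Fin r => Measure.infinitePi fun _ : ℕ => ν) Good
        + ENNReal.ofReal (2 * ((X * Real.exp θ - 1) / R)) := by
      rw [← measure_univ (μ := Measure.pi fun _ : Fin r => Measure.infinitePi fun _ : ℕ => ν),
        ← Set.union_compl_self Good]
      exact (measure_union_le _ _).trans (add_le_add le_rfl hfail')
    rw [ENNReal.ofReal_sub _ (by positivity), ENNReal.ofReal_one]
    exact tsub_le_iff_right.2 h1
  have hlim : Tendsto (fun θ : ℝ => ENNReal.ofReal ((1 - 2 * ((X * Real.exp θ - 1) / R)) * ρ))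
      (𝓝[>] 0) (𝓝 (ENNReal.ofReal 0.75)) := by
    have hc : Continuous fun θ : ℝ =>
        ENNReal.ofReal ((1 - 2 * ((X * Real.exp θ - 1) / R)) * ρ) :=
      ENNReal.continuous_ofReal.comp (by fun_prop)
    have h0 : (1 - 2 * ((X * Real.exp 0 - 1) / R)) * ρ = 0.75 := by
      rw [Real.exp_zero, mul_one, hXR, hρ]
      field_simp
      ring
    have := (hc.tendsto 0).mono_left (nhdsWithin_le_nhds (s := Set.Ioi 0))
    rwa [h0] at this
  exact le_of_tendsto hlim (eventually_nhdsWithin_of_forall fun θ hθ => main θ hθ)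

end Accuracy

/-! ### The expected number of oracle calls -/

section Counting

variable {Ω : Type*} {H : Ω → ℝ} {βmin βmax : ℝ} {S : Type*} {φ : ℝ → S → Ω} {k d : ℕ}

lemma sum_tpaSize_eq {w : Fin k → ℕ → S × I}
    (h : ∀ j, ∃ n, HasSize H βmin βmax φ n βmin (w j)) :
    ∑ j, tpaSize H βmin βmax φ (w j) = ((tpaUnion H βmin βmax φ w).card : ℕ∞) := by
  choose n hn using h
  have : (tpaUnion H βmin βmax φ w).card = ∑ j, n j := by
    rw [tpaUnion, Multiset.card_sum]
    exact Finset.sum_congr rfl fun j _ => by rw [(hn j).tpaRun_eq]; simp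
  rw [this, Nat.cast_sum]
  exact Finset.sum_congr rfl fun j _ => (hn j).tpaSize_eq

lemma sum_tpaCalls_eq {w : Fin k → ℕ → S × I}
    (h : ∀ j, ∃ n, HasSize H βmin βmax φ n βmin (w j)) :
    ∑ j, tpaCalls H βmin βmax φ (w j) = ((tpaUnion H βmin βmax φ w).card + k : ℕ∞) := by
  rw [← sum_tpaSize_eq h]
  choose n hn using h
  simp [fun j => (hn j).tpaCalls_eq, fun j => (hn j).tpaSize_eq, Finset.sum_add_distrib]

/-- The length depends only on c and on the length of L, which yields measurability. -/
lemma length_keepEvery (c : Fin d) (L : List ℝ) :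
    (keepEvery c L).length = (List.range L.length).countP fun i => i % d = c := by
  have : ∀ l : List (ℝ × ℕ), (l.filterMap fun p => if p.2 % d = c then some p.1 else none).length
      = (l.map Prod.snd).countP fun i => i % d = c := fun l => by
    induction l with
    | nil => simp
    | cons p l ih =>
      rw [List.filterMap_cons, List.map_cons, List.countP_cons, ← ih]
      by_cases h : p.2 % d = c <;> simp [h]
  rw [keepEvery, this, List.zipIdx_map_snd, ← List.range_eq_range']

variable [Fintype Ω] [MeasurableSpace S] {ν : Measure S}

lemma measurable_length_scheduleOf (hφ : IsSamplingOracle H βmin βmax ν φ) :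
    Measurable fun q : (Fin k → ℕ → S × I) × Fin d =>
      (scheduleOf (tpaUnion H βmin βmax φ q.1) βmin βmax q.2).length := by
  have e : ∀ q : (Fin k → ℕ → S × I) × Fin d,
      (scheduleOf (tpaUnion H βmin βmax φ q.1) βmin βmax q.2).length
      = (List.range (tpaUnion H βmin βmax φ q.1).card).countP (fun i => i % d = q.2) + 2 :=
    fun q => by
      simp only [scheduleOf, List.length_cons, List.length_append, length_keepEvery,
        Multiset.length_sort, List.length_nil]
  simp_rw [e]
  have h1 : Measurable fun p : ℕ × Fin d =>
      (List.range p.1).countP (fun i => i % d = p.2) + 2 := measurable_of_countable _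
  have h2 := (measurable_card (k := k) hφ).comp
    (f := fun q : (Fin k → ℕ → S × I) × Fin d => q.1) (by fun_prop)
  have h3 := h1.comp (h2.prodMk measurable_snd)
  simpa only [Function.comp_def] using h3

end Counting

/-! ### Expectations of the counts -/

section ExpectedCalls

variable {Ω : Type*} [Fintype Ω] {H : Ω → ℝ} {βmin βmax : ℝ} {S : Type*} [MeasurableSpace S]
  {ν : Measure S} [IsProbabilityMeasure ν] {φ : ℝ → S → Ω} {k d r : ℕ}

lemma hasSum_poisson_mul_nat (a : ℝ) :
    HasSum (fun n : ℕ => Real.exp (-a) * a ^ n / n.factorial * n) a := by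
  have h := (NormedSpace.expSeries_div_hasSum_exp a).mul_left (Real.exp (-a) * a)
  rw [← Real.exp_eq_exp_ℝ, mul_right_comm, ← Real.exp_add, neg_add_cancel, Real.exp_zero,
    one_mul] at h
  rw [← hasSum_nat_add_iff' 1]
  simp only [Finset.range_one, Finset.sum_singleton, Nat.cast_zero, mul_zero, sub_zero]
  have e : (fun n : ℕ => Real.exp (-a) * a ^ (n + 1) / (n + 1).factorial * ((n + 1 : ℕ) : ℝ))
      = fun n : ℕ => Real.exp (-a) * a * (a ^ n / n.factorial) := by
    funext n
    rw [Nat.factorial_succ]; push_cast; field_simp; ring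
  rw [e]; exact h

/-- The law of two counts, with the second interval empty and the first the whole range. -/
lemma measure_card_tpaUnion (hφ : IsSamplingOracle H βmin βmax ν φ) (hH : ∀ x, 0 ≤ H x)
    (hβ : βmin ≤ βmax) (i : ℕ) :
    (Measure.pi fun _ : Fin k => runLaw ν) {w | (tpaUnion H βmin βmax φ w).card = i}
      = ENNReal.ofReal (Real.exp (-(k * (logZ H βmin - logZ H βmax)))
        * (k * (logZ H βmin - logZ H βmax)) ^ i / i.factorial) := by
  have h := measure_tpaUnion_counts hφ hH k le_rfl hβ le_rfl le_rfl i 0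
  rw [sub_self, mul_zero, neg_zero, Real.exp_zero, pow_zero, Nat.factorial_zero, Nat.cast_one,
    mul_one, div_one, mul_one] at h
  rw [← h]
  congr 1
  ext w
  have h1 : (tpaUnion H βmin βmax φ w).countP (fun b => βmin ≤ b ∧ b ≤ βmax)
      = (tpaUnion H βmin βmax φ w).card :=
    Multiset.countP_eq_card.2 fun x hx => mem_of_mem_tpaUnion hx
  have h2 : (tpaUnion H βmin βmax φ w).countP (fun b => βmax < b ∧ b ≤ βmax) = 0 :=
    Multiset.countP_eq_zero.2 fun x _ h => absurd h.1 (not_lt.2 h.2)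
  simp only [Set.mem_ofPred_eq, h1, h2, and_true]

lemma lintegral_card_tpaUnion (hφ : IsSamplingOracle H βmin βmax ν φ) (hH : ∀ x, 0 ≤ H x)
    (hβ : βmin ≤ βmax) :
    ∫⁻ w, ((tpaUnion H βmin βmax φ w).card : ℝ≥0∞) ∂(Measure.pi fun _ : Fin k => runLaw ν)
      = ENNReal.ofReal (k * (logZ H βmin - logZ H βmax)) := by
  have : Nonempty Ω := nonempty_of_oracle ν φ
  have hz := sub_nonneg.2 (antitone_logZ hH hβ)
  set a := (k : ℝ) * (logZ H βmin - logZ H βmax) with ha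
  have ha0 : 0 ≤ a := by positivity
  have hm := measurable_card (k := k) hφ
  rw [← lintegral_map (f := fun i : ℕ => (i : ℝ≥0∞)) (measurable_of_countable _) hm,
    lintegral_countable']
  have hs := hasSum_poisson_mul_nat a
  rw [← hs.tsum_eq, ENNReal.ofReal_tsum_of_nonneg (fun n => by positivity) hs.summable]
  refine tsum_congr fun i => ?_
  rw [Measure.map_apply hm (measurableSet_singleton i)]
  have := measure_card_tpaUnion (k := k) hφ hH hβ i
  rw [ENNReal.ofReal_mul (by positivity), ← this, ENNReal.ofReal_natCast, mul_comm]
  rfl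

lemma ae_forall_hasSize (hφ : IsSamplingOracle H βmin βmax ν φ) (hH : ∀ x, 0 ≤ H x)
    (hβ : βmin ≤ βmax) : ∀ᵐ w ∂(Measure.pi fun _ : Fin k => runLaw ν),
      ∀ j, ∃ n, HasSize H βmin βmax φ n βmin (w j) :=
  ae_all_iff.2 fun j => (Measure.quasiMeasurePreserving_eval (fun _ : Fin k => runLaw ν) j).ae
    (ae_exists_hasSize hφ hβ hH)

lemma lintegral_length_scheduleOf (hd : 0 < d) (B : Multiset ℝ) (a b : ℝ) :
    ∫⁻ c : Fin d, ((scheduleOf B a b c).length : ℝ≥0∞) ∂(uniformOn (Set.univ : Set (Fin d)))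
      = 2 + (B.card : ℝ≥0∞) / d := by
  have hd' : (d : ℝ≥0∞) ≠ 0 := by simpa using hd.ne'
  have e : ∀ c : Fin d, ((scheduleOf B a b c).length : ℝ≥0∞)
      = 2 + ((keepEvery c (B.sort (· ≤ ·))).length : ℝ≥0∞) := fun c => by
    simp only [scheduleOf, List.length_cons, List.length_append, List.length_nil]
    push_cast; ring
  rw [lintegral_uniformOn_fin, Finset.sum_congr rfl fun c _ => e c, Finset.sum_add_distrib,
    ← Nat.cast_sum, sum_length_keepEvery hd, Multiset.length_sort, ENNReal.add_div]
  simp [mul_comm (d : ℝ≥0∞) 2, ENNReal.mul_div_cancel_right hd' (ENNReal.natCast_ne_top d)]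

/-- The expectation of the calls counted as `|B| + u` for TPA and `r (ℓ + 1)` for the
estimator. -/
lemma lintegral_calls (hφ : IsSamplingOracle H βmin βmax ν φ) (hH : ∀ x, 0 ≤ H x)
    (hβ : βmin ≤ βmax) (hd : 0 < d) {m : ℝ} (hm : (k : ℝ) = m * d) (u : ℕ)
    {F : Draws S d k r → ℕ∞} (hF : ∀ ω, (∀ j, ∃ n, HasSize H βmin βmax φ n βmin (ω.1 j)) →
      F ω = (tpaUnion H βmin βmax φ ω.1).card + u + r * (schedule H βmin βmax φ ω).length) :
    ∫⁻ ω, ((F ω : ℕ∞) : ℝ≥0∞) ∂(drawsLaw ν d k r)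
      = ENNReal.ofReal (m * (logZ H βmin - logZ H βmax) * (r + d) + 2 * r + u) := by
  have : Nonempty Ω := nonempty_of_oracle ν φ
  have : NeZero d := ⟨hd.ne'⟩
  have hd' : (0 : ℝ) < d := Nat.cast_pos.2 hd
  have hz := sub_nonneg.2 (antitone_logZ hH hβ)
  have hmp := measurePreserving_drawsLaw (ν := ν) (k := k) (r := r) hd
  have hmC : Measurable fun w : Fin k → ℕ → S × I =>
      ((tpaUnion H βmin βmax φ w).card : ℝ≥0∞) := by
    have := (measurable_of_countable (fun i : ℕ => (i : ℝ≥0∞))).comp (measurable_card (k := k) hφ)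
    simpa only [Function.comp_def] using this
  have hmL : Measurable fun q : (Fin k → ℕ → S × I) × Fin d =>
      ((scheduleOf (tpaUnion H βmin βmax φ q.1) βmin βmax q.2).length : ℝ≥0∞) := by
    have := (measurable_of_countable (fun i : ℕ => (i : ℝ≥0∞))).comp
      (measurable_length_scheduleOf (k := k) (d := d) hφ)
    simpa only [Function.comp_def] using this
  set A : (Fin k → ℕ → S × I) × Fin d → ℝ≥0∞ := fun q =>
    (tpaUnion H βmin βmax φ q.1).card + u
      + r * (scheduleOf (tpaUnion H βmin βmax φ q.1) βmin βmax q.2).length with hA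
  have hmA : Measurable A :=
    ((hmC.comp measurable_fst).add_const _).add (hmL.const_mul _)
  have hae : ∀ᵐ ω ∂(drawsLaw ν d k r), ((F ω : ℕ∞) : ℝ≥0∞) = A (ω.1, ω.2.2) := by
    have : ∀ᵐ ω ∂(drawsLaw ν d k r), ∀ j, ∃ n, HasSize H βmin βmax φ n βmin (ω.1 j) :=
      Measure.quasiMeasurePreserving_fst.ae (ae_forall_hasSize hφ hH hβ)
    filter_upwards [this] with ω hω
    rw [hF ω hω]
    simp only [hA, schedule, scheduleOf, ENat.toENNReal_add, ENat.toENNReal_mul,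
      ENat.toENNReal_coe]
  have hmA' : Measurable fun ω : Draws S d k r => A (ω.1, ω.2.2) := by
    have := hmA.comp (f := fun ω : Draws S d k r => (ω.1, ω.2.2)) (by fun_prop)
    simpa only [Function.comp_def] using this
  have hmA'' : Measurable fun q : ((Fin k → ℕ → S × I) × Fin d) × (Fin r → ℕ → S) => A q.1 := by
    have := hmA.comp (f := fun q : ((Fin k → ℕ → S × I) × Fin d) × (Fin r → ℕ → S) => q.1)
      (by fun_prop)
    simpa only [Function.comp_def] using this
  rw [lintegral_congr_ae hae, ← hmp.lintegral_comp hmA', lintegral_prod _ hmA''.aemeasurable]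
  simp only [lintegral_const, measure_univ, mul_one]
  rw [lintegral_prod _ hmA.aemeasurable]
  have e : ∀ w : Fin k → ℕ → S × I, ∫⁻ c, A (w, c) ∂(uniformOn (Set.univ : Set (Fin d)))
      = (1 + r / d) * ((tpaUnion H βmin βmax φ w).card : ℝ≥0∞) + (u + r * 2) := fun w => by
    have hmc : Measurable fun c : Fin d =>
        ((scheduleOf (tpaUnion H βmin βmax φ w) βmin βmax c).length : ℝ≥0∞) :=
      measurable_of_countable _
    simp only [hA]
    rw [lintegral_add_left measurable_const, lintegral_const, measure_univ, mul_one,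
      lintegral_const_mul _ hmc, lintegral_length_scheduleOf hd]
    simp only [div_eq_mul_inv]
    ring
  rw [lintegral_congr e, lintegral_add_right _ measurable_const, lintegral_const, measure_univ,
    mul_one, lintegral_const_mul _ hmC, lintegral_card_tpaUnion hφ hH hβ]
  have h1 : (1 + r / d : ℝ≥0∞) = ENNReal.ofReal (1 + r / d) := by
    rw [ENNReal.ofReal_add zero_le_one (by positivity), ENNReal.ofReal_one,
      ENNReal.ofReal_div_of_pos hd', ENNReal.ofReal_natCast, ENNReal.ofReal_natCast]
  have h2 : (u + r * 2 : ℝ≥0∞) = ENNReal.ofReal (u + r * 2) := by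
    rw [ENNReal.ofReal_add (by positivity) (by positivity), ENNReal.ofReal_mul (by positivity),
      ENNReal.ofReal_natCast, ENNReal.ofReal_natCast, ENNReal.ofReal_ofNat]
  rw [h1, h2, ← ENNReal.ofReal_mul (by positivity),
    ← ENNReal.ofReal_add (by positivity) (by positivity)]
  congr 1
  rw [hm]; field_simp; ring

end ExpectedCalls

/-! ### The numerical example and the asymptotics of the parameters -/

section Numerics

/-- Here 96 = 1.5 · 64 is τd, 1/76 = 1 - 0.75/0.76 is 1 - ρ, and 0.0408 is τ⁺. The factor 65/64 is
65!/(64 · 64!). -/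
lemma erlangTail_65_96_le : 65 / 64 * erlangTail 65 96 ≤ 0.0408 / 76 := by
  have hs : ∑ i ∈ Finset.range 66, (96 : ℝ) ^ i / i.factorial
      ≤ 0.0408 / 76 * (64 / 65) * 2.7182818283 ^ 96 := by
    norm_num [Finset.sum_range_succ, Nat.factorial]
  have he : (2.7182818283 : ℝ) ^ 96 ≤ Real.exp 96 := by
    rw [show (96 : ℝ) = (96 : ℕ) * 1 by norm_num, Real.exp_nat_mul]
    exact pow_le_pow_left₀ (by norm_num) Real.exp_one_gt_d9.le 96
  have h1 : erlangTail 65 96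
      = Real.exp (-96) * ∑ i ∈ Finset.range 66, (96 : ℝ) ^ i / i.factorial := by
    rw [erlangTail, Finset.mul_sum]
    exact Finset.sum_congr rfl fun i _ => by rw [mul_div_assoc]
  have h2 : erlangTail 65 96 ≤ Real.exp (-96) * (0.0408 / 76 * (64 / 65) * Real.exp 96) := by
    rw [h1]; gcongr; exact hs.trans (by gcongr)
  have h3 : Real.exp (-96) * (0.0408 / 76 * (64 / 65) * Real.exp 96) = 0.0408 / 76 * (64 / 65) := by
    rw [mul_comm, mul_assoc, ← Real.exp_add]; norm_num
  rw [h3] at h2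
  linarith

lemma tauRho_64_le : tauRho (0.75 / (1 - 0.24)) 64 ≤ 1.5408 := by
  refine csInf_le ⟨0, ?_⟩ ⟨1.5, 0.0408, by norm_num, by norm_num, ?_, by norm_num⟩
  · rintro _ ⟨τ, τp, h1, h2, -, rfl⟩; linarith
  · have h := upperGamma_eq 64 (c := 96) (by norm_num)
    have h64 : ((64 : ℕ).factorial : ℝ) ≠ 0 := by positivity
    rw [show (1.5 : ℝ) * (64 : ℕ) = 96 by norm_num, h, Nat.factorial_succ]
    have e : ((64 + 1 : ℕ) * (64 : ℕ).factorial : ℕ) * erlangTail (64 + 1) 96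
        / (0.0408 * (64 : ℕ) * (64 : ℕ).factorial) = 65 / 64 * erlangTail 65 96 / 0.0408 := by
      push_cast; field_simp
    rw [e, div_le_iff₀ (by norm_num)]
    refine erlangTail_65_96_le.trans ?_
    norm_num

lemma exp_neg_seven_le : Real.exp (-7) ≤ 1 / 1096 := by
  rw [Real.exp_neg, ← one_div]
  refine one_div_le_one_div_of_le (by norm_num) ?_
  rw [show (7 : ℝ) = (7 : ℕ) * 1 by norm_num, Real.exp_nat_mul]
  refine le_trans ?_ (pow_le_pow_left₀ (by norm_num) Real.exp_one_gt_d9.le 7)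
  norm_num

lemma le_log_numeric : 0.214 ≤ Real.log (1.24 * (1 - Real.exp (-7))) := by
  have h := exp_neg_seven_le
  rw [Real.le_log_iff_exp_le (by nlinarith)]
  refine (Real.exp_bound' (by norm_num) (by norm_num) (n := 5) (by norm_num)).trans ?_
  refine le_trans (b := 1.24 * (1 - 1 / 1096)) ?_ (by nlinarith)
  norm_num [Finset.sum_range_succ, Nat.factorial]

/-- The choice of r gives r ε̃² ≥ 2, so the factor is at least 1 + 0.12 · 2 = 1.24, and λ = e^{-7}
turns 2 + ln(n/λ) into 9 + ln n. The constants fit because 3.6 · 2 · 0.214 = 1.5408. -/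
theorem sizeCondition_example {n ε m : ℝ} (hn : 1 ≤ n) (hε : 0 < ε)
    (hm : 3.6 * (9 + Real.log n) ≤ m) :
    SizeCondition n ε m 64 ⌈2 * (epsTilde ε) ^ (-2 : ℤ)⌉₊ 0.24 (Real.exp (-7)) := by
  have hη := epsTilde_pos hε
  have h7 := exp_neg_seven_le
  set r := ⌈2 * (epsTilde ε) ^ (-2 : ℤ)⌉₊ with hr
  have hR : 2 ≤ r * epsTilde ε ^ 2 := by
    have := Nat.le_ceil (2 * (epsTilde ε) ^ (-2 : ℤ))
    rw [← hr] at this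
    calc (2 : ℝ) = 2 * (epsTilde ε) ^ (-2 : ℤ) * epsTilde ε ^ 2 := by
          rw [zpow_neg, zpow_ofNat]; field_simp
      _ ≤ _ := by gcongr
  have hX : (1.24 : ℝ) ≤ 1 + 1 / 2 * 0.24 * r * epsTilde ε ^ 2 := by
    have : (1 / 2 * 0.24 * r * epsTilde ε ^ 2 : ℝ) = 0.12 * (r * epsTilde ε ^ 2) := by ring
    rw [this]; linarith
  have hXl : 1.24 * (1 - Real.exp (-7))
      ≤ (1 + 1 / 2 * 0.24 * r * epsTilde ε ^ 2) * (1 - Real.exp (-7)) := by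
    gcongr; linarith
  have hL := le_log_numeric.trans (Real.log_le_log (by nlinarith) hXl)
  have hlogn := Real.log_nonneg hn
  refine ⟨lt_of_lt_of_le (by nlinarith) hXl, ?_⟩
  rw [Real.log_div (by linarith) (Real.exp_pos _).ne', Real.log_exp, ge_iff_le,
    div_le_iff₀ (by linarith)]
  set L := Real.log ((1 + 1 / 2 * 0.24 * r * epsTilde ε ^ 2) * (1 - Real.exp (-7)))
  have hm0 : 0 ≤ m := by linarith
  calc tauRho (0.75 / (1 - 0.24)) 64 * (2 + (Real.log n - -7))
      ≤ 1.5408 * (9 + Real.log n) := by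
        rw [show 2 + (Real.log n - -7) = 9 + Real.log n by ring]
        exact mul_le_mul_of_nonneg_right tauRho_64_le (by linarith)
    _ = 3.6 * (9 + Real.log n) * (2 * 0.214) := by ring
    _ ≤ m * (2 * L) := by gcongr

end Numerics

/-! ### Asymptotics of the tolerance and of the sample size -/

section Asymptotics

/-- `ε / epsTilde ε`, as a continuous function of `ε`. -/
def epsRatio (e : ℝ) : ℝ := Real.sqrt (1 + e) * (Real.sqrt (1 + e) + 1)

/-- With s = √(1+e) one has 1 - 1/s = (s² - 1)/(s(s+1)), which exhibits the simple zero at e = 0. -/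
lemma epsTilde_eq {e : ℝ} (he : -1 < e) : epsTilde e = e / epsRatio e := by
  have hs0 : 0 < Real.sqrt (1 + e) := Real.sqrt_pos.2 (by linarith)
  have hs2 := Real.sq_sqrt (show 0 ≤ 1 + e by linarith)
  rw [epsTilde, Real.rpow_neg (by linarith), ← Real.sqrt_eq_rpow, epsRatio]
  field_simp
  linarith

lemma isBigO_epsTilde_sub :
    (fun e : ℝ => epsTilde e - 1 / 2 * e) =O[𝓝 0] (fun e : ℝ => e ^ 2) := by
  refine IsBigO.of_bound 2 ?_
  -- On this neighbourhood s ≥ ½, which keeps the explicit coefficient of e² in the remainder below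
  -- 2.
  filter_upwards [Ioi_mem_nhds (show (-(3 / 4) : ℝ) < 0 by norm_num)] with e he
  have he' : -(3 / 4) < e := he
  rw [epsTilde_eq (by linarith), epsRatio]
  set s := Real.sqrt (1 + e) with hs
  have hs2 : s ^ 2 = 1 + e := Real.sq_sqrt (by linarith)
  have hs1 : 1 / 2 ≤ s := Real.le_sqrt_of_sq_le (by linarith)
  have hs0 : 0 < s := by linarith
  have h : e / (s * (s + 1)) - 1 / 2 * e = -(e ^ 2 * ((s + 2) / (2 * s * (s + 1) ^ 2))) := by
    have : e = s ^ 2 - 1 := by linarith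
    rw [this]; field_simp; ring
  have h2 : (s + 2) / (2 * s * (s + 1) ^ 2) ≤ 2 := by
    rw [div_le_iff₀ (by positivity)]; nlinarith [sq_nonneg s]
  rw [h, norm_neg, norm_mul, mul_comm, Real.norm_of_nonneg
    (show 0 ≤ (s + 2) / (2 * s * (s + 1) ^ 2) by positivity)]
  gcongr

lemma isEquivalent_two_mul_epsTilde :
    (fun e : ℝ => 2 * epsTilde e ^ (-2 : ℤ)) ~[𝓝[>] 0] (fun e : ℝ => 8 * e ^ (-2 : ℤ)) := by
  refine isEquivalent_of_tendsto_one ?_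
  have hc : Continuous fun e => (epsRatio e) ^ 2 / 4 := by unfold epsRatio; fun_prop
  have h1 : epsRatio 0 ^ 2 / 4 = 1 := by norm_num [epsRatio]
  have ht := (hc.tendsto 0).mono_left (nhdsWithin_le_nhds (s := Set.Ioi 0))
  rw [h1] at ht
  refine ht.congr' (eventually_nhdsWithin_of_forall fun e he => ?_)
  have he' : (0 : ℝ) < e := he
  have hr : epsRatio e ≠ 0 := by
    have : 0 < Real.sqrt (1 + e) := Real.sqrt_pos.2 (by linarith)
    unfold epsRatio; positivity
  simp only [Pi.div_apply]
  rw [epsTilde_eq (by linarith), zpow_neg, zpow_neg, zpow_ofNat, zpow_ofNat]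
  field_simp
  norm_num

/-- The ceiling does not affect the asymptotics because its argument tends to infinity. -/
lemma isEquivalent_ceil_epsTilde :
    (fun e : ℝ => (⌈2 * (epsTilde e) ^ (-2 : ℤ)⌉₊ : ℝ)) ~[𝓝[>] 0]
      (fun e : ℝ => 8 * e ^ (-2 : ℤ)) := by
  have h := isEquivalent_two_mul_epsTilde
  have ht : Tendsto (fun e : ℝ => 8 * e ^ (-2 : ℤ)) (𝓝[>] 0) atTop := by
    refine Tendsto.const_mul_atTop (by norm_num) ?_
    have : Tendsto (fun e : ℝ => (e⁻¹) ^ 2) (𝓝[>] 0) atTop :=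
      (tendsto_pow_atTop two_ne_zero).comp tendsto_inv_nhdsGT_zero
    refine this.congr fun e => ?_
    rw [zpow_neg, zpow_ofNat, inv_pow]
  have hc : (fun e : ℝ => (⌈2 * (epsTilde e) ^ (-2 : ℤ)⌉₊ : ℝ)) ~[𝓝[>] 0]
      (fun e : ℝ => 2 * epsTilde e ^ (-2 : ℤ)) :=
    isEquivalent_nat_ceil.comp_tendsto (h.symm.tendsto_atTop ht)
  exact hc.trans h

end Asymptotics

end GibbsTPA

end

/-! ### The main theorem -/

theorem mainTheorem2 {Ω : Type*} [Fintype Ω] (H : Ω → ℝ) (n : ℝ) (hn : 1 ≤ n)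
    (hH : ∀ x, H x = 0 ∨ H x ∈ Set.Icc 1 n)
    (βmin βmax : ℝ) (hβ : βmin < βmax)
    {S : Type*} [MeasurableSpace S] (ν : Measure S) [IsProbabilityMeasure ν] (φ : ℝ → S → Ω)
    (hφ : GibbsTPA.IsSamplingOracle H βmin βmax ν φ)
    (ε : ℝ) (hε : 0 < ε) (d k r : ℕ) (hd : 1 ≤ d) (hk : 1 ≤ k) (hr : 1 ≤ r)
    (m : ℝ) (hm : (k : ℝ) = m * d)
    (Q q : ℝ) (hQ : Q = GibbsTPA.partitionFn H βmin / GibbsTPA.partitionFn H βmax)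
    (hq : q = Real.log Q) :
    ((∃ γ ∈ Set.Ioo (0 : ℝ) 0.25, ∃ lam ∈ Set.Ioo (0 : ℝ) 1,
        GibbsTPA.SizeCondition n ε m d r γ lam) →
      ENNReal.ofReal 0.75 ≤ GibbsTPA.drawsLaw ν d k r
        {ω | GibbsTPA.estimate H βmin βmax φ ω ∈ Set.Ioo (Q / (1 + ε)) (Q * (1 + ε))} ∧
      ∫⁻ ω, ((GibbsTPA.oracleCalls H βmin βmax φ ω : ℕ∞) : ℝ≥0∞) ∂(GibbsTPA.drawsLaw ν d k r)
        = ENNReal.ofReal (m * q * (r + d) + 2 * r + m * d) ∧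
      ∫⁻ ω, ((GibbsTPA.mergedCalls H βmin βmax φ ω : ℕ∞) : ℝ≥0∞) ∂(GibbsTPA.drawsLaw ν d k r)
        = ENNReal.ofReal (m * q * (r + d) + 2 * r + 1)) ∧
    (∀ m' : ℝ, 3.6 * (9 + Real.log n) ≤ m' →
      GibbsTPA.SizeCondition n ε m' 64 ⌈2 * (GibbsTPA.epsTilde ε) ^ (-2 : ℤ)⌉₊
        0.24 (Real.exp (-7))) ∧
    (fun e : ℝ => GibbsTPA.epsTilde e - 1 / 2 * e) =O[𝓝 0] (fun e : ℝ => e ^ 2) ∧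
    (fun e : ℝ => (⌈2 * (GibbsTPA.epsTilde e) ^ (-2 : ℤ)⌉₊ : ℝ)) ~[𝓝[>] 0]
      (fun e : ℝ => 8 * e ^ (-2 : ℤ)) := by
  have : Nonempty Ω := GibbsTPA.nonempty_of_oracle ν φ
  have hH0 : ∀ x, 0 ≤ H x := fun x => by
    rcases hH x with h | h
    · exact h.ge
    · linarith [h.1]
  have hq' : q = GibbsTPA.logZ H βmin - GibbsTPA.logZ H βmax := by
    rw [hq, hQ, Real.log_div (GibbsTPA.partitionFn_pos H _).ne'
      (GibbsTPA.partitionFn_pos H _).ne']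
    rfl
  refine ⟨?_, fun m' hm' => GibbsTPA.sizeCondition_example hn hε hm',
    GibbsTPA.isBigO_epsTilde_sub, GibbsTPA.isEquivalent_ceil_epsTilde⟩
  rintro ⟨γ, hγ, lam, hlam, hS⟩
  refine ⟨?_, ?_, ?_⟩
  · rw [hQ]
    exact GibbsTPA.le_drawsLaw_estimate hφ hn hH hβ.le hk hd hr hm hε hγ hlam hS
  -- Each of the k = md runs makes one call more than it has points; the merged count below adds a
  -- single call instead.
  · rw [GibbsTPA.lintegral_calls hφ hH0 hβ.le hd hm k fun ω hω => by
      rw [GibbsTPA.oracleCalls, GibbsTPA.sum_tpaCalls_eq hω], hq', hm]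
  · rw [GibbsTPA.lintegral_calls hφ hH0 hβ.le hd hm 1 fun ω hω => by
      rw [GibbsTPA.mergedCalls, GibbsTPA.sum_tpaSize_eq hω, Nat.cast_one], hq', Nat.cast_one]
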